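/- For $x\in\mathbb R^{\mathbb N}$ let $x^*_n=\inf\{s\ge 0:\#\{k:|x_k|>s\}\le n\}\in[0,\infty]$, $n\ge 0$, be its decreasing rearrangement, and write $y\prec\prec x$ if $\sum_{k<n}y^*_k\le\sum_{k<n}x^*_k$ for all $n$. A symmetric sequence space is a nonzero Banach space $(E,\|\cdot\|_E)$ of real sequences such that $x\in E$, $y^*\le x^*$ imply $y\in E$, and $x,y\in E$, $y\prec\prec x$ imply $\|y\|_E\le\|x\|_E$. For $n\ge1$ let $(\sigma_nx)_k=x_{\lfloor k/n\rfloor}$ and $(\sigma_{1/n}x)_k=\frac1n\sum_{j<n}x_{nk+j}$. The Boyd indices of $E$ are $$\alpha_E=\lim_{n\to\infty}\frac{\log\|\sigma_{1/n}\|_{E\to E}}{\log(1/n)},\qquad \beta_E=\lim_{n\to\infty}\frac{\log\|\sigma_n\|_{E\to E}}{\log n};$$ they are called trivial if $\alpha_E=0$ or $\beta_E=1$. Let $\mathfrak S^E$ be the set of all compact operators $T$ on the complex Hilbert space $\ell_2(\mathbb N)$ whose sequence of singular numbers $s(T)$ belongs to $E$, with the norm $\|T\|_{\mathfrak S^E}=\|s(T)\|_E$.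 **Corollary.** For every separable symmetric sequence space $E$ with trivial Boyd indices there exist a $C^1$-function $f_E:\mathbb R\to\mathbb R$ with $f_E(0)=0$, a self-adjoint operator $W\in\mathfrak S^E$ and a (possibly unbounded) self-adjoint operator $X$ on $\ell_2(\mathbb N)$ such that the maps $\alpha_t(T)=e^{itX}Te^{-itX}$, $t\in\mathbb R$, form a $C_0$-group on $\mathfrak S^E$ whose generator $$\delta(T)=\|\cdot\|_{\mathfrak S^E}\text{-}\lim_{t\to0}\frac{\alpha_t(T)-T}{t},\qquad \operatorname{Dom}\delta=\{T\in\mathfrak S^E:\text{this limit exists in }\mathfrak S^E\},$$ is a closed densely defined symmetric derivation on $\mathfrak S^E$ (that is, $\operatorname{Dom}\delta$ is closed under adjoints and products, $\delta(T^*)=\delta(T)^*$ and $\delta(TS)=\delta(T)S+T\delta(S)$), and $$W\in\operatorname{Dom}\delta,\qquad f_E(W)\in\mathfrak S^E,\qquad f_E(W)\notin\operatorname{Dom}\delta .$$ -/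

import Mathlib

open Filter Topology

noncomputable section

/-! ### Symmetric sequence spaces -/

/-- The decreasing rearrangement of a sequence `x`:
`x* n = inf {s ≥ 0 : #{k : |x k| > s} ≤ n}`, with values in `[0, ∞]`. -/
def decRearr (x : ℕ → ℝ) (n : ℕ) : ENNReal :=
  sInf {s : ENNReal | {k : ℕ | s < ‖x k‖ₑ}.encard ≤ (n : ℕ∞)}

/-- Hardy-Littlewood-Polya submajorization `y ≺≺ x`. -/
def Submajorized (y x : ℕ → ℝ) : Prop :=
  ∀ n : ℕ, ∑ k ∈ Finset.range n, decRearr y k ≤ ∑ k ∈ Finset.range n, decRearr x k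

/-- A symmetric Banach sequence space: a nonzero rearrangement invariant Banach space of real
sequences whose norm is monotone for submajorization. Only the values of `nrm` on `carrier`
matter. -/
structure SymmetricSequenceSpace where
  carrier : Submodule ℝ (ℕ → ℝ)
  nrm : (ℕ → ℝ) → ℝ
  nrm_add_le : ∀ x ∈ carrier, ∀ y ∈ carrier, nrm (x + y) ≤ nrm x + nrm y
  nrm_smul : ∀ (c : ℝ), ∀ x ∈ carrier, nrm (c • x) = |c| * nrm x
  eq_zero_of_nrm : ∀ x ∈ carrier, nrm x = 0 → x = 0
  complete : ∀ u : ℕ → ℕ → ℝ, (∀ n, u n ∈ carrier) →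
    (∀ ε > 0, ∃ N, ∀ m ≥ N, ∀ n ≥ N, nrm (u m - u n) < ε) →
    ∃ x ∈ carrier, Tendsto (fun n => nrm (u n - x)) atTop (𝓝 0)
  nontrivial : ∃ x ∈ carrier, x ≠ 0
  mem_of_rearr_le : ∀ x ∈ carrier, ∀ y : ℕ → ℝ,
    (∀ n, decRearr y n ≤ decRearr x n) → y ∈ carrier
  nrm_le_of_submajorized : ∀ x ∈ carrier, ∀ y ∈ carrier, Submajorized y x → nrm y ≤ nrm x

/-- The dilation `σ_n`: every term of the sequence is repeated `n` times. -/
def dilate (n : ℕ) (x : ℕ → ℝ) : ℕ → ℝ := fun k => x (k / n)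

/-- The dilation `σ_{1/n}`: averages over consecutive blocks of length `n`. -/
def contract (n : ℕ) (x : ℕ → ℝ) : ℕ → ℝ :=
  fun k => (n : ℝ)⁻¹ * ∑ j ∈ Finset.range n, x (n * k + j)

namespace SymmetricSequenceSpace

variable (E : SymmetricSequenceSpace)

/-- `E` is separable in its norm. -/
def IsSeparable : Prop :=
  ∃ D : Set (ℕ → ℝ), D.Countable ∧ D ⊆ E.carrier ∧
    ∀ x ∈ E.carrier, ∀ ε > 0, ∃ d ∈ D, E.nrm (x - d) < ε

/-- The operator norm of `σ : E → E`. -/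
def opNorm (σ : (ℕ → ℝ) → ℕ → ℝ) : ℝ :=
  sInf {C : ℝ | 0 ≤ C ∧ ∀ x ∈ E.carrier, E.nrm (σ x) ≤ C * E.nrm x}

/-- The lower Boyd index `lim_{τ → 0} log ‖σ_τ‖ / log τ` (along `τ = 1/n`) equals `a`. -/
def HasLowerBoydIndex (a : ℝ) : Prop :=
  Tendsto (fun n : ℕ => Real.log (E.opNorm (contract n)) / Real.log ((n : ℝ)⁻¹)) atTop (𝓝 a)

/-- The upper Boyd index `lim_{τ → ∞} log ‖σ_τ‖ / log τ` (along `τ = n`) equals `b`. -/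
def HasUpperBoydIndex (b : ℝ) : Prop :=
  Tendsto (fun n : ℕ => Real.log (E.opNorm (dilate n)) / Real.log (n : ℝ)) atTop (𝓝 b)

/-- At least one of the two Boyd indices takes its extreme value. -/
def HasTrivialBoydIndex : Prop := E.HasLowerBoydIndex 0 ∨ E.HasUpperBoydIndex 1

end SymmetricSequenceSpace

/-! ### Ideals of compact operators -/

/-- The complex Hilbert space `ℓ₂(ℕ)`. -/
abbrev Hl2 : Type := lp (fun _ : ℕ => ℂ) 2

/-- The bounded operators on `ℓ₂(ℕ)`. -/
abbrev Bl2 : Type := Hl2 →L[ℂ] Hl2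

/-- The singular numbers (counted with multiplicity, indexed from `0`) of an operator, as
approximation numbers `s_n(T) = inf {‖T - F‖ : rank F ≤ n}`. -/
def singularNumber (T : Bl2) (n : ℕ) : ℝ :=
  sInf {r : ℝ | ∃ F : Bl2, (F : Hl2 →ₗ[ℂ] Hl2).rank ≤ (n : Cardinal) ∧ r = ‖T - F‖}

/-- The operator `f(W)`, for a self-adjoint operator `W` and a function `f` on the real line, by the
continuous functional calculus (the spectrum of `W` is real). -/
def funCalc (f : ℝ → ℝ) (W : Bl2) : Bl2 := cfc (fun z : ℂ => (f z.re : ℂ)) W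

namespace SymmetricSequenceSpace

variable (E : SymmetricSequenceSpace)

/-- The ideal `𝔖^E` of all compact operators whose singular number sequence lies in `E`. -/
def ideal : Set Bl2 := {T | IsCompactOperator T ∧ singularNumber T ∈ E.carrier}

/-- The norm of `𝔖^E`. -/
def idealNorm (T : Bl2) : ℝ := E.nrm (singularNumber T)

end SymmetricSequenceSpace

/-! ### One-parameter groups and their generators -/

/-- `U t = e^{itX}` for all real `t`: `U` is the strongly continuous one-parameter unitary group
with infinitesimal generator `iX`. -/
structure IsUnitaryGroupOf (X : Hl2 →ₗ.[ℂ] Hl2) (U : ℝ → Bl2) : Prop where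
  unitary : ∀ t, U t ∈ unitary Bl2
  zero : U 0 = 1
  add : ∀ s t, U (s + t) = U s * U t
  continuous : ∀ ξ : Hl2, Continuous fun t => U t ξ
  generator : ∀ ξ η : Hl2, (ξ, η) ∈ X.graph ↔
    Tendsto (fun t : ℝ => (t : ℂ)⁻¹ • (U t ξ - ξ)) (𝓝[≠] 0) (𝓝 (Complex.I • η))

/-- The automorphisms `α t T = e^{itX} T e^{-itX}`, where `U t = e^{itX}`. -/
def conjFlow (U : ℝ → Bl2) (t : ℝ) (T : Bl2) : Bl2 := U t * T * U (-t)

namespace SymmetricSequenceSpace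

variable (E : SymmetricSequenceSpace)

/-- The group `α` acts on `𝔖^E`, strongly continuously for the norm of `𝔖^E`. -/
def IsC0Flow (U : ℝ → Bl2) : Prop :=
  (∀ t, ∀ T ∈ E.ideal, conjFlow U t T ∈ E.ideal) ∧
  ∀ T ∈ E.ideal, ∀ t₀ : ℝ,
    Tendsto (fun t : ℝ => E.idealNorm (conjFlow U t T - conjFlow U t₀ T)) (𝓝 t₀) (𝓝 0)

/-- `δ` is the infinitesimal generator of `α` on `𝔖^E`: its domain consists of all `T ∈ 𝔖^E` for
which `(α t T - T) / t` converges in `𝔖^E` as `t → 0`, and `δ T` is this limit. -/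
def IsGeneratorOnIdeal (U : ℝ → Bl2) (δ : Bl2 →ₗ.[ℂ] Bl2) : Prop :=
  ∀ T D : Bl2, (T, D) ∈ δ.graph ↔ T ∈ E.ideal ∧ D ∈ E.ideal ∧
    Tendsto (fun t : ℝ => E.idealNorm ((t : ℂ)⁻¹ • (conjFlow U t T - T) - D)) (𝓝[≠] 0) (𝓝 0)

/-- `δ` is a closed densely defined symmetric derivation on `𝔖^E`. -/
structure IsClosedSymmetricDerivation (δ : Bl2 →ₗ.[ℂ] Bl2) : Prop where
  domain_subset : ∀ T ∈ δ.domain, T ∈ E.ideal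
  range_subset : ∀ T : δ.domain, δ T ∈ E.ideal
  dense : ∀ T ∈ E.ideal, ∀ ε > 0, ∃ S ∈ δ.domain, E.idealNorm (T - S) < ε
  closed : ∀ (u : ℕ → δ.domain), ∀ T ∈ E.ideal, ∀ D ∈ E.ideal,
    Tendsto (fun n => E.idealNorm ((u n : Bl2) - T)) atTop (𝓝 0) →
    Tendsto (fun n => E.idealNorm (δ (u n) - D)) atTop (𝓝 0) → (T, D) ∈ δ.graph
  symmetric : ∀ T : δ.domain, (star (T : Bl2), star (δ T)) ∈ δ.graph
  leibniz : ∀ T S : δ.domain, ((T : Bl2) * S, δ T * S + T * δ S) ∈ δ.graph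

end SymmetricSequenceSpace

end

/-!
The operator `X` is assembled from finite blocks on which commutators can be computed explicitly.

**One block.** Let `P` and `Q` be spectral subspaces of a self-adjoint `W` on which `W` has the
eigenvalues `aᵢ = τ 3ⁱ` and `-aⱼ`. The commutator with `W` multiplies the `(i, j)` entry of an
operator `Q → P` by `-(aᵢ + aⱼ)`, the commutator with `f(W)`, for even `f`, by `f(aⱼ) - f(aᵢ)`. If
`f` looks like `c |t|` at the scales `aᵢ`, the quotient of the two multipliers is about
`± c`, with the sign of `i - j`: passing from `[X, W]` to `[X, f(W)]` is essentially triangular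
truncation. Its norm on `𝔖^E` is unbounded when a Boyd index is trivial
(`exists_tensorOp_of_trivial`): the Hilbert matrix `1 / (i - j)` has norm at most `π`
(`hilbert_inequality`), while its entrywise absolute value has row sums of order `log N`.

* If `α_E = 0`, there are `y` whose dilation `σ_N y` has norm comparable to that of `y`. The
  operator `(Hilbert matrix) ⊗ y` then has norm at most a constant times `‖y‖`, being a bounded
  operator times a diagonal operator with singular numbers `σ_N y`. After truncation, averaging over
  the matrix index produces a diagonal operator with entries `≈ log N · y`.
* If `β_E = 1`, there are `y` with `‖σ_N y‖` comparable to `N ‖y‖`. The operator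
  `(all-ones matrix) ⊗ y` has norm `N ‖y‖`. Its truncation, tested against the Hilbert matrix, has
  Ky Fan norms at least `log N / N` times those of `σ_N y`, up to a constant.

Trace duality enters only through Bessel functionals `T ↦ ∑ ⟨fᵢ, T eᵢ⟩`. They are bounded by the Ky
Fan norms (`norm_pairing_le_sum_singularNumber`), which gives the second estimate, and conversely
they control the Ky Fan norms (`sum_singularNumber_le_of_pairing_le`), which is used for the
difference quotients of the flow.

**All blocks.** The function `f(t) = ∑ 2⁻ⁿ (√(t² + sₙ²) - sₙ)` is continuously differentiable, but
at scales above `sₙ` its `n`-th summand resembles `2⁻ⁿ |t|`. For the `n`-th block the size `N` is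
chosen large enough to beat the factor `2⁻ⁿ`, and then `sₙ` and the scales small (`exists_block`):
`W` and `[X, W]` have norm at most `8⁻ⁿ` on it, but `[X, f(W)]` has norm at least `n`. The
orthogonal sum of these blocks is the required `W`, and `X` has an orthonormal basis of
eigenvectors since each of its blocks does.

**The derivation.** For a diagonal operator `X` with eigenvalues `xᵢ` in the orthonormal basis `v`,
the generator of `T ↦ e^{itX} T e^{-itX}` on `𝔖^E` is described entrywise: `D = δ(T)` if and only if
`T`, `D` belong to `𝔖^E` and `⟨vᵢ, D vⱼ⟩ = i (xᵢ - xⱼ) ⟨vᵢ, T vⱼ⟩` for all `i`, `j`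
(`isGeneratorOnIdeal_derivation`, `mem_derivation_graph`). Separability of `E` enters through order
continuity of the norm (`tendsto_nrm_tail`), which makes compressions to finitely many basis
vectors converge in `𝔖^E`. The first half of the construction then gives `δ(W)`, as the sum of the
commutators of the blocks; and a value `δ(f(W))` would have norm at least `n` for every `n`, because
its compression to the `n`-th block is a multiple of the `n`-th commutator.
-/

/-! ### Decreasing rearrangements -/

theorem decRearr_le_of_injOn {x y : ℕ → ℝ} (π : ℕ → ℕ) (hπ : Set.InjOn π {k | y k ≠ 0})
    (h : ∀ k, y k ≠ 0 → |y k| ≤ |x (π k)|) (n : ℕ) : decRearr y n ≤ decRearr x n := by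
  apply sInf_le_sInf
  intro s hs
  refine le_trans (Set.encard_le_encard_of_injOn (f := π) ?_ ?_) hs
  · intro k hk
    have hk0 : y k ≠ 0 := by
      intro h0
      simp [h0] at hk
    simp only [Set.mem_ofPred_eq] at hk ⊢
    refine lt_of_lt_of_le hk ?_
    rw [← ofReal_norm, ← ofReal_norm]
    exact ENNReal.ofReal_le_ofReal (h k hk0)
  · intro k hk l hl
    refine hπ ?_ ?_
    · intro h0
      simp [h0] at hk
    · intro h0
      simp [h0] at hl

theorem decRearr_antitone (x : ℕ → ℝ) : Antitone (decRearr x) := by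
  intro m n hmn
  apply sInf_le_sInf
  intro s hs
  exact le_trans (α := ℕ∞) hs (by exact_mod_cast hmn)

/-- A non-increasing non-negative sequence is its own decreasing rearrangement. -/
theorem decRearr_of_antitone {a : ℕ → ℝ} (ha : Antitone a) (h0 : ∀ n, 0 ≤ a n) (n : ℕ) :
    decRearr a n = ENNReal.ofReal (a n) := by
  have he : ∀ k, ‖a k‖ₑ = ENNReal.ofReal (a k) := fun k => by
    rw [← ofReal_norm, Real.norm_of_nonneg (h0 k)]
  apply le_antisymm
  · apply sInf_le
    have : {k : ℕ | ENNReal.ofReal (a n) < ‖a k‖ₑ} ⊆ (Finset.range n : Set ℕ) := by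
      intro k hk
      simp only [Set.mem_ofPred_eq, he] at hk
      simp only [Finset.coe_range, Set.mem_Iio]
      by_contra hc
      exact absurd hk (not_lt.2 (ENNReal.ofReal_le_ofReal (ha (not_lt.1 hc))))
    refine (Set.encard_le_encard this).trans ?_
    rw [Set.encard_coe_eq_coe_finsetCard, Finset.card_range]
  · apply le_sInf
    intro s hs
    by_contra hc
    have : (Finset.range (n + 1) : Set ℕ) ⊆ {k : ℕ | s < ‖a k‖ₑ} := by
      intro k hk
      simp only [Finset.coe_range, Set.mem_Iio] at hk
      simp only [Set.mem_ofPred_eq, he]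
      exact lt_of_lt_of_le (not_le.1 hc) (ENNReal.ofReal_le_ofReal (ha (by omega)))
    have h1 := (Set.encard_le_encard this).trans hs
    rw [Set.encard_coe_eq_coe_finsetCard] at h1
    simp only [Finset.card_range] at h1
    have : n + 1 ≤ n := by exact_mod_cast h1
    omega

theorem submajorized_of_antitone {a b : ℕ → ℝ} (ha : Antitone a) (ha0 : ∀ n, 0 ≤ a n)
    (hb : Antitone b) (hb0 : ∀ n, 0 ≤ b n)
    (h : ∀ n, ∑ k ∈ Finset.range n, a k ≤ ∑ k ∈ Finset.range n, b k) : Submajorized a b := by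
  intro n
  simp only [decRearr_of_antitone ha ha0, decRearr_of_antitone hb hb0]
  rw [← ENNReal.ofReal_sum_of_nonneg fun k _ => ha0 k,
    ← ENNReal.ofReal_sum_of_nonneg fun k _ => hb0 k]
  exact ENNReal.ofReal_le_ofReal (h n)

theorem encard_preimage_div (S : Set ℕ) {n : ℕ} (hn : 0 < n) :
    {k : ℕ | k / n ∈ S}.encard = S.encard * n := by
  have hb : Set.BijOn (fun p : ℕ × ℕ => n * p.1 + p.2) (S ×ˢ (Set.Iio n))
      {k : ℕ | k / n ∈ S} := by
    refine ⟨?_, ?_, ?_⟩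
    · rintro ⟨a, b⟩ ⟨ha, hb⟩
      simp only [Set.mem_Iio] at hb
      simp only [Set.mem_ofPred_eq]
      rw [Nat.mul_add_div hn, Nat.div_eq_of_lt hb, add_zero]
      exact ha
    · rintro ⟨a, b⟩ ⟨_, hb⟩ ⟨c, d⟩ ⟨_, hd⟩ h
      simp only [Set.mem_Iio] at hb hd
      simp only at h
      have h1 := congrArg (· / n) h
      have h2 := congrArg (· % n) h
      simp only [Nat.mul_add_div hn, Nat.div_eq_of_lt hb, Nat.div_eq_of_lt hd, add_zero,
        Nat.mul_add_mod, Nat.mod_eq_of_lt hb, Nat.mod_eq_of_lt hd] at h1 h2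
      simp [h1, h2]
    · intro k hk
      exact ⟨(k / n, k % n), ⟨hk, Nat.mod_lt _ hn⟩, Nat.div_add_mod k n⟩
  have h1 : (S ×ˢ (Set.Iio n)).encard = {k : ℕ | k / n ∈ S}.encard := by
    rw [← hb.image_eq, hb.injOn.encard_image]
  rw [← h1, Set.encard_prod]
  congr 1
  rw [← Finset.coe_range, Set.encard_coe_eq_coe_finsetCard, Finset.card_range]

theorem decRearr_dilate (x : ℕ → ℝ) {n : ℕ} (hn : 0 < n) (k : ℕ) :
    decRearr (dilate n x) k = decRearr x (k / n) := by
  unfold decRearr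
  congr 1
  ext s
  simp only [Set.mem_ofPred_eq]
  have : {j : ℕ | s < ‖dilate n x j‖ₑ} = {j : ℕ | j / n ∈ {i : ℕ | s < ‖x i‖ₑ}} := rfl
  rw [this, encard_preimage_div _ hn]
  generalize {i : ℕ | s < ‖x i‖ₑ}.encard = c
  induction c using ENat.recTopCoe with
  | top =>
    rw [ENat.top_mul (by exact_mod_cast hn.ne')]
    simp
  | coe c =>
    have : (c : ℕ∞) * (n : ℕ∞) = ((c * n : ℕ) : ℕ∞) := by push_cast; rfl
    rw [this, Nat.cast_le, Nat.cast_le, Nat.le_div_iff_mul_le hn]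

/-! ### The norm of a symmetric sequence space -/

theorem dilate_add (n : ℕ) (x y : ℕ → ℝ) : dilate n (x + y) = dilate n x + dilate n y := rfl

theorem dilate_dilate (m n : ℕ) (x : ℕ → ℝ) : dilate m (dilate n x) = dilate (m * n) x := by
  funext k
  simp [dilate, Nat.div_div_eq_div_mul]

theorem contract_contract (m n : ℕ) (x : ℕ → ℝ) :
    contract m (contract n x) = contract (n * m) x := by
  funext k
  simp only [contract]
  rw [← Finset.mul_sum, ← mul_assoc]
  congr 1
  · push_cast
    rw [mul_inv]
    ring
  · rw [Finset.sum_sigma']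
    rcases Nat.eq_zero_or_pos n with rfl | hn
    · simp only [zero_mul, Finset.range_zero]
      exact Finset.sum_eq_zero fun p hp => by simp at hp
    refine Finset.sum_bij' (fun p _ => n * p.1 + p.2) (fun j _ => ⟨j / n, j % n⟩) ?_ ?_ ?_ ?_ ?_
    · rintro ⟨a, b⟩ h
      simp only [Finset.mem_sigma, Finset.mem_range] at h ⊢
      nlinarith
    · intro j hj
      simp only [Finset.mem_sigma, Finset.mem_range] at hj ⊢
      exact ⟨Nat.div_lt_of_lt_mul hj, Nat.mod_lt _ hn⟩
    · rintro ⟨a, b⟩ h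
      simp only [Finset.mem_sigma, Finset.mem_range] at h
      simp [Nat.mul_add_div hn, Nat.div_eq_of_lt h.2, Nat.mod_eq_of_lt h.2]
    · intro j hj
      exact Nat.div_add_mod j n
    · rintro ⟨a, b⟩ h
      congr 1
      ring

namespace SymmetricSequenceSpace

variable (E : SymmetricSequenceSpace)

theorem nrm_le_of_decRearr_le {x y : ℕ → ℝ} (hx : x ∈ E.carrier)
    (h : ∀ n, decRearr y n ≤ decRearr x n) : E.nrm y ≤ E.nrm x :=
  E.nrm_le_of_submajorized x hx y (E.mem_of_rearr_le x hx y h)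
    fun _ => Finset.sum_le_sum fun k _ => h k

theorem mem_of_injOn {x y : ℕ → ℝ} (hx : x ∈ E.carrier) (π : ℕ → ℕ)
    (hπ : Set.InjOn π {k | y k ≠ 0}) (h : ∀ k, y k ≠ 0 → |y k| ≤ |x (π k)|) : y ∈ E.carrier :=
  E.mem_of_rearr_le x hx y (decRearr_le_of_injOn π hπ h)

theorem nrm_le_of_injOn {x y : ℕ → ℝ} (hx : x ∈ E.carrier) (π : ℕ → ℕ)
    (hπ : Set.InjOn π {k | y k ≠ 0}) (h : ∀ k, y k ≠ 0 → |y k| ≤ |x (π k)|) :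
    E.nrm y ≤ E.nrm x :=
  E.nrm_le_of_decRearr_le hx (decRearr_le_of_injOn π hπ h)

theorem mem_of_abs_le {x y : ℕ → ℝ} (hx : x ∈ E.carrier) (h : ∀ k, |y k| ≤ |x k|) :
    y ∈ E.carrier :=
  E.mem_of_injOn hx id (Set.injOn_id _) fun k _ => h k

theorem nrm_le_of_abs_le {x y : ℕ → ℝ} (hx : x ∈ E.carrier) (h : ∀ k, |y k| ≤ |x k|) :
    E.nrm y ≤ E.nrm x :=
  E.nrm_le_of_injOn hx id (Set.injOn_id _) fun k _ => h k

theorem nrm_zero : E.nrm 0 = 0 := by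
  have := E.nrm_smul 0 0 E.carrier.zero_mem
  simpa using this

theorem nrm_neg {x : ℕ → ℝ} (hx : x ∈ E.carrier) : E.nrm (-x) = E.nrm x := by
  have := E.nrm_smul (-1) x hx
  simpa using this

theorem nrm_nonneg {x : ℕ → ℝ} (hx : x ∈ E.carrier) : 0 ≤ E.nrm x := by
  have := E.nrm_add_le x hx (-x) (E.carrier.neg_mem hx)
  rw [add_neg_cancel, E.nrm_zero, E.nrm_neg hx] at this
  linarith

theorem nrm_pos {x : ℕ → ℝ} (hx : x ∈ E.carrier) (h0 : x ≠ 0) : 0 < E.nrm x :=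
  lt_of_le_of_ne (E.nrm_nonneg hx) fun h => h0 (E.eq_zero_of_nrm x hx h.symm)

theorem nrm_sum_le {ι : Type*} (s : Finset ι) (u : ι → ℕ → ℝ) (hu : ∀ i ∈ s, u i ∈ E.carrier) :
    E.nrm (∑ i ∈ s, u i) ≤ ∑ i ∈ s, E.nrm (u i) := by
  classical
  induction s using Finset.induction_on with
  | empty => simp [E.nrm_zero]
  | insert a s ha ih =>
    rw [Finset.sum_insert ha, Finset.sum_insert ha]
    have h1 : ∀ i ∈ s, u i ∈ E.carrier := fun i hi => hu i (Finset.mem_insert_of_mem hi)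
    exact (E.nrm_add_le _ (hu a (Finset.mem_insert_self _ _)) _
      (E.carrier.sum_mem h1)).trans (by linarith [ih h1])

theorem single_mem : (Pi.single 0 1 : ℕ → ℝ) ∈ E.carrier := by
  obtain ⟨x, hx, hx0⟩ := E.nontrivial
  obtain ⟨k, hk⟩ := Function.ne_iff.1 hx0
  refine E.mem_of_injOn (E.carrier.smul_mem (x k)⁻¹ hx) (fun j => j + k)
    (fun a _ b _ h => by simpa using h) ?_
  intro j hj
  have : j = 0 := by
    by_contra h
    simp [h] at hj
  subst this
  have : x k ≠ 0 := hk
  simp [this]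

theorem nrm_single_pos : 0 < E.nrm (Pi.single 0 1) :=
  E.nrm_pos E.single_mem fun h => by simpa using congrFun h 0

theorem abs_mul_nrm_single_le {x : ℕ → ℝ} (hx : x ∈ E.carrier) (k : ℕ) :
    |x k| * E.nrm (Pi.single 0 1) ≤ E.nrm x := by
  rw [← abs_abs, ← E.nrm_smul _ _ E.single_mem]
  refine E.nrm_le_of_injOn hx (fun j => j + k) (fun a _ b _ h => by simpa using h) ?_
  intro j hj
  have : j = 0 := by
    by_contra h
    simp [h] at hj
  subst this
  simp

theorem dilate_eq_sum {n : ℕ} (hn : 0 < n) (x : ℕ → ℝ) :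
    dilate n x = ∑ j ∈ Finset.range n, fun k => if k % n = j then x (k / n) else 0 := by
  funext k
  rw [Finset.sum_apply]
  simp [Nat.mod_lt _ hn, dilate]

theorem dilate_part_le {n : ℕ} (j : ℕ) (x : ℕ → ℝ) (m : ℕ) :
    decRearr (fun k => if k % n = j then x (k / n) else 0) m ≤ decRearr x m := by
  refine decRearr_le_of_injOn (fun k => k / n) ?_ ?_ m
  · intro a ha b hb h
    simp only [Set.mem_ofPred_eq, ne_eq, ite_eq_right_iff, not_forall] at ha hb
    obtain ⟨ha, -⟩ := ha
    obtain ⟨hb, -⟩ := hb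
    rw [← Nat.div_add_mod a n, ← Nat.div_add_mod b n, ha, hb]
    simp only at h
    rw [h]
  · intro k hk
    simp only [ne_eq, ite_eq_right_iff, not_forall] at hk
    simp [hk.1]

theorem dilate_mem {n : ℕ} (hn : 0 < n) {x : ℕ → ℝ} (hx : x ∈ E.carrier) :
    dilate n x ∈ E.carrier := by
  rw [dilate_eq_sum hn]
  exact E.carrier.sum_mem fun j _ => E.mem_of_rearr_le x hx _ (dilate_part_le j x)

theorem nrm_dilate_le {n : ℕ} (hn : 0 < n) {x : ℕ → ℝ} (hx : x ∈ E.carrier) :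
    E.nrm (dilate n x) ≤ n * E.nrm x := by
  rw [dilate_eq_sum hn]
  refine (E.nrm_sum_le _ _ fun j _ => E.mem_of_rearr_le x hx _ (dilate_part_le j x)).trans ?_
  refine (Finset.sum_le_sum fun j _ => E.nrm_le_of_decRearr_le hx (dilate_part_le j x)).trans ?_
  simp

theorem contract_mem {n : ℕ} {x : ℕ → ℝ} (hx : x ∈ E.carrier) :
    contract n x ∈ E.carrier := by
  have : contract n x = (n : ℝ)⁻¹ • ∑ j ∈ Finset.range n, fun k => x (n * k + j) := by
    funext k
    simp [contract, Finset.sum_apply]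
  rw [this]
  refine E.carrier.smul_mem _ (E.carrier.sum_mem fun j hj => ?_)
  have hn : 0 < n := lt_of_le_of_lt (Nat.zero_le j) (Finset.mem_range.1 hj)
  refine E.mem_of_injOn hx (fun k => n * k + j) ?_ fun k _ => le_rfl
  intro a _ b _ h
  simpa [hn.ne'] using h

/-- Replacing a sequence by its block averages is an average of rearrangements (rotate each block),
hence does not increase the norm. -/
theorem nrm_dilate_contract_le {n : ℕ} (hn : 0 < n) {x : ℕ → ℝ} (hx : x ∈ E.carrier) :
    E.nrm (dilate n (contract n x)) ≤ E.nrm x := by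
  let π : ℕ → ℕ → ℕ := fun j k => n * (k / n) + (k % n + j) % n
  have hπ : ∀ j, Function.Injective (π j) := by
    intro j a b h
    have h1 := congrArg (· / n) h
    have h2 := congrArg (· % n) h
    simp only [π, Nat.mul_add_div hn, Nat.div_eq_of_lt (Nat.mod_lt _ hn), add_zero,
      Nat.mul_add_mod, Nat.mod_mod] at h1 h2
    have h3 : a % n = b % n := by
      have h4 : a % n + j ≡ b % n + j [MOD n] := h2
      have h5 := Nat.ModEq.add_right_cancel' j h4
      simpa [Nat.ModEq] using h5
    rw [← Nat.div_add_mod a n, ← Nat.div_add_mod b n, h1, h3]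
  have hmem : ∀ j, (fun k => x (π j k)) ∈ E.carrier := fun j =>
    E.mem_of_injOn hx (π j) ((hπ j).injOn) fun k _ => le_rfl
  have heq : dilate n (contract n x) = (n : ℝ)⁻¹ • ∑ j ∈ Finset.range n, fun k => x (π j k) := by
    funext k
    simp only [dilate, contract, Pi.smul_apply, Finset.sum_apply, smul_eq_mul]
    congr 1
    -- the inverse rotation re-indexes the block
    refine (Finset.sum_bij' (fun j _ => (k % n + j) % n) (fun i _ => (i + (n - k % n)) % n)
      ?_ ?_ ?_ ?_ ?_).symm
    · intro j _
      exact Finset.mem_range.2 (Nat.mod_lt _ hn)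
    · intro j _
      exact Finset.mem_range.2 (Nat.mod_lt _ hn)
    · intro j hj
      have hj := Finset.mem_range.1 hj
      have hk := Nat.mod_lt k hn
      have : k % n + j + (n - k % n) = j + n := by omega
      rw [Nat.mod_add_mod, this, Nat.add_mod_right, Nat.mod_eq_of_lt hj]
    · intro i hi
      have hi := Finset.mem_range.1 hi
      have hk := Nat.mod_lt k hn
      have : k % n + (i + (n - k % n)) = i + n := by omega
      rw [Nat.add_mod_mod, this, Nat.add_mod_right, Nat.mod_eq_of_lt hi]
    · intro j _
      rfl
  have hn' : (0 : ℝ) < n := by exact_mod_cast hn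
  rw [heq, E.nrm_smul _ _ (E.carrier.sum_mem fun j _ => hmem j), abs_of_pos (inv_pos.2 hn'),
    inv_mul_le_iff₀ hn']
  refine (E.nrm_sum_le _ _ fun j _ => hmem j).trans ?_
  refine (Finset.sum_le_sum fun j _ =>
    E.nrm_le_of_injOn hx (π j) ((hπ j).injOn) fun k _ => le_rfl).trans ?_
  simp

end SymmetricSequenceSpace

/-! ### Order continuity of separable symmetric sequence spaces -/

namespace SymmetricSequenceSpace

variable (E : SymmetricSequenceSpace)

theorem indicator_mem (S : Set ℕ) {x : ℕ → ℝ} (hx : x ∈ E.carrier) :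
    S.indicator x ∈ E.carrier :=
  E.mem_of_abs_le hx fun k => by
    by_cases h : k ∈ S <;> simp [h]

theorem nrm_indicator_le (S : Set ℕ) {x : ℕ → ℝ} (hx : x ∈ E.carrier) :
    E.nrm (S.indicator x) ≤ E.nrm x :=
  E.nrm_le_of_abs_le hx fun k => by
    by_cases h : k ∈ S <;> simp [h]

/-- In a separable space no element has infinitely many disjoint pieces of large norm: otherwise,
choosing on the `j`-th piece either `x` or `0`, whichever is farther from the `j`-th element of a
countable dense set, gives an element far from the whole dense set. -/
theorem not_exists_disjoint_blocks {E : SymmetricSequenceSpace} (hsep : E.IsSeparable)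
    {x : ℕ → ℝ} (hx : x ∈ E.carrier) {ε : ℝ} (hε : 0 < ε) (B : ℕ → Set ℕ)
    (hB : Pairwise (Function.onFun Disjoint B)) :
    ¬ ∀ j, ε ≤ E.nrm ((B j).indicator x) := by
  classical
  intro hlarge
  obtain ⟨D, hDc, hDE, hD⟩ := hsep
  obtain ⟨d₀, hd₀, -⟩ := hD x hx 1 one_pos
  obtain ⟨d, rfl⟩ := hDc.exists_eq_range ⟨d₀, hd₀⟩
  have hdE : ∀ j, d j ∈ E.carrier := fun j => hDE ⟨j, rfl⟩
  let z : ℕ → ℝ := fun k =>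
    if ∃ j, k ∈ B j ∧ E.nrm ((B j).indicator (d j)) < ε / 2 then x k else 0
  have hz : z ∈ E.carrier := E.mem_of_abs_le hx fun k => by
    by_cases h : ∃ j, k ∈ B j ∧ E.nrm ((B j).indicator (d j)) < ε / 2
    · simp [z, h]
    · simp only [z, if_neg h, abs_zero, abs_nonneg]
  obtain ⟨_, ⟨j, rfl⟩, hj⟩ := hD z hz (ε / 2) (by linarith)
  have h1 : E.nrm ((B j).indicator (z - d j)) < ε / 2 :=
    lt_of_le_of_lt (E.nrm_indicator_le _ (E.carrier.sub_mem hz (hdE j))) hj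
  by_cases hc : E.nrm ((B j).indicator (d j)) < ε / 2
  · have h2 : (B j).indicator x = (B j).indicator (z - d j) + (B j).indicator (d j) := by
      funext k
      by_cases hk : k ∈ B j
      · have : z k = x k := if_pos ⟨j, hk, hc⟩
        simp [hk, this]
      · simp [hk]
    have h3 := E.nrm_add_le _ (E.indicator_mem (B j) (E.carrier.sub_mem hz (hdE j)))
      _ (E.indicator_mem (B j) (hdE j))
    rw [← h2] at h3
    linarith [hlarge j]
  · have h2 : (B j).indicator (d j) = -((B j).indicator (z - d j)) := by
      funext k
      by_cases hk : k ∈ B j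
      · have : z k = 0 := by
          refine if_neg ?_
          rintro ⟨i, hi, hi'⟩
          have : i = j := by
            by_contra hne
            exact Set.disjoint_left.1 (hB hne) hi hk
          subst this
          exact hc hi'
        simp [hk, this]
      · simp [hk]
    rw [h2, E.nrm_neg (E.indicator_mem (B j) (E.carrier.sub_mem hz (hdE j)))] at hc
    exact hc h1

/-- Order continuity: in a separable symmetric sequence space the tails of every element tend to
zero. If the truncations form a Cauchy sequence, their limit can only be `x`; otherwise there are
disjoint blocks of large norm. -/
theorem tendsto_nrm_tail {E : SymmetricSequenceSpace} (hsep : E.IsSeparable) {x : ℕ → ℝ}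
    (hx : x ∈ E.carrier) :
    Tendsto (fun m => E.nrm ((Set.Ici m).indicator x)) atTop (𝓝 0) := by
  have hsub : ∀ m n, m ≤ n → (Set.Iio n).indicator x - (Set.Iio m).indicator x
      = (Set.Ico m n).indicator x := by
    intro m n hmn
    funext k
    by_cases h1 : k < m
    · have h2 : k < n := by omega
      have h3 : ¬ m ≤ k := by omega
      simp [h1, h2, h3]
    · have h3 : m ≤ k := by omega
      by_cases h2 : k < n <;> simp [h1, h2, h3]
  by_cases hC : ∀ ε > 0, ∃ N, ∀ m ≥ N, ∀ n ≥ N,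
      E.nrm ((Set.Iio m).indicator x - (Set.Iio n).indicator x) < ε
  · obtain ⟨z, hz, hlim⟩ := E.complete _ (fun n => E.indicator_mem (Set.Iio n) hx) hC
    have hzx : z = x := by
      funext k
      have h1 : Tendsto (fun n => |((Set.Iio n).indicator x - z) k| * E.nrm (Pi.single 0 1))
          atTop (𝓝 0) :=
        squeeze_zero (fun n => mul_nonneg (abs_nonneg _) E.nrm_single_pos.le)
          (fun n => E.abs_mul_nrm_single_le
            (E.carrier.sub_mem (E.indicator_mem (Set.Iio n) hx) hz) k) hlim
      have h2 : Tendsto (fun n => |((Set.Iio n).indicator x - z) k| * E.nrm (Pi.single 0 1))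
          atTop (𝓝 (|x k - z k| * E.nrm (Pi.single 0 1))) := by
        refine tendsto_const_nhds.congr' ?_
        filter_upwards [eventually_gt_atTop k] with n hn
        simp [hn]
      have h3 := tendsto_nhds_unique h2 h1
      have h4 : |x k - z k| = 0 := by
        rcases mul_eq_zero.1 h3 with h | h
        · exact h
        · exact absurd h E.nrm_single_pos.ne'
      linarith [abs_eq_zero.1 h4]
    subst hzx
    refine hlim.congr fun m => ?_
    rw [← E.nrm_neg (E.indicator_mem (Set.Ici m) hx)]
    congr 1
    funext k
    by_cases h : k < m
    · simp [h, not_le.2 h]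
    · simp [h, not_lt.1 h]
  · exfalso
    push Not at hC
    obtain ⟨ε, hε, hC⟩ := hC
    have hC' : ∀ N, ∃ a b, N ≤ a ∧ a ≤ b ∧ ε ≤ E.nrm ((Set.Ico a b).indicator x) := by
      intro N
      obtain ⟨m, hm, n, hn, h⟩ := hC N
      rcases le_total m n with hmn | hmn
      · refine ⟨m, n, hm, hmn, ?_⟩
        rw [← hsub m n hmn, ← E.nrm_neg (E.carrier.sub_mem (E.indicator_mem _ hx)
          (E.indicator_mem _ hx)), neg_sub]
        exact h
      · refine ⟨n, m, hn, hmn, ?_⟩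
        rw [← hsub n m hmn]
        exact h
    choose a b ha hab hlarge using hC'
    let p : ℕ → ℕ := fun j => Nat.rec 0 (fun _ q => b q) j
    have hp : Monotone p := monotone_nat_of_le_succ fun j => (ha (p j)).trans (hab (p j))
    have hlt : ∀ i j, i < j → Disjoint (Set.Ico (a (p i)) (b (p i)))
        (Set.Ico (a (p j)) (b (p j))) := by
      intro i j hij
      rw [Set.disjoint_left]
      intro k hk hk'
      have h1 : b (p i) ≤ p j := hp (show i + 1 ≤ j from hij)
      have h2 := ha (p j)
      simp only [Set.mem_Ico] at hk hk'
      omega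
    refine not_exists_disjoint_blocks hsep hx hε (fun j => Set.Ico (a (p j)) (b (p j))) ?_
      fun j => hlarge (p j)
    intro i j hij
    rcases lt_or_gt_of_ne hij with h | h
    · exact hlt i j h
    · exact (hlt j i h).symm

theorem tendsto_zero_of_mem {E : SymmetricSequenceSpace} (hsep : E.IsSeparable) {x : ℕ → ℝ}
    (hx : x ∈ E.carrier) : Tendsto x atTop (𝓝 0) := by
  have h := (tendsto_nrm_tail hsep hx).div_const (E.nrm (Pi.single 0 1))
  rw [zero_div] at h
  refine squeeze_zero_norm (fun k => ?_) h
  rw [le_div_iff₀ E.nrm_single_pos, Real.norm_eq_abs]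
  have := E.abs_mul_nrm_single_le (E.indicator_mem (Set.Ici k) hx) k
  simpa using this

/-! ### Consequences of trivial Boyd indices -/

theorem opNorm_le {σ : (ℕ → ℝ) → ℕ → ℝ} {C : ℝ} (hC : 0 ≤ C)
    (h : ∀ x ∈ E.carrier, E.nrm (σ x) ≤ C * E.nrm x) : E.opNorm σ ≤ C :=
  csInf_le ⟨0, fun _ hc => hc.1⟩ ⟨hC, h⟩

theorem opNorm_nonneg (σ : (ℕ → ℝ) → ℕ → ℝ) : 0 ≤ E.opNorm σ :=
  Real.sInf_nonneg fun _ hc => hc.1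

theorem contract_single {n : ℕ} (hn : 0 < n) :
    contract n (Pi.single 0 1) = (n : ℝ)⁻¹ • Pi.single 0 1 := by
  funext k
  simp only [contract, Pi.smul_apply, smul_eq_mul]
  congr 1
  rcases Nat.eq_zero_or_pos k with rfl | hk
  · rw [Finset.sum_eq_single_of_mem 0 (Finset.mem_range.2 hn)]
    · simp
    · intro j _ hj
      rw [mul_zero, zero_add, Pi.single_eq_of_ne hj]
  · rw [Finset.sum_eq_zero]
    · simp [hk.ne']
    · intro j _
      have : n * k + j ≠ 0 := by
        have := Nat.mul_pos hn hk
        omega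
      rw [Pi.single_eq_of_ne this]

theorem inv_le_opNorm_contract {n : ℕ} (hn : 0 < n) {C : ℝ} (hC : 0 ≤ C)
    (h : ∀ x ∈ E.carrier, E.nrm (contract n x) ≤ C * E.nrm x) :
    (n : ℝ)⁻¹ ≤ E.opNorm (contract n) := by
  refine le_csInf ⟨C, hC, h⟩ ?_
  rintro D ⟨-, hD⟩
  have := hD _ E.single_mem
  rw [contract_single hn, E.nrm_smul _ _ E.single_mem, abs_of_nonneg (by positivity)] at this
  exact le_of_mul_le_mul_right this E.nrm_single_pos

/-- If the lower Boyd index vanishes then, for every `n`, some `y` has norm comparable to that of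
`n` disjoint copies of it, uniformly in `n`: otherwise `‖σ_{1/n}‖ ≤ 1/2` and
`‖σ_{1/n^k}‖ ≤ 2^{-k}` by submultiplicativity. -/
theorem exists_nrm_dilate_le_of_lower {E : SymmetricSequenceSpace} (h : E.HasLowerBoydIndex 0)
    {n : ℕ} (hn : 2 ≤ n) :
    ∃ y ∈ E.carrier, 0 < E.nrm y ∧ E.nrm (dilate n y) ≤ 2 * E.nrm y := by
  by_contra hcon
  push Not at hcon
  have hn0 : 0 < n := by omega
  have hhalf : ∀ x ∈ E.carrier, E.nrm (contract n x) ≤ 2⁻¹ * E.nrm x := by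
    intro x hx
    rcases (E.nrm_nonneg (E.contract_mem (n := n) hx)).eq_or_lt with h0 | h0
    · rw [← h0]
      exact mul_nonneg (by norm_num) (E.nrm_nonneg hx)
    · have h1 := hcon _ (E.contract_mem hx) h0
      have h2 := E.nrm_dilate_contract_le hn0 hx
      linarith
  have hpow : ∀ k : ℕ, ∀ x ∈ E.carrier, E.nrm (contract (n ^ k) x) ≤ 2⁻¹ ^ k * E.nrm x := by
    intro k
    induction k with
    | zero =>
      intro x _
      have : contract (n ^ 0) x = x := by
        funext j
        simp [contract]
      rw [this]
      simp
    | succ k ih =>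
      intro x hx
      have : contract (n ^ (k + 1)) x = contract (n ^ k) (contract n x) := by
        rw [contract_contract, pow_succ']
      rw [this]
      refine (ih _ (E.contract_mem hx)).trans ?_
      rw [pow_succ, mul_assoc]
      exact mul_le_mul_of_nonneg_left (hhalf x hx) (by positivity)
  have hlogn : 0 < Real.log n := Real.log_pos (by exact_mod_cast hn)
  have hlim := h.comp (tendsto_pow_atTop_atTop_of_one_lt (show 1 < n by omega))
  have hge : ∀ᶠ k : ℕ in atTop, Real.log 2 / Real.log n ≤
      Real.log (E.opNorm (contract (n ^ k))) / Real.log (((n ^ k : ℕ) : ℝ)⁻¹) := by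
    filter_upwards [eventually_gt_atTop 0] with k hk
    have hk' : (0 : ℝ) < k := by exact_mod_cast hk
    have h1 : E.opNorm (contract (n ^ k)) ≤ 2⁻¹ ^ k := E.opNorm_le (by positivity) (hpow k)
    have h2 : 0 < E.opNorm (contract (n ^ k)) :=
      lt_of_lt_of_le (inv_pos.2 (by exact_mod_cast Nat.pow_pos hn0))
        (E.inv_le_opNorm_contract (Nat.pow_pos hn0) (by positivity) (hpow k))
    have h3 : Real.log (E.opNorm (contract (n ^ k))) ≤ -(k * Real.log 2) := by
      refine (Real.log_le_log h2 h1).trans_eq ?_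
      rw [Real.log_pow, Real.log_inv]
      ring
    have h4 : Real.log (((n ^ k : ℕ) : ℝ)⁻¹) = -(k * Real.log n) := by
      rw [Real.log_inv, Nat.cast_pow, Real.log_pow]
    rw [h4, div_neg, ← neg_div, le_div_iff₀ (by positivity)]
    have : Real.log 2 / Real.log n * (k * Real.log n) = k * Real.log 2 := by
      field_simp
    linarith
  have := ge_of_tendsto hlim hge
  have h5 : 0 < Real.log 2 / Real.log n := div_pos (Real.log_pos (by norm_num)) hlogn
  linarith

/-- If the upper Boyd index is `1` then, for every `n`, some `y` is such that `n` disjoint copies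
of it have norm comparable to `n` times its norm, uniformly in `n`. -/
theorem exists_le_nrm_dilate_of_upper {E : SymmetricSequenceSpace} (h : E.HasUpperBoydIndex 1)
    {n : ℕ} (hn : 2 ≤ n) :
    ∃ y ∈ E.carrier, 0 < E.nrm y ∧ n * E.nrm y ≤ 2 * E.nrm (dilate n y) := by
  by_contra hcon
  push Not at hcon
  have hn0 : 0 < n := by omega
  have hn2 : (2 : ℝ) ≤ n := by exact_mod_cast hn
  have hhalf : ∀ x ∈ E.carrier, E.nrm (dilate n x) ≤ (n / 2) * E.nrm x := by
    intro x hx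
    rcases (E.nrm_nonneg hx).eq_or_lt with h0 | h0
    · have : x = 0 := E.eq_zero_of_nrm x hx h0.symm
      subst this
      have : dilate n 0 = 0 := rfl
      simp [this, E.nrm_zero]
    · have h1 := hcon _ hx h0
      linarith
  have hpow : ∀ k : ℕ, ∀ x ∈ E.carrier, E.nrm (dilate (n ^ k) x) ≤ (n / 2) ^ k * E.nrm x := by
    intro k
    induction k with
    | zero =>
      intro x _
      have : dilate (n ^ 0) x = x := by
        funext j
        simp [dilate]
      rw [this]
      simp
    | succ k ih =>
      intro x hx
      rw [pow_succ n, ← dilate_dilate]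
      refine (ih _ (E.dilate_mem hn0 hx)).trans ?_
      rw [pow_succ, mul_assoc]
      exact mul_le_mul_of_nonneg_left (hhalf x hx) (by positivity)
  have hlogn : 0 < Real.log n := Real.log_pos (by exact_mod_cast hn)
  have hlim := h.comp (tendsto_pow_atTop_atTop_of_one_lt (show 1 < n by omega))
  have hge : ∀ᶠ k : ℕ in atTop,
      Real.log (E.opNorm (dilate (n ^ k))) / Real.log ((n ^ k : ℕ) : ℝ) ≤
        1 - Real.log 2 / Real.log n := by
    filter_upwards [eventually_gt_atTop 0] with k hk
    have hk' : (0 : ℝ) < k := by exact_mod_cast hk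
    have h1 : E.opNorm (dilate (n ^ k)) ≤ (n / 2) ^ k := E.opNorm_le (by positivity) (hpow k)
    have h6 : Real.log (((n : ℝ) / 2) ^ k) = k * (Real.log n - Real.log 2) := by
      rw [Real.log_pow, Real.log_div (by positivity) (by norm_num)]
    have h3 : Real.log (E.opNorm (dilate (n ^ k))) ≤ k * (Real.log n - Real.log 2) := by
      rcases (E.opNorm_nonneg (dilate (n ^ k))).eq_or_lt with h0 | h0
      · -- the junk value `log 0 = 0` does no harm here
        rw [← h0, Real.log_zero]
        exact mul_nonneg hk'.le (sub_nonneg.2 (Real.log_le_log (by norm_num) hn2))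
      · exact (Real.log_le_log h0 h1).trans_eq h6
    rw [Nat.cast_pow, Real.log_pow, div_le_iff₀ (by positivity)]
    have : (1 - Real.log 2 / Real.log n) * (k * Real.log n)
        = k * (Real.log n - Real.log 2) := by
      field_simp
    linarith
  have := le_of_tendsto hlim hge
  have h5 : 0 < Real.log 2 / Real.log n := div_pos (Real.log_pos (by norm_num)) hlogn
  linarith

/-- Sorted version of a sequence. -/
theorem exists_antitone_decRearr_eq {E : SymmetricSequenceSpace} (hsep : E.IsSeparable)
    {x : ℕ → ℝ} (hx : x ∈ E.carrier) :
    ∃ y : ℕ → ℝ, Antitone y ∧ (∀ n, 0 ≤ y n) ∧ Tendsto y atTop (𝓝 0) ∧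
      ∀ n, decRearr y n = decRearr x n := by
  obtain ⟨M, hM⟩ := (tendsto_zero_of_mem hsep hx).norm.bddAbove_range
  have hfin : ∀ n, decRearr x n ≠ ⊤ := by
    intro n
    refine ne_top_of_le_ne_top (ENNReal.ofReal_ne_top (r := M)) (sInf_le ?_)
    have : {k : ℕ | ENNReal.ofReal M < ‖x k‖ₑ} = ∅ := by
      rw [Set.eq_empty_iff_forall_notMem]
      intro k hk
      simp only [Set.mem_ofPred_eq] at hk
      rw [← ofReal_norm] at hk
      exact absurd hk (not_lt.2 (ENNReal.ofReal_le_ofReal (hM ⟨k, rfl⟩)))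
    simp only [Set.mem_ofPred_eq]
    rw [this]
    simp
  have hanti : Antitone fun n => (decRearr x n).toReal := fun m n hmn =>
    ENNReal.toReal_mono (hfin m) (decRearr_antitone x hmn)
  have heq : ∀ n, decRearr (fun n => (decRearr x n).toReal) n = decRearr x n := fun n => by
    rw [decRearr_of_antitone hanti fun _ => ENNReal.toReal_nonneg, ENNReal.ofReal_toReal (hfin n)]
  refine ⟨_, hanti, fun n => ENNReal.toReal_nonneg, ?_, heq⟩
  exact tendsto_zero_of_mem hsep (E.mem_of_rearr_le x hx _ fun n => (heq n).le)

/-- A finitely supported non-increasing approximation of a sequence, keeping the norms of the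
sequence and of its dilation up to a factor `2`. -/
theorem exists_sorted_truncation {E : SymmetricSequenceSpace} (hsep : E.IsSeparable)
    {n : ℕ} (hn : 0 < n) {x : ℕ → ℝ} (hx : x ∈ E.carrier) (h0 : 0 < E.nrm x) :
    ∃ y ∈ E.carrier, Antitone y ∧ (∀ k, 0 ≤ y k) ∧ (∃ r, ∀ k, r ≤ k → y k = 0) ∧
      E.nrm y ≤ E.nrm x ∧ E.nrm x ≤ 2 * E.nrm y ∧ E.nrm (dilate n y) ≤ E.nrm (dilate n x) ∧
      E.nrm (dilate n x) ≤ 2 * E.nrm (dilate n y) := by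
  obtain ⟨w, hanti, hpos, -, heq⟩ := exists_antitone_decRearr_eq hsep hx
  have hw : w ∈ E.carrier := E.mem_of_rearr_le x hx _ fun k => (heq k).le
  have hwx : E.nrm w = E.nrm x := le_antisymm (E.nrm_le_of_decRearr_le hx fun k => (heq k).le)
    (E.nrm_le_of_decRearr_le hw fun k => (heq k).ge)
  have hdeq : ∀ k, decRearr (dilate n w) k = decRearr (dilate n x) k := fun k => by
    rw [decRearr_dilate _ hn, decRearr_dilate _ hn, heq]
  have hdx := E.dilate_mem hn hx
  have hdw := E.dilate_mem hn hw
  have hdwx : E.nrm (dilate n w) = E.nrm (dilate n x) :=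
    le_antisymm (E.nrm_le_of_decRearr_le hdx fun k => (hdeq k).le)
      (E.nrm_le_of_decRearr_le hdw fun k => (hdeq k).ge)
  have hdpos : 0 < E.nrm (dilate n w) := by
    refine E.nrm_pos hdw fun h => ?_
    have : w = 0 := by
      funext k
      have := congrFun h (n * k)
      simpa [dilate, hn] using this
    rw [← hwx, this, E.nrm_zero] at h0
    exact lt_irrefl _ h0
  have h1 := (tendsto_nrm_tail hsep hw).eventually (gt_mem_nhds (half_pos (hwx ▸ h0)))
  have h2 := ((tendsto_nrm_tail hsep hdw).comp (tendsto_id.const_mul_atTop' hn)).eventually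
    (gt_mem_nhds (half_pos hdpos))
  obtain ⟨r, hr1, hr2⟩ := (h1.and h2).exists
  have hmem := E.indicator_mem (Set.Iio r) hw
  have hsplit : w = (Set.Iio r).indicator w + (Set.Ici r).indicator w := by
    funext k
    by_cases hk : k < r
    · simp [hk, not_le.2 hk]
    · simp [hk, not_lt.1 hk]
  have hdt : dilate n ((Set.Ici r).indicator w) = (Set.Ici (n * r)).indicator (dilate n w) := by
    funext k
    have : r ≤ k / n ↔ n * r ≤ k := by rw [Nat.le_div_iff_mul_le hn, mul_comm]
    by_cases hk : r ≤ k / n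
    · simp [dilate, hk, this.1 hk]
    · have h' : k ∉ Set.Ici (n * r) := fun h => hk (this.2 h)
      rw [Set.indicator_of_notMem h']
      simp [dilate, hk]
  refine ⟨(Set.Iio r).indicator w, hmem, ?_, ?_, ⟨r, ?_⟩, ?_, ?_, ?_, ?_⟩
  · intro a b hab
    by_cases hb : b < r
    · have ha : a < r := by omega
      simpa [ha, hb] using hanti hab
    · simp only [Set.mem_Iio, hb, not_false_eq_true, Set.indicator_of_notMem]
      exact Set.indicator_nonneg (fun k _ => hpos k) a
  · exact fun k => Set.indicator_nonneg (fun k _ => hpos k) k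
  · intro k hk
    simp [not_lt.2 hk]
  · rw [← hwx]
    exact E.nrm_indicator_le _ hw
  · have := E.nrm_add_le _ hmem _ (E.indicator_mem (Set.Ici r) hw)
    rw [← hsplit] at this
    linarith
  · rw [← hdwx]
    refine E.nrm_le_of_abs_le hdw fun k => ?_
    simp only [dilate]
    by_cases hk : k / n < r <;> simp [hk]
  · have := E.nrm_add_le _ (E.dilate_mem hn hmem) _
      (E.dilate_mem hn (E.indicator_mem (Set.Ici r) hw))
    rw [← dilate_add, ← hsplit, hdt] at this
    simp only [Function.comp_apply, id] at hr2
    linarith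

end SymmetricSequenceSpace

/-! ### Singular numbers -/

theorem singularNumber_bddBelow (T : Bl2) (n : ℕ) :
    BddBelow {r : ℝ | ∃ F : Bl2, (F : Hl2 →ₗ[ℂ] Hl2).rank ≤ (n : Cardinal) ∧ r = ‖T - F‖} :=
  ⟨0, by rintro _ ⟨F, -, rfl⟩; exact norm_nonneg _⟩

theorem singularNumber_le {T F : Bl2} {n : ℕ} (h : (F : Hl2 →ₗ[ℂ] Hl2).rank ≤ (n : Cardinal)) :
    singularNumber T n ≤ ‖T - F‖ :=
  csInf_le (singularNumber_bddBelow T n) ⟨F, h, rfl⟩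

theorem rank_zero_le (n : ℕ) : ((0 : Bl2) : Hl2 →ₗ[ℂ] Hl2).rank ≤ (n : Cardinal) := by
  rw [ContinuousLinearMap.toLinearMap_zero, LinearMap.rank_zero]
  exact zero_le

theorem le_singularNumber {T : Bl2} {n : ℕ} {r : ℝ}
    (h : ∀ F : Bl2, (F : Hl2 →ₗ[ℂ] Hl2).rank ≤ (n : Cardinal) → r ≤ ‖T - F‖) :
    r ≤ singularNumber T n :=
  le_csInf ⟨_, 0, rank_zero_le n, rfl⟩ (by rintro _ ⟨F, hF, rfl⟩; exact h F hF)

theorem exists_rank_le_norm_sub_lt (T : Bl2) (n : ℕ) {ε : ℝ} (hε : 0 < ε) :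
    ∃ F : Bl2, (F : Hl2 →ₗ[ℂ] Hl2).rank ≤ (n : Cardinal) ∧
      ‖T - F‖ < singularNumber T n + ε := by
  by_contra hc
  push Not at hc
  linarith [le_singularNumber hc]

theorem singularNumber_nonneg (T : Bl2) (n : ℕ) : 0 ≤ singularNumber T n :=
  le_singularNumber fun _ _ => norm_nonneg _

theorem singularNumber_antitone (T : Bl2) : Antitone (singularNumber T) := fun _ _ hmn =>
  le_singularNumber fun _ hF => singularNumber_le (hF.trans (by exact_mod_cast hmn))

theorem singularNumber_le_norm (T : Bl2) (n : ℕ) : singularNumber T n ≤ ‖T‖ := by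
  simpa using singularNumber_le (T := T) (rank_zero_le n)

theorem singularNumber_zero (T : Bl2) : singularNumber T 0 = ‖T‖ := by
  refine le_antisymm (singularNumber_le_norm T 0) (le_singularNumber fun F hF => ?_)
  have h0 : (F : Hl2 →ₗ[ℂ] Hl2).rank = 0 := le_antisymm (by simpa using hF) zero_le
  rw [LinearMap.rank, Submodule.rank_eq_zero, LinearMap.range_eq_bot] at h0
  have : F = 0 := ContinuousLinearMap.coe_injective h0
  simp [this]

theorem rank_add_le_nat {F G : Bl2} {m n : ℕ} (hF : (F : Hl2 →ₗ[ℂ] Hl2).rank ≤ (m : Cardinal))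
    (hG : (G : Hl2 →ₗ[ℂ] Hl2).rank ≤ (n : Cardinal)) :
    ((F + G : Bl2) : Hl2 →ₗ[ℂ] Hl2).rank ≤ ((m + n : ℕ) : Cardinal) := by
  refine (LinearMap.rank_add_le (F : Hl2 →ₗ[ℂ] Hl2) (G : Hl2 →ₗ[ℂ] Hl2)).trans ?_
  rw [Nat.cast_add]
  exact add_le_add hF hG

theorem rank_neg_le {F : Bl2} {m : ℕ} (hF : (F : Hl2 →ₗ[ℂ] Hl2).rank ≤ (m : Cardinal)) :
    ((-F : Bl2) : Hl2 →ₗ[ℂ] Hl2).rank ≤ (m : Cardinal) := by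
  have : ((-F : Bl2) : Hl2 →ₗ[ℂ] Hl2) = (F : Hl2 →ₗ[ℂ] Hl2).comp (-LinearMap.id) := by
    ext1 x
    simp
  rw [this]
  exact (LinearMap.rank_comp_le_left _ _).trans hF

theorem rank_sub_le_nat {F G : Bl2} {m n : ℕ} (hF : (F : Hl2 →ₗ[ℂ] Hl2).rank ≤ (m : Cardinal))
    (hG : (G : Hl2 →ₗ[ℂ] Hl2).rank ≤ (n : Cardinal)) :
    ((F - G : Bl2) : Hl2 →ₗ[ℂ] Hl2).rank ≤ ((m + n : ℕ) : Cardinal) := by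
  rw [sub_eq_add_neg]
  exact rank_add_le_nat hF (rank_neg_le hG)

theorem rank_mul_le_left {F : Bl2} {m : ℕ} (G : Bl2)
    (hF : (F : Hl2 →ₗ[ℂ] Hl2).rank ≤ (m : Cardinal)) :
    ((F * G : Bl2) : Hl2 →ₗ[ℂ] Hl2).rank ≤ (m : Cardinal) :=
  (LinearMap.rank_comp_le_left (G : Hl2 →ₗ[ℂ] Hl2) (F : Hl2 →ₗ[ℂ] Hl2)).trans hF

theorem rank_mul_le_right {F : Bl2} {m : ℕ} (G : Bl2)
    (hF : (F : Hl2 →ₗ[ℂ] Hl2).rank ≤ (m : Cardinal)) :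
    ((G * F : Bl2) : Hl2 →ₗ[ℂ] Hl2).rank ≤ (m : Cardinal) :=
  (LinearMap.rank_comp_le_right (F : Hl2 →ₗ[ℂ] Hl2) (G : Hl2 →ₗ[ℂ] Hl2)).trans hF

theorem finiteDimensional_range {F : Bl2} {m : ℕ}
    (hF : (F : Hl2 →ₗ[ℂ] Hl2).rank ≤ (m : Cardinal)) :
    FiniteDimensional ℂ (LinearMap.range (F : Hl2 →ₗ[ℂ] Hl2)) :=
  Module.rank_lt_aleph0_iff.1 (lt_of_le_of_lt hF (Cardinal.natCast_lt_aleph0))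

theorem finrank_range_le {F : Bl2} {m : ℕ}
    (hF : (F : Hl2 →ₗ[ℂ] Hl2).rank ≤ (m : Cardinal)) :
    Module.finrank ℂ (LinearMap.range (F : Hl2 →ₗ[ℂ] Hl2)) ≤ m := by
  have := finiteDimensional_range hF
  have h : Module.rank ℂ (LinearMap.range (F : Hl2 →ₗ[ℂ] Hl2)) ≤ (m : Cardinal) := hF
  rw [← Module.finrank_eq_rank] at h
  exact_mod_cast h

theorem rank_star_le {F : Bl2} {m : ℕ} (hF : (F : Hl2 →ₗ[ℂ] Hl2).rank ≤ (m : Cardinal)) :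
    ((star F : Bl2) : Hl2 →ₗ[ℂ] Hl2).rank ≤ (m : Cardinal) := by
  have := finiteDimensional_range hF
  let P : Bl2 := (LinearMap.range (F : Hl2 →ₗ[ℂ] Hl2)).starProjection
  have hPF : P * F = F := by
    ext1 x
    exact Submodule.starProjection_eq_self_iff.2 (LinearMap.mem_range_self (F : Hl2 →ₗ[ℂ] Hl2) x)
  have hP : IsSelfAdjoint P := isSelfAdjoint_starProjection _
  have h : star F = star F * P := by
    conv_lhs => rw [← hPF, star_mul, hP.star_eq]
  rw [h]
  refine rank_mul_le_right _ ?_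
  rw [LinearMap.rank, Submodule.range_starProjection]
  exact hF

theorem singularNumber_add_le (S T : Bl2) (m n : ℕ) :
    singularNumber (S + T) (m + n) ≤ singularNumber S m + singularNumber T n := by
  refine le_of_forall_pos_le_add fun ε hε => ?_
  obtain ⟨F, hF, hF'⟩ := exists_rank_le_norm_sub_lt S m (half_pos hε)
  obtain ⟨G, hG, hG'⟩ := exists_rank_le_norm_sub_lt T n (half_pos hε)
  refine (singularNumber_le (rank_add_le_nat hF hG)).trans ?_
  have : S + T - (F + G) = (S - F) + (T - G) := by abel
  rw [this]
  linarith [norm_add_le (S - F) (T - G)]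

theorem singularNumber_mul_le_left (A T : Bl2) (n : ℕ) :
    singularNumber (A * T) n ≤ ‖A‖ * singularNumber T n := by
  refine le_of_forall_pos_le_add fun ε hε => ?_
  obtain ⟨F, hF, hF'⟩ := exists_rank_le_norm_sub_lt T n (ε := ε / (‖A‖ + 1)) (by positivity)
  refine (singularNumber_le (rank_mul_le_right A hF)).trans ?_
  rw [← mul_sub]
  refine (norm_mul_le _ _).trans ?_
  refine (mul_le_mul_of_nonneg_left hF'.le (norm_nonneg A)).trans ?_
  rw [mul_add]
  have : ‖A‖ * (ε / (‖A‖ + 1)) ≤ ε := by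
    rw [mul_div_assoc', div_le_iff₀ (by positivity)]
    nlinarith [norm_nonneg A]
  linarith

theorem singularNumber_star (T : Bl2) (n : ℕ) :
    singularNumber (star T) n = singularNumber T n := by
  have h : ∀ S : Bl2, singularNumber (star S) n ≤ singularNumber S n := fun S =>
    le_singularNumber fun F hF => by
      have := singularNumber_le (T := star S) (rank_star_le hF)
      rwa [← star_sub, norm_star] at this
  exact le_antisymm (h T) (by simpa using h (star T))

theorem singularNumber_mul_le_right (T A : Bl2) (n : ℕ) :
    singularNumber (T * A) n ≤ singularNumber T n * ‖A‖ := by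
  rw [← singularNumber_star, star_mul, mul_comm, ← norm_star A, ← singularNumber_star T]
  exact singularNumber_mul_le_left _ _ _

theorem singularNumber_smul_le (c : ℂ) (T : Bl2) (n : ℕ) :
    singularNumber (c • T) n ≤ ‖c‖ * singularNumber T n := by
  have : c • T = (c • (1 : Bl2)) * T := by rw [smul_mul_assoc, one_mul]
  rw [this]
  refine (singularNumber_mul_le_left _ _ _).trans ?_
  refine mul_le_mul_of_nonneg_right ?_ (singularNumber_nonneg T n)
  rw [norm_smul]
  exact mul_le_of_le_one_right (norm_nonneg c) ContinuousLinearMap.norm_id_le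

theorem singularNumber_neg (T : Bl2) (n : ℕ) : singularNumber (-T) n = singularNumber T n := by
  have h : ∀ S : Bl2, singularNumber (-S) n ≤ singularNumber S n := fun S => by
    simpa using singularNumber_smul_le (-1) S n
  exact le_antisymm (h T) (by simpa using h (-T))

theorem singularNumber_eq_zero {T : Bl2} {m n : ℕ}
    (h : (T : Hl2 →ₗ[ℂ] Hl2).rank ≤ (m : Cardinal)) (hmn : m ≤ n) : singularNumber T n = 0 := by
  refine le_antisymm ?_ (singularNumber_nonneg T n)
  simpa using singularNumber_le (T := T) (h.trans (show (m : Cardinal) ≤ n by exact_mod_cast hmn))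

theorem isCompactOperator_of_tendsto_singularNumber {T : Bl2}
    (h : Tendsto (singularNumber T) atTop (𝓝 0)) : IsCompactOperator T := by
  have hx : ∀ n : ℕ, ∃ F : Bl2, (F : Hl2 →ₗ[ℂ] Hl2).rank ≤ (n : Cardinal) ∧
      ‖T - F‖ < singularNumber T n + 1 / ((n : ℝ) + 1) := fun n =>
    exists_rank_le_norm_sub_lt T n (by positivity)
  choose F hF hF' using hx
  refine isCompactOperator_of_tendsto (l := atTop) (F := F) ?_ (Eventually.of_forall fun n => ?_)
  · rw [tendsto_iff_norm_sub_tendsto_zero]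
    have hlim := h.add (tendsto_one_div_add_atTop_nhds_zero_nat (𝕜 := ℝ))
    rw [add_zero] at hlim
    refine squeeze_zero (fun _ => norm_nonneg _) (fun n => ?_) hlim
    rw [norm_sub_rev]
    exact (hF' n).le
  · have := finiteDimensional_range (hF n)
    let R := LinearMap.range (F n : Hl2 →ₗ[ℂ] Hl2)
    let G : Hl2 →L[ℂ] R := (F n).codRestrict R fun x => LinearMap.mem_range_self _ x
    have hproper : ProperSpace R := FiniteDimensional.proper ℂ R
    exact IsCompactOperator.clm_comp (f := G) (isCompactOperator_of_locallyCompactSpace_dom G)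
      R.subtypeL

theorem singularNumber_sum_le {ι : Type*} (s : Finset ι) (T : ι → Bl2) (m : ι → ℕ) :
    singularNumber (∑ i ∈ s, T i) (∑ i ∈ s, m i) ≤ ∑ i ∈ s, singularNumber (T i) (m i) := by
  classical
  induction s using Finset.induction_on with
  | empty => simp [singularNumber_zero]
  | insert a s ha ih =>
    rw [Finset.sum_insert ha, Finset.sum_insert ha, Finset.sum_insert ha]
    exact (singularNumber_add_le _ _ _ _).trans (by linarith)

local notation "⟪" x ", " y "⟫" => inner ℂ x y

/-! ### Ky Fan norms and Bessel families -/

/-- A finite family of vectors satisfying Bessel's inequality with constant `1`, for instance the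
image of an orthonormal family under a contraction. -/
def IsBessel {ι : Type*} [Fintype ι] (e : ι → Hl2) : Prop :=
  ∀ x : Hl2, ∑ i, ‖⟪e i, x⟫‖ ^ 2 ≤ ‖x‖ ^ 2

theorem Orthonormal.isBessel {ι : Type*} [Fintype ι] {e : ι → Hl2} (h : Orthonormal ℂ e) :
    IsBessel e := fun x => h.sum_inner_products_le x

theorem IsBessel.map {ι : Type*} [Fintype ι] {e : ι → Hl2} (h : IsBessel e) {A : Bl2}
    (hA : ‖A‖ ≤ 1) : IsBessel fun i => A (e i) := by
  intro x
  have h1 : ∀ i, ⟪A (e i), x⟫ = ⟪e i, (star A) x⟫ := fun i => by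
    rw [ContinuousLinearMap.star_eq_adjoint, ContinuousLinearMap.adjoint_inner_right]
  simp only [h1]
  refine (h _).trans ?_
  have h2 : ‖(star A) x‖ ≤ ‖x‖ := by
    exact ((star A).le_opNorm x).trans
      (mul_le_of_le_one_left (norm_nonneg _) ((norm_star A).trans_le hA))
  gcongr

theorem IsBessel.smul {ι : Type*} [Fintype ι] {e : ι → Hl2} (h : IsBessel e) {w : ι → ℂ}
    (hw : ∀ i, ‖w i‖ ≤ 1) : IsBessel fun i => w i • e i := by
  intro x
  refine (Finset.sum_le_sum fun i _ => ?_).trans (h x)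
  rw [inner_smul_left, norm_mul, RCLike.norm_conj]
  have : ‖w i‖ * ‖⟪e i, x⟫‖ ≤ ‖⟪e i, x⟫‖ := mul_le_of_le_one_left (norm_nonneg _) (hw i)
  gcongr

/-- The functional `T ↦ ∑ ⟨f i, T e i⟩`. -/
noncomputable def pairing {ι : Type*} [Fintype ι] (e f : ι → Hl2) (T : Bl2) : ℂ :=
  ∑ i, ⟪f i, T (e i)⟫

section pairing

variable {ι : Type*} [Fintype ι] (e f : ι → Hl2)

theorem pairing_add (S T : Bl2) : pairing e f (S + T) = pairing e f S + pairing e f T := by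
  simp [pairing, Finset.sum_add_distrib]

theorem pairing_sub (S T : Bl2) : pairing e f (S - T) = pairing e f S - pairing e f T := by
  simp [pairing, Finset.sum_sub_distrib]

theorem pairing_smul (c : ℂ) (T : Bl2) : pairing e f (c • T) = c * pairing e f T := by
  simp [pairing, Finset.mul_sum]

theorem norm_pairing_le (T : Bl2) : ‖pairing e f T‖ ≤ (∑ i, ‖f i‖ * ‖e i‖) * ‖T‖ := by
  rw [Finset.sum_mul]
  refine (norm_sum_le _ _).trans (Finset.sum_le_sum fun i _ => ?_)
  calc ‖⟪f i, T (e i)⟫‖ ≤ ‖f i‖ * ‖T (e i)‖ := norm_inner_le_norm _ _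
    _ ≤ ‖f i‖ * (‖T‖ * ‖e i‖) := by gcongr; exact T.le_opNorm _
    _ = _ := by ring

variable {e f}

/-- On operators of rank at most `r`, Bessel functionals have norm at most `r`. -/
theorem norm_pairing_le_of_rank_le (he : IsBessel e) (hf : IsBessel f) {R : Bl2} {r : ℕ}
    (hR : (R : Hl2 →ₗ[ℂ] Hl2).rank ≤ (r : Cardinal)) : ‖pairing e f R‖ ≤ r * ‖R‖ := by
  have := finiteDimensional_range hR
  let b := stdOrthonormalBasis ℂ (LinearMap.range (R : Hl2 →ₗ[ℂ] Hl2))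
  have hb : ∀ x, R x = ∑ m, ⟪((b m : _) : Hl2), R x⟫ • ((b m : _) : Hl2) := fun x => by
    have h1 := b.sum_repr' ⟨R x, LinearMap.mem_range_self (R : Hl2 →ₗ[ℂ] Hl2) x⟩
    have h2 := congrArg Subtype.val h1
    simp only [Submodule.coe_sum, Submodule.coe_smul, Submodule.coe_inner] at h2
    exact h2.symm
  have hp : pairing e f R
      = ∑ m, ∑ i, ⟪f i, ((b m : _) : Hl2)⟫ * ⟪(star R) ((b m : _) : Hl2), e i⟫ := by
    rw [Finset.sum_comm]
    refine Finset.sum_congr rfl fun i _ => ?_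
    rw [hb (e i), inner_sum]
    refine Finset.sum_congr rfl fun m _ => ?_
    rw [inner_smul_right, ContinuousLinearMap.star_eq_adjoint,
      ContinuousLinearMap.adjoint_inner_left, mul_comm]
  have hnb : ∀ m, ‖((b m : _) : Hl2)‖ = 1 := fun m => b.orthonormal.1 m
  have hm : ∀ m, ‖∑ i, ⟪f i, ((b m : _) : Hl2)⟫ * ⟪(star R) ((b m : _) : Hl2), e i⟫‖ ≤ ‖R‖ := by
    intro m
    have h1 : (∑ i, ‖⟪f i, ((b m : _) : Hl2)⟫‖ * ‖⟪e i, (star R) ((b m : _) : Hl2)⟫‖) ^ 2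
        ≤ ‖R‖ ^ 2 := by
      refine (Finset.sum_mul_sq_le_sq_mul_sq _ _ _).trans ?_
      have h2 := hf ((b m : _) : Hl2)
      have h3 := he ((star R) ((b m : _) : Hl2))
      have h4 : ‖(star R) ((b m : _) : Hl2)‖ ≤ ‖R‖ := by
        have := (star R).le_opNorm ((b m : _) : Hl2)
        rw [hnb, mul_one] at this
        exact this.trans_eq (norm_star R)
      rw [hnb, one_pow] at h2
      calc _ ≤ 1 * ‖(star R) ((b m : _) : Hl2)‖ ^ 2 := by gcongr
        _ ≤ ‖R‖ ^ 2 := by rw [one_mul]; gcongr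
    have h5 := (le_abs_self _).trans (abs_le_of_sq_le_sq h1 (norm_nonneg R))
    refine (norm_sum_le _ _).trans ?_
    refine le_trans (le_of_eq ?_) h5
    refine Finset.sum_congr rfl fun i _ => ?_
    rw [norm_mul, norm_inner_symm (star R _) (e i)]
  rw [hp]
  refine (norm_sum_le _ _).trans ((Finset.sum_le_sum fun m _ => hm m).trans ?_)
  rw [Finset.sum_const, Finset.card_univ, Fintype.card_fin, nsmul_eq_mul]
  exact mul_le_mul_of_nonneg_right (by exact_mod_cast finrank_range_le hR) (norm_nonneg R)

theorem pow_mul_le_sum_singularNumber (T : Bl2) (j : ℕ) :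
    (2 : ℝ) ^ j * singularNumber T (2 ^ (j + 1)) ≤
      ∑ k ∈ Finset.range (2 ^ (j + 1)), singularNumber T k -
        ∑ k ∈ Finset.range (2 ^ j), singularNumber T k := by
  have h : 2 ^ j ≤ 2 ^ (j + 1) := Nat.pow_le_pow_right (by norm_num) (by omega)
  rw [← Finset.sum_Ico_eq_sub _ h]
  have h1 := Finset.card_nsmul_le_sum (Finset.Ico (2 ^ j) (2 ^ (j + 1))) (singularNumber T)
    (singularNumber T (2 ^ (j + 1))) fun k hk =>
      singularNumber_antitone T (Finset.mem_Ico.1 hk).2.le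
  rw [Nat.card_Ico, nsmul_eq_mul, pow_succ 2 j] at h1
  have h2 : 2 ^ j * 2 - 2 ^ j = 2 ^ j := by omega
  rw [h2] at h1
  push_cast at h1
  rw [pow_succ 2 j]
  exact h1

/-- Bessel functionals of total mass at most `n` are bounded by a multiple of the Ky Fan norm
`∑_{k<n} s_k`. The operator is decomposed dyadically: the difference of near-optimal approximants
of ranks `2^j` and `2^{j+1}` has rank at most `3 · 2^j` and norm about `s_{2^j}`. -/
theorem norm_pairing_le_sum_singularNumber (he : IsBessel e) (hf : IsBessel f) {n : ℕ}
    (hn : ∑ i, ‖f i‖ * ‖e i‖ ≤ n) (T : Bl2) :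
    ‖pairing e f T‖ ≤ 9 * ∑ k ∈ Finset.range n, singularNumber T k := by
  rcases Nat.eq_zero_or_pos n with rfl | hn0
  · have h := norm_pairing_le e f T
    have h2 : (∑ i, ‖f i‖ * ‖e i‖) * ‖T‖ ≤ 0 :=
      mul_nonpos_of_nonpos_of_nonneg (by simpa using hn) (norm_nonneg T)
    simpa using h.trans h2
  have key : ∀ ε > 0, ‖pairing e f T‖ ≤
      9 * ∑ k ∈ Finset.range n, singularNumber T k + 8 * n * ε := by
    intro ε hε
    choose F hF hF' using fun j : ℕ => exists_rank_le_norm_sub_lt T (2 ^ j) hε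
    have hs := singularNumber_nonneg T
    have hind : ∀ j : ℕ, ‖pairing e f (F j)‖ ≤
        9 * ∑ k ∈ Finset.range (2 ^ j), singularNumber T k
          - 3 * 2 ^ j * singularNumber T (2 ^ j) + 6 * 2 ^ j * ε := by
      intro j
      induction j with
      | zero =>
        have h1 := norm_pairing_le_of_rank_le he hf (hF 0)
        have h2 := hF' 0
        have h3 : ‖F 0‖ ≤ ‖T‖ + ‖T - F 0‖ := by
          have := norm_sub_le T (T - F 0)
          rwa [sub_sub_cancel] at this
        have h4 := singularNumber_antitone T (Nat.zero_le 1)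
        rw [← singularNumber_zero T] at h3
        simp only [pow_zero, Nat.cast_one, one_mul, Finset.range_one, Finset.sum_singleton] at *
        linarith [hs 0]
      | succ j ih =>
        have h1 := norm_pairing_le_of_rank_le he hf (rank_sub_le_nat (hF (j + 1)) (hF j))
        have h2 : ‖F (j + 1) - F j‖ ≤
            singularNumber T (2 ^ (j + 1)) + singularNumber T (2 ^ j) + 2 * ε := by
          have : F (j + 1) - F j = (T - F j) - (T - F (j + 1)) := by abel
          rw [this]
          linarith [norm_sub_le (T - F j) (T - F (j + 1)), hF' j, hF' (j + 1)]
        have h3 : ‖pairing e f (F (j + 1))‖ ≤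
            ‖pairing e f (F (j + 1) - F j)‖ + ‖pairing e f (F j)‖ := by
          have : pairing e f (F (j + 1)) = pairing e f (F (j + 1) - F j) + pairing e f (F j) := by
            rw [pairing_sub, sub_add_cancel]
          rw [this]
          exact norm_add_le _ _
        have h4 := pow_mul_le_sum_singularNumber T j
        have h5 : (0 : ℝ) < 2 ^ j := by positivity
        have h6 : ((2 ^ (j + 1) + 2 ^ j : ℕ) : ℝ) = 3 * 2 ^ j := by
          push_cast
          ring
        rw [h6] at h1
        have h7 := mul_le_mul_of_nonneg_left h2 (show (0 : ℝ) ≤ 3 * 2 ^ j by positivity)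
        have h8 : (2 : ℝ) ^ (j + 1) = 2 * 2 ^ j := by ring
        rw [h8]
        nlinarith
    obtain ⟨p, hp1, hp2⟩ : ∃ p, 2 ^ p ≤ n ∧ n < 2 ^ (p + 1) :=
      ⟨Nat.log 2 n, Nat.pow_log_le_self 2 hn0.ne', Nat.lt_pow_succ_log_self (by norm_num) n⟩
    have h1 : ‖pairing e f T‖ ≤ ‖pairing e f (T - F p)‖ + ‖pairing e f (F p)‖ := by
      have : pairing e f T = pairing e f (T - F p) + pairing e f (F p) := by
        rw [pairing_sub, sub_add_cancel]
      conv_lhs => rw [this]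
      exact norm_add_le _ _
    have h2 : ‖pairing e f (T - F p)‖ ≤ n * (singularNumber T (2 ^ p) + ε) :=
      (norm_pairing_le e f _).trans (mul_le_mul hn (hF' p).le (norm_nonneg _) (Nat.cast_nonneg n))
    have h3 : (n : ℝ) ≤ 2 * 2 ^ p := by
      have : n ≤ 2 * 2 ^ p := by rw [pow_succ] at hp2; omega
      exact_mod_cast this
    have h3' : (2 : ℝ) ^ p ≤ n := by exact_mod_cast hp1
    have h4 : ∑ k ∈ Finset.range (2 ^ p), singularNumber T k ≤
        ∑ k ∈ Finset.range n, singularNumber T k :=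
      Finset.sum_le_sum_of_subset_of_nonneg (Finset.range_mono hp1) fun k _ _ => hs k
    have h5 := mul_le_mul_of_nonneg_right h3 (hs (2 ^ p))
    have h6 := mul_le_mul_of_nonneg_right h3' hε.le
    have h7 : 0 ≤ (2 : ℝ) ^ p * singularNumber T (2 ^ p) := mul_nonneg (by positivity) (hs _)
    have h8 : 0 ≤ (n : ℝ) * ε := by positivity
    nlinarith [hind p]
  refine le_of_forall_pos_le_add fun ε hε => ?_
  have hn' : (0 : ℝ) < n := by exact_mod_cast hn0
  have := key (ε / (8 * n)) (by positivity)
  have h2 : 8 * (n : ℝ) * (ε / (8 * n)) = ε := by field_simp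
  rwa [h2] at this

end pairing

theorem norm_sub_inner_smul_sq_le {e₀ : Hl2} (h : ‖e₀‖ ≤ 1) (x : Hl2) :
    ‖x - ⟪e₀, x⟫ • e₀‖ ^ 2 + ‖⟪e₀, x⟫‖ ^ 2 ≤ ‖x‖ ^ 2 := by
  have h1 := norm_sub_sq (𝕜 := ℂ) x (⟪e₀, x⟫ • e₀)
  have h2 : RCLike.re ⟪x, ⟪e₀, x⟫ • e₀⟫ = ‖⟪e₀, x⟫‖ ^ 2 := by
    rw [inner_smul_right, ← inner_conj_symm x e₀, RCLike.mul_conj]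
    norm_cast
  rw [h1, h2, norm_smul, mul_pow]
  have h3 : ‖e₀‖ ^ 2 ≤ 1 := pow_le_one₀ (norm_nonneg _) h
  nlinarith [sq_nonneg ‖⟪e₀, x⟫‖]

/-- A Ky Fan norm is almost attained by a Bessel functional, up to passing to every other singular
number. The vectors are found greedily: a pair almost attaining `‖T‖` is split off on both sides,
which changes `T` by an operator of rank at most `2`. -/
theorem exists_pairing_ge (k : ℕ) (T : Bl2) {ε : ℝ} (hε : 0 < ε) :
    ∃ e f : Fin k → Hl2, IsBessel e ∧ IsBessel f ∧ (∀ i, ‖e i‖ ≤ 1) ∧ (∀ i, ‖f i‖ ≤ 1) ∧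
      ∑ j ∈ Finset.range k, singularNumber T (2 * j) ≤ (pairing e f T).re + k * ε := by
  induction k generalizing T with
  | zero =>
    refine ⟨fun _ => 0, fun _ => 0, ?_, ?_, ?_, ?_, ?_⟩ <;> simp [IsBessel, pairing]
  | succ k ih =>
    obtain ⟨e₀, he₀, hT⟩ := T.exists_lt_apply_of_lt_opNorm (r := ‖T‖ - ε) (by linarith)
    let f₀ : Hl2 := ((‖T e₀‖ : ℂ))⁻¹ • T e₀
    have hf₀ : ‖f₀‖ ≤ 1 := by
      rw [norm_smul, norm_inv, Complex.norm_real, norm_norm]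
      exact inv_mul_le_one
    have hf₀T : ⟪f₀, T e₀⟫ = (‖T e₀‖ : ℂ) := by
      rw [inner_smul_left, inner_self_eq_norm_sq_to_K]
      rcases eq_or_ne (T e₀) 0 with h | h
      · simp [h]
      · have : (‖T e₀‖ : ℂ) ≠ 0 := by simpa using h
        simp only [map_inv₀, Complex.conj_ofReal, Complex.coe_algebraMap]
        field_simp
    let P : Bl2 := InnerProductSpace.rankOne ℂ e₀ e₀
    let Q : Bl2 := InnerProductSpace.rankOne ℂ f₀ f₀
    have hrk : ∀ x : Hl2, ((InnerProductSpace.rankOne ℂ x x : Bl2) : Hl2 →ₗ[ℂ] Hl2).rank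
        ≤ ((1 : ℕ) : Cardinal) := by
      intro x
      rcases eq_or_ne x 0 with rfl | h
      · simp
      · rw [InnerProductSpace.rank_rankOne h h]
        simp
    let A : Bl2 := (1 - Q) * T * (1 - P)
    obtain ⟨e, f, he, hf, he1, hf1, hsum⟩ := ih A
    have hsub : ∀ x, ∀ y z : Hl2, ⟪y - ⟪x, y⟫ • x, z⟫ = ⟪y, z - ⟪x, z⟫ • x⟫ := by
      intro x y z
      rw [inner_sub_left, inner_sub_right, inner_smul_left, inner_smul_right, inner_conj_symm]
      ring
    have hbes : ∀ (x : Hl2) (u : Fin k → Hl2), ‖x‖ ≤ 1 → IsBessel u →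
        IsBessel (Fin.cons x fun i => u i - ⟪x, u i⟫ • x : Fin (k + 1) → Hl2) := by
      intro x u hx hu z
      rw [Fin.sum_univ_succ]
      simp only [Fin.cons_zero, Fin.cons_succ, hsub]
      have h1 := hu (z - ⟪x, z⟫ • x)
      have h2 := norm_sub_inner_smul_sq_le hx z
      linarith
    have hnorm : ∀ x y : Hl2, ‖x‖ ≤ 1 → ‖y‖ ≤ 1 → ‖y - ⟪x, y⟫ • x‖ ≤ 1 := by
      intro x y hx hy
      have h1 := norm_sub_inner_smul_sq_le hx y
      have h2 : ‖y‖ ^ 2 ≤ 1 := pow_le_one₀ (norm_nonneg _) hy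
      refine abs_le_of_sq_le_sq' ?_ zero_le_one |>.2
      nlinarith [sq_nonneg ‖⟪x, y⟫‖]
    refine ⟨Fin.cons e₀ fun i => e i - ⟪e₀, e i⟫ • e₀, Fin.cons f₀ fun i => f i - ⟪f₀, f i⟫ • f₀,
      hbes _ _ he₀.le he, hbes _ _ hf₀ hf, ?_, ?_, ?_⟩
    · exact Fin.cases he₀.le fun i => hnorm _ _ he₀.le (he1 i)
    · exact Fin.cases hf₀ fun i => hnorm _ _ hf₀ (hf1 i)
    · have hpair : pairing (Fin.cons e₀ fun i => e i - ⟪e₀, e i⟫ • e₀ : Fin (k + 1) → Hl2)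
          (Fin.cons f₀ fun i => f i - ⟪f₀, f i⟫ • f₀ : Fin (k + 1) → Hl2) T
          = (‖T e₀‖ : ℂ) + pairing e f A := by
        rw [pairing, Fin.sum_univ_succ]
        simp only [Fin.cons_zero, Fin.cons_succ, hsub, hf₀T]
        rfl
      have hsh : ∀ j, singularNumber T (2 * (j + 1)) ≤ singularNumber A (2 * j) := by
        intro j
        have h1 : T - A = Q * T + (1 - Q) * T * P := by
          simp only [A]
          noncomm_ring
        have h2 : ((T - A : Bl2) : Hl2 →ₗ[ℂ] Hl2).rank ≤ ((2 : ℕ) : Cardinal) := by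
          rw [h1]
          exact rank_add_le_nat (rank_mul_le_left T (hrk f₀)) (rank_mul_le_right _ (hrk e₀))
        have h3 := singularNumber_add_le A (T - A) (2 * j) 2
        rw [singularNumber_eq_zero h2 le_rfl, add_sub_cancel, add_zero] at h3
        exact h3
      rw [hpair, Complex.add_re, Complex.ofReal_re, Finset.sum_range_succ', mul_zero,
        singularNumber_zero]
      have := Finset.sum_le_sum fun j (_ : j ∈ Finset.range k) => hsh j
      push_cast
      linarith

theorem sum_singularNumber_le_two_mul (T : Bl2) (n : ℕ) :
    ∑ k ∈ Finset.range n, singularNumber T k ≤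
      2 * ∑ j ∈ Finset.range n, singularNumber T (2 * j) := by
  rw [Finset.mul_sum]
  refine Finset.sum_le_sum_of_subset_of_nonneg (Finset.range_mono (by omega : n ≤ 2 * n))
    (fun k _ _ => singularNumber_nonneg T k) |>.trans ?_
  induction n with
  | zero => simp
  | succ n ih =>
    rw [Finset.sum_range_succ, mul_add, Finset.sum_range_succ, Finset.sum_range_succ]
    have := singularNumber_antitone T (show 2 * n ≤ 2 * n + 1 by omega)
    linarith

/-- If all Bessel functionals are dominated by those of `D`, so are the Ky Fan norms. -/
theorem sum_singularNumber_le_of_pairing_le {A : Bl2} {n : ℕ} {M : ℝ}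
    (h : ∀ e f : Fin n → Hl2, IsBessel e → IsBessel f → (∀ i, ‖e i‖ ≤ 1) → (∀ i, ‖f i‖ ≤ 1) →
      ‖pairing e f A‖ ≤ M) :
    ∑ k ∈ Finset.range n, singularNumber A k ≤ 2 * M := by
  refine le_of_forall_pos_le_add fun ε hε => ?_
  obtain ⟨e, f, he, hf, he1, hf1, hs⟩ :=
    exists_pairing_ge n A (ε := ε / (2 * (n + 1))) (by positivity)
  have h1 := sum_singularNumber_le_two_mul A n
  have h2 := (Complex.re_le_norm _).trans (h e f he hf he1 hf1)
  have h3 : (n : ℝ) * (ε / (2 * (n + 1))) ≤ ε / 2 := by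
    rw [mul_div_assoc', div_le_iff₀ (by positivity)]
    nlinarith
  linarith

/-! ### The ideal of a separable symmetric sequence space -/

namespace SymmetricSequenceSpace

variable {E : SymmetricSequenceSpace}

theorem mem_ideal_iff (hsep : E.IsSeparable) {T : Bl2} :
    T ∈ E.ideal ↔ singularNumber T ∈ E.carrier :=
  ⟨fun h => h.2, fun h => ⟨isCompactOperator_of_tendsto_singularNumber
    (tendsto_zero_of_mem hsep h), h⟩⟩

theorem singularNumber_mem_of_le {T : Bl2} {x : ℕ → ℝ} (hx : x ∈ E.carrier)
    (h : ∀ n, singularNumber T n ≤ x n) : singularNumber T ∈ E.carrier :=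
  E.mem_of_abs_le hx fun k => by
    rw [abs_of_nonneg (singularNumber_nonneg T k)]
    exact (h k).trans (le_abs_self _)

theorem idealNorm_le_of_le {T : Bl2} {x : ℕ → ℝ} (hx : x ∈ E.carrier)
    (h : ∀ n, singularNumber T n ≤ x n) : E.idealNorm T ≤ E.nrm x :=
  E.nrm_le_of_abs_le hx fun k => by
    rw [abs_of_nonneg (singularNumber_nonneg T k)]
    exact (h k).trans (le_abs_self _)

theorem mem_ideal_of_le (hsep : E.IsSeparable) {T S : Bl2} (hS : S ∈ E.ideal) {c : ℝ}
    (h : ∀ n, singularNumber T n ≤ c * singularNumber S n) : T ∈ E.ideal :=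
  (mem_ideal_iff hsep).2 (singularNumber_mem_of_le (E.carrier.smul_mem c hS.2) h)

theorem idealNorm_le_mul {T S : Bl2} (hS : S ∈ E.ideal) {c : ℝ} (hc : 0 ≤ c)
    (h : ∀ n, singularNumber T n ≤ c * singularNumber S n) :
    E.idealNorm T ≤ c * E.idealNorm S := by
  have := idealNorm_le_of_le (E.carrier.smul_mem c hS.2) h
  rwa [E.nrm_smul _ _ hS.2, abs_of_nonneg hc] at this

theorem idealNorm_nonneg {T : Bl2} (hT : T ∈ E.ideal) : 0 ≤ E.idealNorm T :=
  E.nrm_nonneg hT.2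

theorem singularNumber_add_le_dilate (S T : Bl2) (k : ℕ) : singularNumber (S + T) k ≤
    (dilate 2 (singularNumber S) + dilate 2 (singularNumber T)) k := by
  refine (singularNumber_antitone _ (by omega : k / 2 + k / 2 ≤ k)).trans ?_
  exact singularNumber_add_le S T (k / 2) (k / 2)

theorem add_mem_ideal (hsep : E.IsSeparable) {S T : Bl2} (hS : S ∈ E.ideal) (hT : T ∈ E.ideal) :
    S + T ∈ E.ideal :=
  (mem_ideal_iff hsep).2 (singularNumber_mem_of_le
    (E.carrier.add_mem (E.dilate_mem two_pos hS.2) (E.dilate_mem two_pos hT.2))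
    (singularNumber_add_le_dilate S T))

/-- A quasi-triangle inequality; the constant is immaterial for the topology. -/
theorem idealNorm_add_le {S T : Bl2} (hS : S ∈ E.ideal) (hT : T ∈ E.ideal) :
    E.idealNorm (S + T) ≤ 2 * (E.idealNorm S + E.idealNorm T) := by
  have h1 := E.dilate_mem two_pos hS.2
  have h2 := E.dilate_mem two_pos hT.2
  refine (idealNorm_le_of_le (E.carrier.add_mem h1 h2) (singularNumber_add_le_dilate S T)).trans ?_
  refine (E.nrm_add_le _ h1 _ h2).trans ?_
  have h3 := E.nrm_dilate_le two_pos hS.2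
  have h4 := E.nrm_dilate_le two_pos hT.2
  push_cast at h3 h4
  unfold idealNorm
  linarith

theorem mul_mem_ideal_left (hsep : E.IsSeparable) (A : Bl2) {T : Bl2} (hT : T ∈ E.ideal) :
    A * T ∈ E.ideal := mem_ideal_of_le hsep hT (singularNumber_mul_le_left A T)

theorem mul_mem_ideal_right (hsep : E.IsSeparable) (A : Bl2) {T : Bl2} (hT : T ∈ E.ideal) :
    T * A ∈ E.ideal := mem_ideal_of_le hsep hT (c := ‖A‖) fun n => by
  rw [mul_comm]
  exact singularNumber_mul_le_right T A n

theorem idealNorm_mul_le_left (A : Bl2) {T : Bl2} (hT : T ∈ E.ideal) :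
    E.idealNorm (A * T) ≤ ‖A‖ * E.idealNorm T :=
  idealNorm_le_mul hT (norm_nonneg A) (singularNumber_mul_le_left A T)

theorem idealNorm_mul_le_right (A : Bl2) {T : Bl2} (hT : T ∈ E.ideal) :
    E.idealNorm (T * A) ≤ ‖A‖ * E.idealNorm T :=
  idealNorm_le_mul hT (norm_nonneg A) fun n => by
    rw [mul_comm]
    exact singularNumber_mul_le_right T A n

theorem idealNorm_mul_mul_le (hsep : E.IsSeparable) {A B T : Bl2} (hA : ‖A‖ ≤ 1) (hB : ‖B‖ ≤ 1)
    (hT : T ∈ E.ideal) : E.idealNorm (A * T * B) ≤ E.idealNorm T := by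
  have h1 := idealNorm_mul_le_left A hT
  have h2 := idealNorm_mul_le_right B (mul_mem_ideal_left hsep A hT)
  have h3 := idealNorm_nonneg hT
  have h4 := idealNorm_nonneg (mul_mem_ideal_left hsep A hT)
  nlinarith

theorem smul_mem_ideal (hsep : E.IsSeparable) (c : ℂ) {T : Bl2} (hT : T ∈ E.ideal) :
    c • T ∈ E.ideal := mem_ideal_of_le hsep hT (singularNumber_smul_le c T)

theorem idealNorm_smul_le (c : ℂ) {T : Bl2} (hT : T ∈ E.ideal) :
    E.idealNorm (c • T) ≤ ‖c‖ * E.idealNorm T :=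
  idealNorm_le_mul hT (norm_nonneg c) (singularNumber_smul_le c T)

theorem idealNorm_neg (T : Bl2) : E.idealNorm (-T) = E.idealNorm T := by
  unfold idealNorm
  rw [funext (singularNumber_neg T)]

theorem neg_mem_ideal {T : Bl2} (hT : T ∈ E.ideal) (hsep : E.IsSeparable) : -T ∈ E.ideal :=
  (mem_ideal_iff hsep).2 (by rw [funext (singularNumber_neg T)]; exact hT.2)

theorem sub_mem_ideal (hsep : E.IsSeparable) {S T : Bl2} (hS : S ∈ E.ideal) (hT : T ∈ E.ideal) :
    S - T ∈ E.ideal := by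
  rw [sub_eq_add_neg]
  exact add_mem_ideal hsep hS (neg_mem_ideal hT hsep)

theorem idealNorm_sub_le (hsep : E.IsSeparable) {S T : Bl2} (hS : S ∈ E.ideal)
    (hT : T ∈ E.ideal) : E.idealNorm (S - T) ≤ 2 * (E.idealNorm S + E.idealNorm T) := by
  rw [sub_eq_add_neg, ← idealNorm_neg T]
  exact idealNorm_add_le hS (neg_mem_ideal hT hsep)

theorem star_mem_ideal (hsep : E.IsSeparable) {T : Bl2} (hT : T ∈ E.ideal) :
    star T ∈ E.ideal :=
  (mem_ideal_iff hsep).2 (by rw [funext (singularNumber_star T)]; exact hT.2)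

theorem idealNorm_star (T : Bl2) : E.idealNorm (star T) = E.idealNorm T := by
  unfold idealNorm
  rw [funext (singularNumber_star T)]

theorem norm_mul_le_idealNorm {T : Bl2} (hT : T ∈ E.ideal) :
    ‖T‖ * E.nrm (Pi.single 0 1) ≤ E.idealNorm T := by
  have := E.abs_mul_nrm_single_le hT.2 0
  rwa [singularNumber_zero, abs_of_nonneg (norm_nonneg T)] at this

theorem singularNumber_le_dilate_single {T : Bl2} {r : ℕ}
    (h : (T : Hl2 →ₗ[ℂ] Hl2).rank ≤ (r : Cardinal)) (hr : 0 < r) (n : ℕ) :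
    singularNumber T n ≤ (‖T‖ • dilate r (Pi.single 0 1)) n := by
  simp only [Pi.smul_apply, smul_eq_mul, dilate]
  by_cases hn : n < r
  · rw [Nat.div_eq_of_lt hn, Pi.single_eq_same, mul_one]
    exact singularNumber_le_norm T n
  · rw [singularNumber_eq_zero h (not_lt.1 hn), Pi.single_eq_of_ne, mul_zero]
    exact (Nat.div_pos (not_lt.1 hn) hr).ne'

theorem mem_ideal_of_rank_le (hsep : E.IsSeparable) {T : Bl2} {r : ℕ}
    (h : (T : Hl2 →ₗ[ℂ] Hl2).rank ≤ (r : Cardinal)) : T ∈ E.ideal :=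
  (mem_ideal_iff hsep).2 (singularNumber_mem_of_le
    (E.carrier.smul_mem _ (E.dilate_mem r.succ_pos E.single_mem))
    (singularNumber_le_dilate_single (h.trans (by exact_mod_cast r.le_succ)) r.succ_pos))

theorem idealNorm_le_of_rank_le {T : Bl2} {r : ℕ}
    (h : (T : Hl2 →ₗ[ℂ] Hl2).rank ≤ (r : Cardinal)) :
    E.idealNorm T ≤ (r + 1) * E.nrm (Pi.single 0 1) * ‖T‖ := by
  have h1 := E.dilate_mem r.succ_pos E.single_mem
  refine (idealNorm_le_of_le (E.carrier.smul_mem ‖T‖ h1)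
    (singularNumber_le_dilate_single (h.trans (by exact_mod_cast r.le_succ)) r.succ_pos)).trans ?_
  rw [E.nrm_smul _ _ h1, abs_of_nonneg (norm_nonneg T), mul_comm]
  refine mul_le_mul_of_nonneg_right ?_ (norm_nonneg T)
  have := E.nrm_dilate_le r.succ_pos E.single_mem
  push_cast at this
  exact this

theorem tendsto_idealNorm_of_rank_le (hsep : E.IsSeparable) {ι : Type*} {l : Filter ι}
    {T : ι → Bl2} {r : ℕ} (h : ∀ i, (T i : Hl2 →ₗ[ℂ] Hl2).rank ≤ (r : Cardinal))
    (h0 : Tendsto (fun i => ‖T i‖) l (𝓝 0)) : Tendsto (fun i => E.idealNorm (T i)) l (𝓝 0) := by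
  refine squeeze_zero (fun i => idealNorm_nonneg (mem_ideal_of_rank_le hsep (h i)))
    (fun i => idealNorm_le_of_rank_le (h i)) ?_
  simpa using h0.const_mul ((r + 1) * E.nrm (Pi.single 0 1))

/-- Ky Fan domination: the norm of the ideal is monotone for submajorization. -/
theorem idealNorm_le_of_sum_le {A D : Bl2} (hA : A ∈ E.ideal) (hD : D ∈ E.ideal) {c : ℝ}
    (hc : 0 ≤ c) (h : ∀ n, ∑ k ∈ Finset.range n, singularNumber A k ≤
      c * ∑ k ∈ Finset.range n, singularNumber D k) : E.idealNorm A ≤ c * E.idealNorm D := by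
  unfold idealNorm
  rw [← abs_of_nonneg hc, ← E.nrm_smul _ _ hD.2]
  refine E.nrm_le_of_submajorized _ (E.carrier.smul_mem c hD.2) _ hA.2 ?_
  refine submajorized_of_antitone (singularNumber_antitone A) (singularNumber_nonneg A)
    (fun m n hmn => mul_le_mul_of_nonneg_left (singularNumber_antitone D hmn) hc)
    (fun n => mul_nonneg hc (singularNumber_nonneg D n)) fun n => ?_
  simp only [Pi.smul_apply, smul_eq_mul, ← Finset.mul_sum]
  exact h n

/-- Finite rank operators are dense in the ideal. -/
theorem exists_rank_le_idealNorm_sub_lt (hsep : E.IsSeparable) {T : Bl2} (hT : T ∈ E.ideal)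
    {ε : ℝ} (hε : 0 < ε) :
    ∃ (F : Bl2) (r : ℕ), (F : Hl2 →ₗ[ℂ] Hl2).rank ≤ (r : Cardinal) ∧ E.idealNorm (T - F) < ε := by
  set s := singularNumber T with hs
  have hc := E.nrm_single_pos
  obtain ⟨p, hp⟩ := ((tendsto_nrm_tail hsep hT.2).eventually
    (gt_mem_nhds (show 0 < ε / 8 by linarith))).exists
  set η := ε / (8 * (4 * p + 1) * E.nrm (Pi.single 0 1)) with hη
  have hη0 : 0 < η := by positivity
  obtain ⟨F, hF, hF'⟩ := exists_rank_le_norm_sub_lt T (2 * p) hη0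
  refine ⟨F, 2 * p, hF, ?_⟩
  have hshift : (fun i => s (p + i)) ∈ E.carrier :=
    E.mem_of_injOn hT.2 (fun i => p + i) (fun a _ b _ h => by simpa using h) fun _ _ => le_rfl
  have hshiftn : E.nrm (fun i => s (p + i)) ≤ E.nrm ((Set.Ici p).indicator s) :=
    E.nrm_le_of_injOn (E.indicator_mem _ hT.2) (fun i => p + i)
      (fun a _ b _ h => by simpa using h) fun i _ => by simp
  have h4 : (0 : ℕ) < 4 := by norm_num
  have hd1 := E.dilate_mem h4 hshift
  have hd2 := E.dilate_mem (4 * p).succ_pos E.single_mem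
  have hle : ∀ j, singularNumber (T - F) j ≤
      (dilate 4 (fun i => s (p + i)) + η • dilate (4 * p + 1) (Pi.single 0 1)) j := by
    intro j
    simp only [Pi.add_apply, Pi.smul_apply, smul_eq_mul, dilate]
    by_cases hj : j < 4 * p + 1
    · rw [Nat.div_eq_of_lt hj, Pi.single_eq_same, mul_one]
      refine (singularNumber_le_norm _ _).trans (hF'.le.trans ?_)
      have : s (2 * p) ≤ s (p + j / 4) := singularNumber_antitone T (by omega)
      linarith
    · have h0 : 0 ≤ η * (Pi.single 0 1 : ℕ → ℝ) (j / (4 * p + 1)) := by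
        refine mul_nonneg hη0.le ?_
        rw [Pi.single_apply]
        split_ifs <;> norm_num
      have h1 := singularNumber_add_le T (-F) (j - 2 * p) (2 * p)
      rw [singularNumber_eq_zero (rank_neg_le hF) le_rfl, add_zero, ← sub_eq_add_neg,
        show j - 2 * p + 2 * p = j by omega] at h1
      have h2 : s (j - 2 * p) ≤ s (p + j / 4) := singularNumber_antitone T (by omega)
      linarith
  refine (idealNorm_le_of_le (E.carrier.add_mem hd1 (E.carrier.smul_mem η hd2)) hle).trans_lt ?_
  refine (E.nrm_add_le _ hd1 _ (E.carrier.smul_mem η hd2)).trans_lt ?_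
  rw [E.nrm_smul _ _ hd2, abs_of_pos hη0]
  have h5 := E.nrm_dilate_le h4 hshift
  have h6 := mul_le_mul_of_nonneg_left (E.nrm_dilate_le (4 * p).succ_pos E.single_mem) hη0.le
  have h7 : η * (((4 * p).succ : ℕ) * E.nrm (Pi.single 0 1)) = ε / 8 := by
    rw [hη]
    push_cast
    field_simp
  rw [h7] at h6
  push_cast at h5
  simp only [Nat.succ_eq_add_one] at h6
  linarith

theorem sum_div_two_pow_add_le (k M : ℕ) :
    ∑ n ∈ Finset.range M, k / 2 ^ (n + 1) + k / 2 ^ M ≤ k := by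
  induction M with
  | zero => simp
  | succ M ih =>
    rw [Finset.sum_range_succ]
    have : k / 2 ^ (M + 1) = k / 2 ^ M / 2 := by rw [pow_succ, Nat.div_div_eq_div_mul]
    omega

/-- A series of operators with geometrically small norms converges to an element of the ideal: its
`k`-th singular number is at most `∑ₙ s_{⌊k / 2^{n+1}⌋}(Tₙ)`, because these indices add up to at
most `k`. -/
theorem summable_and_tsum_mem_ideal (hsep : E.IsSeparable) {T : ℕ → Bl2}
    (hT : ∀ n, T n ∈ E.ideal) (h : ∀ n, E.idealNorm (T n) ≤ 8⁻¹ ^ n) :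
    Summable (fun n => ‖T n‖) ∧ ∑' n, T n ∈ E.ideal := by
  have hc := E.nrm_single_pos
  have hsum : Summable fun n => ‖T n‖ := by
    refine Summable.of_nonneg_of_le (fun n => norm_nonneg _) (fun n => ?_)
      ((summable_geometric_of_lt_one (r := (8⁻¹ : ℝ)) (by norm_num) (by norm_num)).mul_right
        (E.nrm (Pi.single 0 1))⁻¹)
    rw [← div_eq_mul_inv, le_div_iff₀ hc]
    exact (norm_mul_le_idealNorm (hT n)).trans (h n)
  refine ⟨hsum, (mem_ideal_iff hsep).2 ?_⟩
  let d : ℕ → ℕ → ℝ := fun n => dilate (2 ^ (n + 1)) (singularNumber (T n))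
  have hd : ∀ n, d n ∈ E.carrier := fun n => E.dilate_mem (by positivity) (hT n).2
  have hdn : ∀ n, E.nrm (d n) ≤ 2 * 4⁻¹ ^ n := by
    intro n
    refine (E.nrm_dilate_le (by positivity) (hT n).2).trans ?_
    refine (mul_le_mul_of_nonneg_left (h n) (Nat.cast_nonneg _)).trans_eq ?_
    push_cast
    rw [pow_succ, mul_comm _ (2 : ℝ), mul_assoc, ← mul_pow]
    norm_num
  let u : ℕ → ℕ → ℝ := fun M => ∑ n ∈ Finset.range M, d n
  have hu : ∀ M, u M ∈ E.carrier := fun M => E.carrier.sum_mem fun n _ => hd n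
  have hgeo : Tendsto (fun N : ℕ => 4 * (4⁻¹ : ℝ) ^ N) atTop (𝓝 0) := by
    simpa using (tendsto_pow_atTop_nhds_zero_of_lt_one (r := (4⁻¹ : ℝ)) (by norm_num)
      (by norm_num)).const_mul 4
  have hdiff : ∀ N M, N ≤ M → E.nrm (u M - u N) ≤ 4 * 4⁻¹ ^ N := by
    intro N M hNM
    have h1 : u M - u N = ∑ n ∈ Finset.Ico N M, d n := (Finset.sum_Ico_eq_sub _ hNM).symm
    rw [h1]
    refine (E.nrm_sum_le _ _ fun n _ => hd n).trans ((Finset.sum_le_sum fun n _ => hdn n).trans ?_)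
    rw [← Finset.mul_sum, geom_sum_Ico (by norm_num) hNM]
    have : (0 : ℝ) ≤ 4⁻¹ ^ M := by positivity
    have : (0 : ℝ) ≤ 4⁻¹ ^ N := by positivity
    have e : (2 : ℝ) * ((4⁻¹ ^ M - 4⁻¹ ^ N) / (4⁻¹ - 1)) = 8 / 3 * (4⁻¹ ^ N - 4⁻¹ ^ M) := by ring
    rw [e]
    linarith
  obtain ⟨z, hz, hlim⟩ := E.complete u hu (by
    intro ε hε
    obtain ⟨N, hN⟩ := (hgeo.eventually (gt_mem_nhds hε)).exists_forall_of_atTop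
    refine ⟨N, fun m hm n hn => ?_⟩
    rcases le_total n m with hnm | hnm
    · exact (hdiff n m hnm).trans_lt (hN n hn)
    · rw [← E.nrm_neg (E.carrier.sub_mem (hu m) (hu n)), neg_sub]
      exact (hdiff m n hnm).trans_lt (hN m hm))
  refine singularNumber_mem_of_le hz fun k => ?_
  have hcoord : Tendsto (fun M => u M k) atTop (𝓝 (z k)) := by
    rw [tendsto_iff_norm_sub_tendsto_zero]
    have h1 := hlim.div_const (E.nrm (Pi.single 0 1))
    rw [zero_div] at h1
    refine squeeze_zero (fun _ => norm_nonneg _) (fun M => ?_) h1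
    rw [le_div_iff₀ hc]
    exact E.abs_mul_nrm_single_le (E.carrier.sub_mem (hu M) hz) k
  have htail : Tendsto (fun M => ‖∑' n, T n - ∑ n ∈ Finset.range M, T n‖) atTop (𝓝 0) := by
    have h1 := (hsum.of_norm.hasSum.tendsto_sum_nat)
    rw [tendsto_iff_norm_sub_tendsto_zero] at h1
    simpa only [norm_sub_rev] using h1
  have hlim2 := hcoord.add htail
  rw [add_zero] at hlim2
  refine ge_of_tendsto' hlim2 fun M => ?_
  have h1 := singularNumber_add_le (∑ n ∈ Finset.range M, T n)
    (∑' n, T n - ∑ n ∈ Finset.range M, T n) (∑ n ∈ Finset.range M, k / 2 ^ (n + 1)) 0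
  rw [add_sub_cancel, singularNumber_zero, add_zero] at h1
  have h2 := singularNumber_sum_le (Finset.range M) T fun n => k / 2 ^ (n + 1)
  have h3 := singularNumber_antitone (∑' n, T n)
    (show ∑ n ∈ Finset.range M, k / 2 ^ (n + 1) ≤ k by
      exact (Nat.le_add_right _ _).trans (sum_div_two_pow_add_le k M))
  have h4 : u M k = ∑ n ∈ Finset.range M, singularNumber (T n) (k / 2 ^ (n + 1)) := by
    simp only [u, Finset.sum_apply, d, dilate]
  rw [h4]
  linarith

end SymmetricSequenceSpace

open InnerProductSpace (rankOne)

/-! ### Operators that are diagonal with respect to two orthonormal families -/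

theorem rank_le_of_forall_mem_span {κ : Type*} {F : Bl2} (s : Finset κ) (p : κ → Hl2)
    (h : ∀ x, F x ∈ Submodule.span ℂ (p '' s)) :
    (F : Hl2 →ₗ[ℂ] Hl2).rank ≤ ((s.card : ℕ) : Cardinal) := by
  classical
  have hle : LinearMap.range (F : Hl2 →ₗ[ℂ] Hl2) ≤ Submodule.span ℂ (p '' s) := by
    rintro _ ⟨x, rfl⟩
    exact h x
  refine (Submodule.rank_mono hle).trans ?_
  rw [← Finset.coe_image]
  exact (rank_span_finset_le _).trans (by exact_mod_cast Finset.card_image_le)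

/-- The operator `∑ cᵢ |pᵢ⟩⟨qᵢ|`. -/
noncomputable def diagOp {κ : Type*} [Fintype κ] (p q : κ → Hl2) (c : κ → ℂ) : Bl2 :=
  ∑ i, c i • rankOne ℂ (p i) (q i)

section diagOp

variable {κ : Type*} [Fintype κ] {p q : κ → Hl2}

theorem diagOp_apply (p q : κ → Hl2) (c : κ → ℂ) (x : Hl2) :
    diagOp p q c x = ∑ i, (c i * ⟪q i, x⟫) • p i := by
  simp [diagOp, smul_smul]

theorem diagOp_apply_self (hq : Orthonormal ℂ q) (c : κ → ℂ) (i : κ) :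
    diagOp p q c (q i) = c i • p i := by
  classical
  rw [diagOp_apply, Finset.sum_eq_single i]
  · rw [inner_self_eq_norm_sq_to_K, hq.1 i]
    simp
  · intro j _ hj
    rw [hq.2 hj]
    simp
  · simp

theorem norm_sq_diagOp_apply (hp : Orthonormal ℂ p) (q : κ → Hl2) (c : κ → ℂ) (x : Hl2) :
    ‖diagOp p q c x‖ ^ 2 = ∑ i, ‖c i‖ ^ 2 * ‖⟪q i, x⟫‖ ^ 2 := by
  rw [diagOp_apply, ← inner_self_eq_norm_sq (𝕜 := ℂ), hp.inner_sum]
  rw [map_sum]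
  refine Finset.sum_congr rfl fun i _ => ?_
  rw [← mul_pow, ← norm_mul, RCLike.conj_mul]
  norm_cast

theorem norm_diagOp_le (hp : Orthonormal ℂ p) (hq : Orthonormal ℂ q) {c : κ → ℂ} {M : ℝ}
    (hM : 0 ≤ M) (h : ∀ i, ‖c i‖ ≤ M) : ‖diagOp p q c‖ ≤ M := by
  refine ContinuousLinearMap.opNorm_le_bound _ hM fun x => ?_
  refine abs_le_of_sq_le_sq' ?_ (by positivity) |>.2
  rw [norm_sq_diagOp_apply hp, mul_pow]
  refine le_trans ?_ (mul_le_mul_of_nonneg_left (hq.isBessel x) (sq_nonneg M))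
  rw [Finset.mul_sum]
  refine Finset.sum_le_sum fun i _ => ?_
  have := h i
  gcongr

/-- Let `z` be the sequence obtained from `c` by placing its entries injectively into `ℕ`. The
singular numbers of `∑ cᵢ |pᵢ⟩⟨qᵢ|` are the decreasing rearrangement of `z`. -/
theorem ofReal_singularNumber_diagOp (hp : Orthonormal ℂ p) (hq : Orthonormal ℂ q)
    (c : κ → ℂ) {φ : κ → ℕ} (hφ : Function.Injective φ) {z : ℕ → ℝ}
    (hz : ∀ i, |z (φ i)| = ‖c i‖) (hz0 : ∀ k, k ∉ Set.range φ → z k = 0) (n : ℕ) :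
    ENNReal.ofReal (singularNumber (diagOp p q c) n) = decRearr z n := by
  classical
  have hcard : ∀ r : ℝ, 0 ≤ r → {k : ℕ | ENNReal.ofReal r < ‖z k‖ₑ}.encard
      = ((Finset.univ.filter fun i => r < ‖c i‖).card : ℕ∞) := by
    intro r hr
    have : {k : ℕ | ENNReal.ofReal r < ‖z k‖ₑ}
        = φ '' (Finset.univ.filter fun i => r < ‖c i‖ : Finset κ) := by
      ext k
      simp only [Set.mem_ofPred_eq, Finset.coe_filter, Finset.mem_univ, true_and, Set.mem_image]
      rw [← ofReal_norm, Real.norm_eq_abs]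
      constructor
      · intro h
        have hk : k ∈ Set.range φ := by
          by_contra hk
          simp [hz0 k hk] at h
        obtain ⟨i, rfl⟩ := hk
        rw [hz] at h
        exact ⟨i, (ENNReal.ofReal_lt_ofReal_iff_of_nonneg hr).1 h, rfl⟩
      · rintro ⟨i, hi, rfl⟩
        rw [hz]
        exact (ENNReal.ofReal_lt_ofReal_iff_of_nonneg hr).2 hi
    rw [this, hφ.injOn.encard_image, Set.encard_coe_eq_coe_finsetCard]
  apply le_antisymm
  · refine le_sInf fun s hs => ?_
    induction s using ENNReal.recTopCoe with
    | top => exact le_top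
    | coe s =>
      simp only [Set.mem_ofPred_eq] at hs
      rw [← ENNReal.ofReal_coe_nnreal, hcard _ s.coe_nonneg] at hs
      rw [← ENNReal.ofReal_coe_nnreal]
      refine ENNReal.ofReal_le_ofReal ?_
      let A := Finset.univ.filter fun i => (s : ℝ) < ‖c i‖
      let F : Bl2 := diagOp p q fun i => if i ∈ A then c i else 0
      have hF : (F : Hl2 →ₗ[ℂ] Hl2).rank ≤ (n : Cardinal) := by
        refine (rank_le_of_forall_mem_span A p fun x => ?_).trans (by exact_mod_cast hs)
        simp only [F, diagOp_apply]
        refine Submodule.sum_mem _ fun i _ => ?_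
        by_cases hi : i ∈ A
        · exact Submodule.smul_mem _ _ (Submodule.subset_span ⟨i, hi, rfl⟩)
        · simp [hi]
      refine (singularNumber_le hF).trans ?_
      have : diagOp p q c - F = diagOp p q fun i => if i ∈ A then 0 else c i := by
        ext1 x
        simp only [F, sub_apply, diagOp_apply, ← Finset.sum_sub_distrib,
          ← sub_smul, ← sub_mul]
        refine Finset.sum_congr rfl fun i _ => ?_
        split_ifs <;> simp
      rw [this]
      refine norm_diagOp_le hp hq s.coe_nonneg fun i => ?_
      by_cases hi : i ∈ A
      · simp [hi]
      · simp only [hi, if_false]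
        simpa [A] using hi
  · have hle : decRearr z n ≤ ⊤ := le_top
    -- an operator of rank at most `n` vanishes on some combination of `n + 1` of the `q i`
    have key : ∀ F : Bl2, (F : Hl2 →ₗ[ℂ] Hl2).rank ≤ (n : Cardinal) →
        decRearr z n ≤ ENNReal.ofReal ‖diagOp p q c - F‖ := by
      intro F hF
      set r := ‖diagOp p q c - F‖ with hr
      refine sInf_le ?_
      simp only [Set.mem_ofPred_eq]
      rw [hcard r (norm_nonneg _)]
      by_contra hlt
      let A := Finset.univ.filter fun i => r < ‖c i‖
      have hlt' : n < A.card := by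
        rw [not_le] at hlt
        exact_mod_cast hlt
      have hfd := finiteDimensional_range hF
      let G : (A → ℂ) →ₗ[ℂ] Hl2 := Fintype.linearCombination ℂ (fun i : A => q i)
      let K : (A → ℂ) →ₗ[ℂ] LinearMap.range (F : Hl2 →ₗ[ℂ] Hl2) :=
        (F : Hl2 →ₗ[ℂ] Hl2).rangeRestrict.comp G
      have hker : LinearMap.ker K ≠ ⊥ := by
        apply LinearMap.ker_ne_bot_of_finrank_lt
        rw [Module.finrank_fintype_fun_eq_card, Fintype.card_coe]
        exact (finrank_range_le hF).trans_lt hlt'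
      obtain ⟨a, ha, ha0⟩ := Submodule.exists_mem_ne_zero_of_ne_bot hker
      have hFG : F (G a) = 0 := by
        have := congrArg Subtype.val (LinearMap.mem_ker.1 ha)
        exact this
      have hG : G a = ∑ i : A, a i • q i := by
        simp [G, Fintype.linearCombination_apply]
      have hqA : Orthonormal ℂ fun i : A => q i := hq.comp _ Subtype.val_injective
      have hin : ∀ j : A, ⟪q j, G a⟫ = a j := fun j => by
        rw [hG]
        exact hqA.inner_right_fintype a j
      have hnG : ‖G a‖ ^ 2 = ∑ i : A, ‖a i‖ ^ 2 := by
        rw [← inner_self_eq_norm_sq (𝕜 := ℂ), hG, hqA.inner_sum, map_sum]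
        refine Finset.sum_congr rfl fun i _ => ?_
        rw [RCLike.conj_mul]
        norm_cast
      have h1 : ‖diagOp p q c (G a)‖ ≤ r * ‖G a‖ := by
        have := (diagOp p q c - F).le_opNorm (G a)
        rwa [sub_apply, hFG, sub_zero] at this
      have h2 : ‖diagOp p q c (G a)‖ ^ 2 ≤ r ^ 2 * ‖G a‖ ^ 2 := by
        rw [← mul_pow]
        gcongr
      rw [norm_sq_diagOp_apply hp, hnG, Finset.mul_sum] at h2
      have h3 : ∑ i : A, ‖c i‖ ^ 2 * ‖a i‖ ^ 2 ≤ ∑ i, ‖c i‖ ^ 2 * ‖⟪q i, G a⟫‖ ^ 2 := by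
        have e : ∑ i : A, ‖c i‖ ^ 2 * ‖a i‖ ^ 2
            = ∑ i ∈ A, ‖c i‖ ^ 2 * ‖⟪q i, G a⟫‖ ^ 2 := by
          rw [← Finset.sum_coe_sort A]
          exact Finset.sum_congr rfl fun i _ => by rw [hin]
        rw [e]
        exact Finset.sum_le_univ_sum_of_nonneg fun i => by positivity
      have h4 : ∑ i : A, r ^ 2 * ‖a i‖ ^ 2 < ∑ i : A, ‖c i‖ ^ 2 * ‖a i‖ ^ 2 := by
        obtain ⟨j, hj⟩ := Function.ne_iff.1 ha0
        have hlt2 : ∀ i : A, r ^ 2 < ‖c i‖ ^ 2 := fun i => by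
          have : r < ‖c i‖ := (Finset.mem_filter.1 i.2).2
          have hr0 : 0 ≤ r := norm_nonneg _
          gcongr
        refine Finset.sum_lt_sum (fun i _ => ?_) ⟨j, Finset.mem_univ j, ?_⟩
        · exact mul_le_mul_of_nonneg_right (hlt2 i).le (by positivity)
        · have : 0 < ‖a j‖ := norm_pos_iff.2 hj
          exact mul_lt_mul_of_pos_right (hlt2 j) (by positivity)
      linarith
    have hfin : decRearr z n ≠ ⊤ := ne_top_of_le_ne_top ENNReal.ofReal_ne_top
      (key 0 (rank_zero_le n))
    refine ENNReal.le_ofReal_iff_toReal_le hfin (singularNumber_nonneg _ _) |>.2 ?_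
    refine le_singularNumber fun F hF => ?_
    exact (ENNReal.le_ofReal_iff_toReal_le hfin (norm_nonneg _)).1 (key F hF)

theorem idealNorm_diagOp (E : SymmetricSequenceSpace) (hp : Orthonormal ℂ p)
    (hq : Orthonormal ℂ q) (c : κ → ℂ) {φ : κ → ℕ} (hφ : Function.Injective φ) {z : ℕ → ℝ}
    (hz : ∀ i, |z (φ i)| = ‖c i‖) (hz0 : ∀ k, k ∉ Set.range φ → z k = 0) (hzE : z ∈ E.carrier) :
    E.idealNorm (diagOp p q c) = E.nrm z := by
  have h : ∀ n, decRearr (singularNumber (diagOp p q c)) n = decRearr z n := fun n => by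
    rw [decRearr_of_antitone (singularNumber_antitone _) (singularNumber_nonneg _),
      ofReal_singularNumber_diagOp hp hq c hφ hz hz0]
  have hmem : singularNumber (diagOp p q c) ∈ E.carrier :=
    E.mem_of_rearr_le z hzE _ fun n => (h n).le
  exact le_antisymm (E.nrm_le_of_decRearr_le hzE fun n => (h n).le)
    (E.nrm_le_of_decRearr_le hmem fun n => (h n).ge)

theorem diagOp_mem_ideal {E : SymmetricSequenceSpace} (hsep : E.IsSeparable) (p q : κ → Hl2)
    (c : κ → ℂ) : diagOp p q c ∈ E.ideal := by
  classical
  refine SymmetricSequenceSpace.mem_ideal_of_rank_le hsep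
    (rank_le_of_forall_mem_span Finset.univ p fun x => ?_)
  rw [diagOp_apply]
  exact Submodule.sum_mem _ fun i _ =>
    Submodule.smul_mem _ _ (Submodule.subset_span ⟨i, by simp, rfl⟩)

end diagOp

/-! ### Diagonal unitary groups -/

section basis

variable {ι : Type*} (v : HilbertBasis ι ℂ Hl2)

theorem HilbertBasis.ext_inner {ξ η : Hl2} (h : ∀ i, ⟪v i, ξ⟫ = ⟪v i, η⟫) : ξ = η := by
  apply v.repr.injective
  ext i
  rw [v.repr_apply_apply, v.repr_apply_apply, h i]

theorem HilbertBasis.inner_repr_symm (a : lp (fun _ : ι => ℂ) 2) (i : ι) :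
    ⟪v i, v.repr.symm a⟫ = a i := by
  rw [← v.repr_apply_apply, LinearIsometryEquiv.apply_symm_apply]

theorem HilbertBasis.exists_of_summable {a : ι → ℂ} (h : Summable fun i => ‖a i‖ ^ 2) :
    ∃ ξ : Hl2, ∀ i, ⟪v i, ξ⟫ = a i := by
  have hm : Memℓp (E := fun _ : ι => ℂ) a 2 := by
    apply memℓp_gen
    simpa using h
  exact ⟨v.repr.symm ⟨a, hm⟩, v.inner_repr_symm ⟨a, hm⟩⟩

theorem HilbertBasis.hasSum_norm_sq (ξ : Hl2) :
    HasSum (fun i => ‖⟪v i, ξ⟫‖ ^ 2) (‖ξ‖ ^ 2) := by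
  have h := RCLike.hasSum_re ℂ (v.hasSum_inner_mul_inner ξ ξ)
  rw [inner_self_eq_norm_sq] at h
  refine h.congr_fun ?_ |> id
  intro i
  rw [← inner_conj_symm ξ (v i), RCLike.conj_mul]
  norm_cast

theorem HilbertBasis.ext_operator {S T : Bl2} (h : ∀ i, S (v i) = T (v i)) : S = T := by
  refine ContinuousLinearMap.ext_on (s := Set.range v) ?_ ?_
  · rw [Submodule.dense_iff_topologicalClosure_eq_top]
    exact v.dense_span
  · rintro _ ⟨i, rfl⟩
    exact h i

theorem HilbertBasis.ext_entries {S T : Bl2} (h : ∀ i j, ⟪v i, S (v j)⟫ = ⟪v i, T (v j)⟫) :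
    S = T :=
  v.ext_operator fun j => v.ext_inner fun i => h i j

/-- Dominated convergence for the coefficients in a Hilbert basis. -/
theorem HilbertBasis.tendsto_norm_zero {α : Type*} {l : Filter α} {η : α → Hl2} {b : ι → ℝ}
    (hb : Summable fun i => b i ^ 2) (hle : ∀ᶠ t in l, ∀ i, ‖⟪v i, η t⟫‖ ≤ b i)
    (h0 : ∀ i, Tendsto (fun t => ⟪v i, η t⟫) l (𝓝 0)) : Tendsto (fun t => ‖η t‖) l (𝓝 0) := by
  have h1 : Tendsto (fun t => ∑' i, ‖⟪v i, η t⟫‖ ^ 2) l (𝓝 (∑' _ : ι, 0)) := by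
    refine tendsto_tsum_of_dominated_convergence hb (fun i => ?_) ?_
    · simpa using ((h0 i).norm.pow 2)
    · filter_upwards [hle] with t ht i
      rw [Real.norm_of_nonneg (sq_nonneg _)]
      have := ht i
      gcongr
  simp only [(v.hasSum_norm_sq _).tsum_eq, tsum_zero] at h1
  have h2 := h1.sqrt
  simpa [Real.sqrt_sq] using h2

theorem HilbertBasis.norm_eq_of_norm_inner_eq {ξ η : Hl2} (h : ∀ i, ‖⟪v i, ξ⟫‖ = ‖⟪v i, η⟫‖) :
    ‖ξ‖ = ‖η‖ := by
  have h1 := v.hasSum_norm_sq ξ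
  simp only [h] at h1
  have h2 := h1.unique (v.hasSum_norm_sq η)
  exact (sq_eq_sq₀ (norm_nonneg _) (norm_nonneg _)).1 h2

theorem norm_exp_mul_I_mul (s : ℝ) (z : ℂ) : ‖Complex.exp (s * Complex.I) * z‖ = ‖z‖ := by
  rw [norm_mul, Complex.norm_exp_ofReal_mul_I, one_mul]

theorem HilbertBasis.exists_phase (x : ι → ℝ) (ξ : Hl2) :
    ∃ η : Hl2, ∀ i, ⟪v i, η⟫ = Complex.exp (x i * Complex.I) * ⟪v i, ξ⟫ := by
  refine v.exists_of_summable ?_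
  simp only [norm_exp_mul_I_mul]
  exact (v.hasSum_norm_sq ξ).summable

/-- The unitary operator multiplying the `i`-th coefficient by `exp (i xᵢ)`. -/
noncomputable def phaseOp (x : ι → ℝ) : Bl2 :=
  LinearMap.mkContinuous
    { toFun := fun ξ => (v.exists_phase x ξ).choose
      map_add' := fun ξ η => by
        apply v.ext_inner
        intro i
        rw [inner_add_right, (v.exists_phase x _).choose_spec, (v.exists_phase x _).choose_spec,
          (v.exists_phase x _).choose_spec, inner_add_right, mul_add]
      map_smul' := fun c ξ => by
        apply v.ext_inner
        intro i
        rw [RingHom.id_apply, inner_smul_right, (v.exists_phase x _).choose_spec,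
          (v.exists_phase x _).choose_spec, inner_smul_right, mul_left_comm] }
    1 (fun ξ => by
      rw [one_mul]
      refine (v.norm_eq_of_norm_inner_eq fun i => ?_).le
      change ‖⟪v i, (v.exists_phase x ξ).choose⟫‖ = _
      rw [(v.exists_phase x ξ).choose_spec, norm_exp_mul_I_mul])

theorem inner_phaseOp (x : ι → ℝ) (ξ : Hl2) (i : ι) :
    ⟪v i, phaseOp v x ξ⟫ = Complex.exp (x i * Complex.I) * ⟪v i, ξ⟫ :=
  (v.exists_phase x ξ).choose_spec i

theorem norm_phaseOp_apply (x : ι → ℝ) (ξ : Hl2) : ‖phaseOp v x ξ‖ = ‖ξ‖ :=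
  v.norm_eq_of_norm_inner_eq fun i => by rw [inner_phaseOp, norm_exp_mul_I_mul]

theorem norm_phaseOp_le (x : ι → ℝ) : ‖phaseOp v x‖ ≤ 1 :=
  ContinuousLinearMap.opNorm_le_bound _ zero_le_one fun ξ => by rw [norm_phaseOp_apply, one_mul]

theorem phaseOp_zero : phaseOp v 0 = 1 := by
  ext1 ξ
  refine v.ext_inner fun i => ?_
  rw [inner_phaseOp]
  simp

theorem phaseOp_add (x y : ι → ℝ) : phaseOp v (x + y) = phaseOp v x * phaseOp v y := by
  ext1 ξ
  refine v.ext_inner fun i => ?_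
  rw [mul_apply_eq_comp, inner_phaseOp, inner_phaseOp, inner_phaseOp, ← mul_assoc,
    ← Complex.exp_add]
  congr 2
  simp only [Pi.add_apply]
  push_cast
  ring

theorem star_phaseOp (x : ι → ℝ) : star (phaseOp v x) = phaseOp v (-x) := by
  have h1 : star (phaseOp v x) * phaseOp v x = 1 :=
    (ContinuousLinearMap.norm_map_iff_adjoint_comp_self _).1 (norm_phaseOp_apply v x)
  have h2 : phaseOp v x * phaseOp v (-x) = 1 := by
    rw [← phaseOp_add, add_neg_cancel, phaseOp_zero]
  calc star (phaseOp v x) = star (phaseOp v x) * (phaseOp v x * phaseOp v (-x)) := by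
        rw [h2, mul_one]
    _ = phaseOp v (-x) := by rw [← mul_assoc, h1, one_mul]

theorem phaseOp_mem_unitary (x : ι → ℝ) : phaseOp v x ∈ unitary Bl2 := by
  rw [Unitary.mem_iff, star_phaseOp, ← phaseOp_add, ← phaseOp_add, neg_add_cancel,
    add_neg_cancel, phaseOp_zero]
  exact ⟨rfl, rfl⟩

theorem inner_basis_basis [DecidableEq ι] (i j : ι) : ⟪v i, v j⟫ = if i = j then 1 else 0 :=
  orthonormal_iff_ite.1 v.orthonormal i j

theorem phaseOp_apply_basis (x : ι → ℝ) (j : ι) :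
    phaseOp v x (v j) = Complex.exp (x j * Complex.I) • v j := by
  classical
  refine v.ext_inner fun i => ?_
  rw [inner_phaseOp, inner_smul_right, inner_basis_basis]
  split_ifs with h
  · rw [h]
  · simp

theorem continuous_phaseOp_smul (x : ι → ℝ) (ξ : Hl2) :
    Continuous fun t : ℝ => phaseOp v (t • x) ξ := by
  rw [continuous_iff_continuousAt]
  intro t₀
  rw [ContinuousAt, tendsto_iff_norm_sub_tendsto_zero]
  refine v.tendsto_norm_zero (b := fun i => 2 * ‖⟪v i, ξ⟫‖) ?_ (Eventually.of_forall fun t i => ?_)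
    fun i => ?_
  · simp only [mul_pow]
    exact (v.hasSum_norm_sq ξ).summable.mul_left _
  · rw [inner_sub_right, inner_phaseOp, inner_phaseOp]
    refine (norm_sub_le _ _).trans ?_
    rw [norm_exp_mul_I_mul, norm_exp_mul_I_mul, two_mul]
  · simp only [inner_sub_right, inner_phaseOp, Pi.smul_apply, smul_eq_mul]
    have h : Continuous fun t : ℝ => Complex.exp ((t * x i : ℝ) * Complex.I) * ⟪v i, ξ⟫ -
        Complex.exp ((t₀ * x i : ℝ) * Complex.I) * ⟪v i, ξ⟫ := by fun_prop
    have := h.tendsto t₀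
    simpa using this

theorem hasDerivAt_exp_mul_I (ω t : ℝ) :
    HasDerivAt (fun s : ℝ => Complex.exp ((s * ω : ℝ) * Complex.I))
      (Complex.exp ((t * ω : ℝ) * Complex.I) * (Complex.I * ω)) t := by
  have h1 : HasDerivAt (fun s : ℝ => ((s * ω : ℝ) : ℂ) * Complex.I) (Complex.I * ω) t := by
    have h2 : HasDerivAt (fun s : ℝ => ((s * ω : ℝ) : ℂ)) ((1 * ω : ℝ) : ℂ) t :=
      ((hasDerivAt_id t).mul_const ω).ofReal_comp
    convert! h2.mul_const Complex.I using 1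
    push_cast
    ring
  exact h1.cexp

theorem tendsto_exp_slope (ω : ℝ) :
    Tendsto (fun t : ℝ => (t : ℂ)⁻¹ * (Complex.exp ((t * ω : ℝ) * Complex.I) - 1)) (𝓝[≠] 0)
      (𝓝 (Complex.I * ω)) := by
  have h := (hasDerivAt_exp_mul_I ω 0).tendsto_slope_zero
  simp only [zero_add, zero_mul, Complex.ofReal_zero, Complex.exp_zero, one_mul] at h
  refine h.congr fun t => ?_
  rw [Complex.real_smul, Complex.ofReal_inv]

theorem norm_exp_slope_le (ω t : ℝ) :
    ‖(t : ℂ)⁻¹ * (Complex.exp ((t * ω : ℝ) * Complex.I) - 1)‖ ≤ |ω| := by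
  have h : ‖Complex.exp ((t * ω : ℝ) * Complex.I) - 1‖ ≤ |t * ω| := by
    have := Real.norm_exp_I_mul_ofReal_sub_one_le (x := t * ω)
    rwa [mul_comm Complex.I] at this
  rw [norm_mul, norm_inv, Complex.norm_real, Real.norm_eq_abs]
  rcases eq_or_ne t 0 with rfl | ht
  · simp
  · rw [inv_mul_le_iff₀ (abs_pos.2 ht), ← abs_mul]
    exact h

/-- The graph of the diagonal operator with eigenvalues `xᵢ`. -/
noncomputable def diagGraph (x : ι → ℝ) : Submodule ℂ (Hl2 × Hl2) where
  carrier := {p | ∀ i, ⟪v i, p.2⟫ = x i * ⟪v i, p.1⟫}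
  add_mem' := fun {p q} hp hq i => by
    rw [Prod.snd_add, Prod.fst_add, inner_add_right, inner_add_right, hp i, hq i, mul_add]
  zero_mem' := fun i => by simp
  smul_mem' := fun c p hp i => by
    rw [Prod.smul_snd, Prod.smul_fst, inner_smul_right, inner_smul_right, hp i, mul_left_comm]

theorem mem_diagGraph {x : ι → ℝ} {ξ η : Hl2} :
    (ξ, η) ∈ diagGraph v x ↔ ∀ i, ⟪v i, η⟫ = x i * ⟪v i, ξ⟫ := Iff.rfl

/-- The (unbounded) diagonal operator with eigenvalues `xᵢ`. -/
noncomputable def diagPMap (x : ι → ℝ) : Hl2 →ₗ.[ℂ] Hl2 := (diagGraph v x).toLinearPMap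

theorem diagPMap_graph (x : ι → ℝ) : (diagPMap v x).graph = diagGraph v x := by
  refine Submodule.toLinearPMap_graph_eq _ ?_
  rintro ⟨ξ, η⟩ h (rfl : ξ = 0)
  refine v.ext_inner fun i => ?_
  rw [h i]
  simp

theorem basis_mem_diagGraph (x : ι → ℝ) (j : ι) : (v j, (x j : ℂ) • v j) ∈ diagGraph v x := by
  classical
  intro i
  rw [inner_smul_right, inner_basis_basis]
  split_ifs with h
  · rw [h]
  · simp

theorem isSelfAdjoint_diagPMap (x : ι → ℝ) : IsSelfAdjoint (diagPMap v x) := by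
  have hdense : Dense ((diagPMap v x).domain : Set Hl2) := by
    refine Dense.mono (s₁ := (Submodule.span ℂ (Set.range v) : Set Hl2)) ?_ ?_
    · refine Submodule.span_le.2 ?_
      rintro _ ⟨j, rfl⟩
      refine LinearPMap.mem_domain_of_mem_graph (y := (x j : ℂ) • v j) ?_
      rw [diagPMap_graph]
      exact basis_mem_diagGraph v x j
    · rw [Submodule.dense_iff_topologicalClosure_eq_top]
      exact v.dense_span
  rw [LinearPMap.isSelfAdjoint_def]
  refine LinearPMap.eq_of_eq_graph ?_
  rw [LinearPMap.adjoint_graph_eq_graph_adjoint hdense, diagPMap_graph]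
  ext ⟨ξ, η⟩
  rw [Submodule.mem_adjoint_iff, mem_diagGraph]
  constructor
  · intro h i
    have := h _ _ (basis_mem_diagGraph v x i)
    rw [inner_smul_left, Complex.conj_ofReal] at this
    exact (sub_eq_zero.1 this).symm
  · intro h a b hab
    rw [sub_eq_zero, ← v.tsum_inner_mul_inner, ← v.tsum_inner_mul_inner]
    refine tsum_congr fun i => ?_
    have h1 : ⟪b, v i⟫ = x i * ⟪a, v i⟫ := by
      rw [← inner_conj_symm, hab i, map_mul, Complex.conj_ofReal, inner_conj_symm]
    rw [h1, h i]
    ring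

theorem isUnitaryGroupOf_diagPMap (x : ι → ℝ) :
    IsUnitaryGroupOf (diagPMap v x) fun t => phaseOp v (t • x) where
  unitary t := phaseOp_mem_unitary v _
  zero := by rw [zero_smul, phaseOp_zero]
  add s t := by rw [add_smul, phaseOp_add]
  continuous := continuous_phaseOp_smul v x
  generator ξ η := by
    rw [diagPMap_graph, mem_diagGraph]
    have hcoef : ∀ (t : ℝ) i, ⟪v i, (t : ℂ)⁻¹ • (phaseOp v (t • x) ξ - ξ)⟫ =
        (t : ℂ)⁻¹ * (Complex.exp ((t * x i : ℝ) * Complex.I) - 1) * ⟪v i, ξ⟫ := fun t i => by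
      rw [inner_smul_right, inner_sub_right, inner_phaseOp]
      simp only [Pi.smul_apply, smul_eq_mul]
      ring
    have hlim : ∀ i, Tendsto (fun t : ℝ => ⟪v i, (t : ℂ)⁻¹ • (phaseOp v (t • x) ξ - ξ)⟫) (𝓝[≠] 0)
        (𝓝 (Complex.I * x i * ⟪v i, ξ⟫)) := fun i => by
      simp only [hcoef]
      exact (tendsto_exp_slope (x i)).mul_const _
    constructor
    · intro h
      rw [tendsto_iff_norm_sub_tendsto_zero]
      refine v.tendsto_norm_zero (b := fun i => 2 * ‖⟪v i, η⟫‖) ?_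
        (Eventually.of_forall fun t i => ?_) fun i => ?_
      · simp only [mul_pow]
        exact (v.hasSum_norm_sq η).summable.mul_left _
      · rw [inner_sub_right, hcoef, inner_smul_right]
        refine (norm_sub_le _ _).trans ?_
        rw [norm_mul _ ⟪v i, ξ⟫, norm_mul Complex.I, Complex.norm_I, one_mul, two_mul]
        refine add_le_add ?_ le_rfl
        rw [h i, norm_mul (x i : ℂ), Complex.norm_real, Real.norm_eq_abs]
        exact mul_le_mul_of_nonneg_right (norm_exp_slope_le _ _) (norm_nonneg _)
      · simp only [inner_sub_right]
        have h1 := (hlim i).sub_const (Complex.I * x i * ⟪v i, ξ⟫)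
        rw [sub_self] at h1
        refine h1.congr fun t => ?_
        rw [inner_smul_right (v i) η, h i, mul_assoc]
    · intro h i
      have h1 : Tendsto (fun t : ℝ => ⟪v i, (t : ℂ)⁻¹ • (phaseOp v (t • x) ξ - ξ)⟫) (𝓝[≠] 0)
          (𝓝 ⟪v i, Complex.I • η⟫) := tendsto_const_nhds.inner h
      have h2 := tendsto_nhds_unique h1 (hlim i)
      rw [inner_smul_right, mul_assoc] at h2
      exact mul_left_cancel₀ Complex.I_ne_zero h2

end basis

/-! ### The derivation generated by a diagonal unitary group -/

section derivation

variable {ι : Type*} (v : HilbertBasis ι ℂ Hl2) (x : ι → ℝ)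

/-- Entrywise form of `D = i [X, T]` for the diagonal operator `X` with eigenvalues `xᵢ`. -/
def IsFormalCommutator (T D : Bl2) : Prop :=
  ∀ i j, ⟪v i, D (v j)⟫ = Complex.I * ((x i - x j : ℝ) : ℂ) * ⟪v i, T (v j)⟫

variable {v x}

theorem IsFormalCommutator.add {S T C D : Bl2} (h : IsFormalCommutator v x S C)
    (h' : IsFormalCommutator v x T D) : IsFormalCommutator v x (S + T) (C + D) := fun i j => by
  rw [add_apply, add_apply, inner_add_right,
    inner_add_right, h i j, h' i j, mul_add]

theorem IsFormalCommutator.smul {T D : Bl2} (c : ℂ) (h : IsFormalCommutator v x T D) :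
    IsFormalCommutator v x (c • T) (c • D) := fun i j => by
  rw [smul_apply, smul_apply, inner_smul_right,
    inner_smul_right, h i j, mul_left_comm]

theorem IsFormalCommutator.sub {S T C D : Bl2} (h : IsFormalCommutator v x S C)
    (h' : IsFormalCommutator v x T D) : IsFormalCommutator v x (S - T) (C - D) := fun i j => by
  rw [sub_apply, sub_apply, inner_sub_right,
    inner_sub_right, h i j, h' i j, mul_sub]

theorem IsFormalCommutator.star {T D : Bl2} (h : IsFormalCommutator v x T D) :
    IsFormalCommutator v x (star T) (star D) := fun i j => by
  rw [ContinuousLinearMap.star_eq_adjoint, ContinuousLinearMap.star_eq_adjoint,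
    ContinuousLinearMap.adjoint_inner_right, ContinuousLinearMap.adjoint_inner_right,
    ← inner_conj_symm, h j i, ← inner_conj_symm (T (v i)), map_mul, map_mul, Complex.conj_I,
    Complex.conj_ofReal]
  push_cast
  ring

/-- Entrywise Leibniz rule, from `xᵢ - xⱼ = (xᵢ - xₗ) + (xₗ - xⱼ)`. -/
theorem IsFormalCommutator.mul {S T C D : Bl2} (h : IsFormalCommutator v x S C)
    (h' : IsFormalCommutator v x T D) : IsFormalCommutator v x (S * T) (C * T + S * D) :=
  fun i j => by
  have hs : ∀ A B : Bl2, HasSum (fun l => ⟪v i, A (v l)⟫ * ⟪v l, B (v j)⟫)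
      ⟪v i, (A * B) (v j)⟫ := by
    intro A B
    have := v.hasSum_inner_mul_inner ((Star.star A) (v i)) (B (v j))
    simp only [ContinuousLinearMap.star_eq_adjoint, ContinuousLinearMap.adjoint_inner_left] at this
    exact this
  rw [add_apply, inner_add_right]
  refine ((hs C T).add (hs S D)).unique ?_
  convert! (hs S T).mul_left (Complex.I * ((x i - x j : ℝ) : ℂ)) using 1
  funext l
  rw [h i l, h' l j]
  push_cast
  ring

theorem IsFormalCommutator.of_tendsto {α : Type*} {l : Filter α} [l.NeBot] {S C : α → Bl2}
    {T D : Bl2} (h : ∀ a, IsFormalCommutator v x (S a) (C a)) (hS : Tendsto S l (𝓝 T))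
    (hC : Tendsto C l (𝓝 D)) : IsFormalCommutator v x T D := fun i j => by
  have hlim : ∀ {A : α → Bl2} {B : Bl2}, Tendsto A l (𝓝 B) →
      Tendsto (fun a => ⟪v i, A a (v j)⟫) l (𝓝 ⟪v i, B (v j)⟫) := fun hA =>
    tendsto_const_nhds.inner
      (((ContinuousLinearMap.apply ℂ Hl2 (v j)).continuous.tendsto _).comp hA)
  refine tendsto_nhds_unique (hlim hC) ?_
  simp only [h _ i j]
  exact (hlim hS).const_mul _

variable (v x)

/-- The orthogonal projection onto the span of finitely many basis vectors. -/
noncomputable def basisProj (F : Finset ι) : Bl2 := ∑ i ∈ F, rankOne ℂ (v i) (v i)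

theorem basisProj_apply (F : Finset ι) (ξ : Hl2) :
    basisProj v F ξ = ∑ i ∈ F, ⟪v i, ξ⟫ • v i := by
  simp [basisProj]

theorem basisProj_apply_basis [DecidableEq ι] (F : Finset ι) (j : ι) :
    basisProj v F (v j) = if j ∈ F then v j else 0 := by
  rw [basisProj_apply]
  simp [inner_basis_basis, ite_smul]

theorem inner_basisProj [DecidableEq ι] (F : Finset ι) (ξ : Hl2) (i : ι) :
    ⟪v i, basisProj v F ξ⟫ = if i ∈ F then ⟪v i, ξ⟫ else 0 := by
  rw [basisProj_apply, inner_sum]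
  simp [inner_smul_right, inner_basis_basis]

theorem isSelfAdjoint_basisProj (F : Finset ι) : IsSelfAdjoint (basisProj v F) := by
  rw [IsSelfAdjoint, basisProj, star_sum]
  refine Finset.sum_congr rfl fun i _ => ?_
  rw [ContinuousLinearMap.star_eq_adjoint, InnerProductSpace.adjoint_rankOne]

theorem norm_basisProj_le (F : Finset ι) : ‖basisProj v F‖ ≤ 1 := by
  classical
  refine ContinuousLinearMap.opNorm_le_bound _ zero_le_one fun ξ => ?_
  rw [one_mul]
  refine (sq_le_sq₀ (norm_nonneg _) (norm_nonneg _)).1 ?_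
  refine hasSum_le (fun i => ?_) (v.hasSum_norm_sq _) (v.hasSum_norm_sq ξ)
  rw [inner_basisProj]
  split_ifs
  · exact le_rfl
  · simp

theorem tendsto_basisProj (ξ : Hl2) :
    Tendsto (fun F => basisProj v F ξ) atTop (𝓝 ξ) := by
  have h := v.hasSum_repr ξ
  simp only [v.repr_apply_apply] at h
  simp only [basisProj_apply]
  exact h

/-- The compression of an operator to finitely many basis vectors. -/
noncomputable def compress (F : Finset ι) (T : Bl2) : Bl2 := basisProj v F * T * basisProj v F

theorem inner_compress [DecidableEq ι] (F : Finset ι) (T : Bl2) (i j : ι) :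
    ⟪v i, compress v F T (v j)⟫ = if i ∈ F ∧ j ∈ F then ⟪v i, T (v j)⟫ else 0 := by
  rw [compress, mul_apply_eq_comp, mul_apply_eq_comp, inner_basisProj, basisProj_apply_basis]
  by_cases hi : i ∈ F <;> by_cases hj : j ∈ F <;> simp [hi, hj]

theorem IsFormalCommutator.compress {T D : Bl2} (F : Finset ι) (h : IsFormalCommutator v x T D) :
    IsFormalCommutator v x (compress v F T) (compress v F D) := fun i j => by
  classical
  rw [inner_compress, inner_compress]
  split_ifs
  · exact h i j
  · simp

theorem rank_le_card_of_forall_mem_span {T : Bl2} (F : Finset ι)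
    (h : ∀ i ∉ F, ∀ ξ, ⟪v i, T ξ⟫ = 0) : (T : Hl2 →ₗ[ℂ] Hl2).rank ≤ ((F.card : ℕ) : Cardinal) := by
  classical
  refine rank_le_of_forall_mem_span F v fun ξ => ?_
  have : T ξ = basisProj v F (T ξ) := v.ext_inner fun i => by
    rw [inner_basisProj]
    split_ifs with hi
    · rfl
    · exact h i hi ξ
  rw [this, basisProj_apply]
  exact Submodule.sum_mem _ fun i hi =>
    Submodule.smul_mem _ _ (Submodule.subset_span ⟨i, hi, rfl⟩)

theorem rank_mul_basisProj_le {T : Bl2} (F : Finset ι) :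
    ((basisProj v F * T : Bl2) : Hl2 →ₗ[ℂ] Hl2).rank ≤ ((F.card : ℕ) : Cardinal) := by
  classical
  refine rank_le_card_of_forall_mem_span v F fun i hi ξ => ?_
  rw [mul_apply_eq_comp, inner_basisProj, if_neg hi]

/-! ### The flow on compressions and its derivative -/

/-- The diagonal unitary group `exp (i t X)`. -/
noncomputable abbrev phaseGroup (t : ℝ) : Bl2 := phaseOp v (t • x)

theorem inner_conjFlow (t : ℝ) (T : Bl2) (i j : ι) :
    ⟪v i, conjFlow (phaseGroup v x) t T (v j)⟫ =
      Complex.exp ((t * (x i - x j) : ℝ) * Complex.I) * ⟪v i, T (v j)⟫ := by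
  rw [conjFlow, mul_apply_eq_comp, mul_apply_eq_comp, inner_phaseOp, phaseOp_apply_basis, map_smul,
    inner_smul_right, ← mul_assoc, ← Complex.exp_add]
  congr 2
  simp only [Pi.smul_apply, smul_eq_mul]
  push_cast
  ring

theorem conjFlow_zero (T : Bl2) : conjFlow (phaseGroup v x) 0 T = T := by
  simp only [conjFlow, neg_zero, phaseGroup, zero_smul, phaseOp_zero, one_mul, mul_one]

theorem conjFlow_sub (t : ℝ) (S T : Bl2) : conjFlow (phaseGroup v x) t (S - T) =
    conjFlow (phaseGroup v x) t S - conjFlow (phaseGroup v x) t T := by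
  simp only [conjFlow, mul_sub, sub_mul]

theorem conjFlow_compress (F : Finset ι) (T : Bl2) (t : ℝ) :
    conjFlow (phaseGroup v x) t (compress v F T) = ∑ i ∈ F, ∑ j ∈ F,
      Complex.exp ((t * (x i - x j) : ℝ) * Complex.I) • ⟪v i, T (v j)⟫ • rankOne ℂ (v i) (v j) := by
  classical
  refine v.ext_entries fun k l => ?_
  rw [inner_conjFlow, inner_compress]
  simp only [sum_apply, smul_apply, inner_sum, inner_smul_right, InnerProductSpace.rankOne_apply,
    inner_basis_basis]
  by_cases hk : k ∈ F <;> by_cases hl : l ∈ F <;> simp [hk, hl]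

theorem hasDerivAt_conjFlow_compress {T D : Bl2} (h : IsFormalCommutator v x T D) (F : Finset ι)
    (t : ℝ) : HasDerivAt (fun s => conjFlow (phaseGroup v x) s (compress v F T))
      (conjFlow (phaseGroup v x) t (compress v F D)) t := by
  simp only [conjFlow_compress]
  refine HasDerivAt.fun_sum fun i _ => HasDerivAt.fun_sum fun j _ => ?_
  convert! (hasDerivAt_exp_mul_I (x i - x j) t).smul_const
    (⟪v i, T (v j)⟫ • (rankOne ℂ (v i) (v j) : Bl2)) using 1
  rw [h i j, smul_smul, smul_smul]
  congr 1
  ring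

variable {v x}

/-- The difference quotients of the flow have Ky Fan norms dominated by those of the commutator, by
the mean value inequality applied to Bessel functionals. -/
theorem sum_singularNumber_slope_le {T D : Bl2} (h : IsFormalCommutator v x T D) (F : Finset ι)
    (t : ℝ) (n : ℕ) :
    ∑ k ∈ Finset.range n, singularNumber ((t : ℂ)⁻¹ •
      (conjFlow (phaseGroup v x) t (compress v F T) - compress v F T)) k ≤
      18 * ∑ k ∈ Finset.range n, singularNumber (compress v F D) k := by
  set M := ∑ k ∈ Finset.range n, singularNumber (compress v F D) k with hM
  have hM0 : 0 ≤ M := Finset.sum_nonneg fun k _ => singularNumber_nonneg _ k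
  have h18 : 18 * M = 2 * (9 * M) := by ring
  rw [h18]
  refine sum_singularNumber_le_of_pairing_le fun e f he hf he1 hf1 => ?_
  have hmass : ∑ i, ‖f i‖ * ‖e i‖ ≤ n := by
    refine (Finset.sum_le_sum fun i _ => mul_le_one₀ (hf1 i) (norm_nonneg _) (he1 i)).trans ?_
    simp
  let L : Bl2 →ₗ[ℝ] ℂ :=
    { toFun := pairing e f
      map_add' := pairing_add e f
      map_smul' := fun c T => by
        have := pairing_smul e f (c : ℂ) T
        rw [RingHom.id_apply, Complex.real_smul, ← this]
        rfl }
  let L' : Bl2 →L[ℝ] ℂ := L.mkContinuous _ (norm_pairing_le e f)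
  have hder : ∀ s, HasDerivAt
      (fun s => pairing e f (conjFlow (phaseGroup v x) s (compress v F T)))
      (pairing e f (conjFlow (phaseGroup v x) s (compress v F D))) s := fun s =>
    L'.hasFDerivAt.comp_hasDerivAt s (hasDerivAt_conjFlow_compress v x h F s)
  have hbound : ∀ s, ‖pairing e f (conjFlow (phaseGroup v x) s (compress v F D))‖ ≤ 9 * M := by
    intro s
    refine (norm_pairing_le_sum_singularNumber he hf hmass _).trans ?_
    refine mul_le_mul_of_nonneg_left (Finset.sum_le_sum fun k _ => ?_) (by norm_num)
    refine (singularNumber_mul_le_right _ _ _).trans ?_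
    have h1 := singularNumber_mul_le_left (phaseGroup v x s) (compress v F D) k
    have h2 := norm_phaseOp_le v (s • x)
    have h3 := norm_phaseOp_le v (-s • x)
    have h4 := singularNumber_nonneg (compress v F D) k
    have h5 := singularNumber_nonneg (phaseGroup v x s * compress v F D) k
    calc _ ≤ singularNumber (phaseGroup v x s * compress v F D) k * 1 := by gcongr
      _ ≤ 1 * singularNumber (compress v F D) k := by
        rw [mul_one]
        exact h1.trans (by gcongr)
      _ = _ := one_mul _
  have hmv := Convex.norm_image_sub_le_of_norm_hasDerivWithin_le (𝕜 := ℝ) (s := Set.univ)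
    (fun s _ => (hder s).hasDerivWithinAt) (fun s _ => hbound s) convex_univ
    (Set.mem_univ 0) (Set.mem_univ t)
  simp only [conjFlow_zero, sub_zero] at hmv
  rw [pairing_smul, pairing_sub, norm_mul, norm_inv, Complex.norm_real]
  rcases eq_or_ne t 0 with rfl | ht
  · simp only [norm_zero, inv_zero, zero_mul]
    positivity
  · rw [inv_mul_le_iff₀ (norm_pos_iff.2 ht), mul_comm]
    exact hmv

end derivation

section generator

open SymmetricSequenceSpace

variable {E : SymmetricSequenceSpace} {ι : Type*} {v : HilbertBasis ι ℂ Hl2} {x : ι → ℝ}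

theorem compress_mem_ideal (hsep : E.IsSeparable) (F : Finset ι) (T : Bl2) :
    compress v F T ∈ E.ideal := by
  rw [compress, mul_assoc]
  exact mem_ideal_of_rank_le hsep (rank_mul_basisProj_le v F)

theorem idealNorm_compress_le (hsep : E.IsSeparable) (F : Finset ι) {T : Bl2}
    (hT : T ∈ E.ideal) : E.idealNorm (compress v F T) ≤ E.idealNorm T :=
  idealNorm_mul_mul_le hsep (norm_basisProj_le v F) (norm_basisProj_le v F) hT

theorem conjFlow_mem_ideal (hsep : E.IsSeparable) (t : ℝ) {T : Bl2} (hT : T ∈ E.ideal) :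
    conjFlow (phaseGroup v x) t T ∈ E.ideal :=
  mul_mem_ideal_right hsep _ (mul_mem_ideal_left hsep _ hT)

theorem idealNorm_conjFlow_le (hsep : E.IsSeparable) (t : ℝ) {T : Bl2} (hT : T ∈ E.ideal) :
    E.idealNorm (conjFlow (phaseGroup v x) t T) ≤ E.idealNorm T :=
  idealNorm_mul_mul_le hsep (norm_phaseOp_le v _) (norm_phaseOp_le v _) hT

/-- For a finite rank operator the compressions converge in operator norm. -/
theorem tendsto_norm_basisProj_mul_sub {R : Bl2} {r : ℕ}
    (hR : (R : Hl2 →ₗ[ℂ] Hl2).rank ≤ (r : Cardinal)) :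
    Tendsto (fun F => ‖basisProj v F * R - R‖) atTop (𝓝 0) := by
  have := finiteDimensional_range hR
  let b := stdOrthonormalBasis ℂ (LinearMap.range (R : Hl2 →ₗ[ℂ] Hl2))
  have hb : ∀ ξ, R ξ = ∑ m, ⟪((b m : _) : Hl2), R ξ⟫ • ((b m : _) : Hl2) := fun ξ => by
    have h1 := b.sum_repr' ⟨R ξ, LinearMap.mem_range_self (R : Hl2 →ₗ[ℂ] Hl2) ξ⟩
    have h2 := congrArg Subtype.val h1
    simp only [Submodule.coe_sum, Submodule.coe_smul, Submodule.coe_inner] at h2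
    exact h2.symm
  have hlim : Tendsto (fun F => ∑ m, ‖basisProj v F ((b m : _) : Hl2) - ((b m : _) : Hl2)‖ * ‖R‖)
      atTop (𝓝 0) := by
    have h : ∀ m ∈ Finset.univ, Tendsto
        (fun F => ‖basisProj v F ((b m : _) : Hl2) - ((b m : _) : Hl2)‖ * ‖R‖) atTop (𝓝 0) := by
      intro m _
      have := (tendsto_iff_norm_sub_tendsto_zero.1
        (tendsto_basisProj v ((b m : _) : Hl2))).mul_const ‖R‖
      rwa [zero_mul] at this
    simpa using tendsto_finsetSum Finset.univ h
  refine squeeze_zero (fun _ => norm_nonneg _) (fun F => ?_) hlim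
  refine ContinuousLinearMap.opNorm_le_bound _
    (Finset.sum_nonneg fun m _ => by positivity) fun ξ => ?_
  have h1 : (basisProj v F * R - R) ξ
      = ∑ m, ⟪((b m : _) : Hl2), R ξ⟫ • (basisProj v F ((b m : _) : Hl2) - ((b m : _) : Hl2)) := by
    simp only [smul_sub, Finset.sum_sub_distrib]
    rw [← hb ξ, sub_apply, mul_apply_eq_comp]
    congr 1
    conv_lhs => rw [hb ξ]
    rw [map_sum]
    exact Finset.sum_congr rfl fun m _ => map_smul _ _ _
  rw [h1, Finset.sum_mul]
  refine (norm_sum_le _ _).trans (Finset.sum_le_sum fun m _ => ?_)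
  rw [norm_smul, mul_comm, mul_assoc]
  refine mul_le_mul_of_nonneg_left ?_ (norm_nonneg _)
  refine (norm_inner_le_norm _ _).trans ?_
  have hm : ‖((b m : _) : Hl2)‖ = 1 := b.orthonormal.1 m
  rw [hm, one_mul]
  exact R.le_opNorm ξ

/-- The compressions to finitely many basis vectors converge in the norm of the ideal. -/
theorem tendsto_idealNorm_sub_compress (hsep : E.IsSeparable) {T : Bl2} (hT : T ∈ E.ideal) :
    Tendsto (fun F => E.idealNorm (T - compress v F T)) atTop (𝓝 0) := by
  have hnn : ∀ F, 0 ≤ E.idealNorm (T - compress v F T) := fun F =>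
    idealNorm_nonneg (sub_mem_ideal hsep hT (compress_mem_ideal hsep F T))
  rw [Metric.tendsto_nhds]
  intro ε hε
  obtain ⟨R, r, hR, hTR⟩ := exists_rank_le_idealNorm_sub_lt hsep hT (ε := ε / 16) (by linarith)
  have hRi : R ∈ E.ideal := mem_ideal_of_rank_le hsep hR
  have hnorm : Tendsto (fun F => ‖R - compress v F R‖) atTop (𝓝 0) := by
    have h1 := tendsto_norm_basisProj_mul_sub (v := v) hR
    have h2 := tendsto_norm_basisProj_mul_sub (v := v) (rank_star_le hR)
    have h3 := h1.add h2
    rw [add_zero] at h3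
    refine squeeze_zero (fun _ => norm_nonneg _) (fun F => ?_) h3
    have e1 : ‖R * basisProj v F - R‖ = ‖basisProj v F * star R - star R‖ := by
      rw [← norm_star, star_sub, star_mul, (isSelfAdjoint_basisProj v F).star_eq]
    rw [← e1]
    have e2 : R - compress v F R
        = -(basisProj v F * (R * basisProj v F - R)) - (basisProj v F * R - R) := by
      simp only [compress, mul_sub, mul_assoc]
      abel
    rw [e2]
    refine (norm_sub_le _ _).trans ?_
    rw [norm_neg, add_comm]
    refine add_le_add le_rfl ((norm_mul_le _ _).trans ?_)
    exact mul_le_of_le_one_left (norm_nonneg _) (norm_basisProj_le v F)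
  have hrank : ∀ F, ((R - compress v F R : Bl2) : Hl2 →ₗ[ℂ] Hl2).rank
      ≤ ((r + r : ℕ) : Cardinal) := fun F =>
    rank_sub_le_nat hR (rank_mul_le_left _ (rank_mul_le_right _ hR))
  have hR0 := tendsto_idealNorm_of_rank_le (E := E) hsep hrank hnorm
  filter_upwards [hR0.eventually (gt_mem_nhds (show 0 < ε / 8 by linarith))] with F hF
  rw [Real.dist_eq, sub_zero, abs_of_nonneg (hnn F)]
  have hsub := sub_mem_ideal hsep hT hRi
  have e : T - compress v F T = (T - R) + ((R - compress v F R) - compress v F (T - R)) := by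
    simp only [compress, mul_sub, sub_mul]
    abel
  rw [e]
  have h1 := idealNorm_add_le hsub (sub_mem_ideal hsep
    (sub_mem_ideal hsep hRi (compress_mem_ideal (v := v) hsep F R))
    (compress_mem_ideal (v := v) hsep F (T - R)))
  have h2 := idealNorm_sub_le hsep
    (sub_mem_ideal hsep hRi (compress_mem_ideal (v := v) hsep F R))
    (compress_mem_ideal (v := v) hsep F (T - R))
  have h3 := idealNorm_compress_le (v := v) hsep F hsub
  linarith

theorem rank_conjFlow_compress_le (F : Finset ι) (T : Bl2) (t : ℝ) :
    ((conjFlow (phaseGroup v x) t (compress v F T) : Bl2) : Hl2 →ₗ[ℂ] Hl2).rank ≤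
      ((F.card : ℕ) : Cardinal) := by
  rw [conjFlow, compress]
  refine rank_mul_le_left _ (rank_mul_le_right _ ?_)
  rw [mul_assoc]
  exact rank_mul_basisProj_le v F

theorem rank_compress_le (F : Finset ι) (T : Bl2) :
    ((compress v F T : Bl2) : Hl2 →ₗ[ℂ] Hl2).rank ≤ ((F.card : ℕ) : Cardinal) := by
  rw [compress, mul_assoc]
  exact rank_mul_basisProj_le v F

variable (v x) in
/-- The formal commutator of a compression, as an operator. -/
theorem exists_formalCommutator_compress (hsep : E.IsSeparable) (F : Finset ι) (T : Bl2) :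
    ∃ D ∈ E.ideal, IsFormalCommutator v x (compress v F T) D := by
  classical
  let Y : Bl2 := ∑ i ∈ F, (x i : ℂ) • rankOne ℂ (v i) (v i)
  have hY : ∀ j ξ, ⟪v j, Y ξ⟫ = (if j ∈ F then (x j : ℂ) else 0) * ⟪v j, ξ⟫ := by
    intro j ξ
    simp only [Y, sum_apply, smul_apply, inner_sum, inner_smul_right,
      InnerProductSpace.rankOne_apply, inner_basis_basis]
    by_cases hj : j ∈ F <;> simp [hj]
  have hYv : ∀ j, Y (v j) = (if j ∈ F then (x j : ℂ) else 0) • v j := by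
    intro j
    refine v.ext_inner fun i => ?_
    rw [hY, inner_smul_right, inner_basis_basis]
    by_cases hij : i = j
    · rw [hij]
    · simp [hij]
  refine ⟨Complex.I • (Y * compress v F T - compress v F T * Y), ?_, fun i j => ?_⟩
  · exact smul_mem_ideal hsep _ (sub_mem_ideal hsep
      (mul_mem_ideal_left hsep _ (compress_mem_ideal hsep F T))
      (mul_mem_ideal_right hsep _ (compress_mem_ideal hsep F T)))
  · rw [smul_apply, inner_smul_right, sub_apply, inner_sub_right, mul_apply_eq_comp,
      mul_apply_eq_comp, hY, hYv, map_smul, inner_smul_right, inner_compress]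
    by_cases hi : i ∈ F <;> by_cases hj : j ∈ F <;> simp [hi, hj]
    ring

/-- `α` is a `C₀`-group on the ideal. -/
theorem isC0Flow_phaseGroup (hsep : E.IsSeparable) : E.IsC0Flow (phaseGroup v x) := by
  refine ⟨fun t T hT => conjFlow_mem_ideal hsep t hT, fun T hT t₀ => ?_⟩
  have hmem : ∀ t, ∀ S ∈ E.ideal, conjFlow (phaseGroup v x) t S ∈ E.ideal := fun t S hS =>
    conjFlow_mem_ideal hsep t hS
  rw [Metric.tendsto_nhds]
  intro ε hε
  obtain ⟨F, hF⟩ := ((tendsto_idealNorm_sub_compress (v := v) hsep hT).eventually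
    (gt_mem_nhds (show 0 < ε / 16 by linarith))).exists
  have hTF := compress_mem_ideal (v := v) hsep F T
  have hfin : Tendsto (fun t => E.idealNorm (conjFlow (phaseGroup v x) t (compress v F T) -
      conjFlow (phaseGroup v x) t₀ (compress v F T))) (𝓝 t₀) (𝓝 0) := by
    refine tendsto_idealNorm_of_rank_le hsep (fun t => rank_sub_le_nat
      (rank_conjFlow_compress_le F T t) (rank_conjFlow_compress_le F T t₀)) ?_
    obtain ⟨D, -, hD⟩ := exists_formalCommutator_compress (E := E) v x hsep F T
    rw [← tendsto_iff_norm_sub_tendsto_zero]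
    simp only [conjFlow_compress]
    refine tendsto_finsetSum _ fun i _ => tendsto_finsetSum _ fun j _ => ?_
    refine Tendsto.smul_const ?_ _
    exact (hasDerivAt_exp_mul_I (x i - x j) t₀).continuousAt.tendsto
  filter_upwards [hfin.eventually (gt_mem_nhds (show 0 < ε / 8 by linarith))] with t ht
  have hsub := sub_mem_ideal hsep hT hTF
  rw [Real.dist_eq, sub_zero, abs_of_nonneg (idealNorm_nonneg
    (sub_mem_ideal hsep (hmem t T hT) (hmem t₀ T hT)))]
  have e : conjFlow (phaseGroup v x) t T - conjFlow (phaseGroup v x) t₀ T =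
      (conjFlow (phaseGroup v x) t (T - compress v F T) -
        conjFlow (phaseGroup v x) t₀ (T - compress v F T)) +
      (conjFlow (phaseGroup v x) t (compress v F T) -
        conjFlow (phaseGroup v x) t₀ (compress v F T)) := by
    simp only [conjFlow_sub]
    abel
  rw [e]
  have h1 := idealNorm_add_le (sub_mem_ideal hsep (hmem t _ hsub) (hmem t₀ _ hsub))
    (sub_mem_ideal hsep (hmem t _ hTF) (hmem t₀ _ hTF))
  have h2 := idealNorm_sub_le hsep (hmem t _ hsub) (hmem t₀ _ hsub)
  have h3 := idealNorm_conjFlow_le (v := v) (x := x) hsep t hsub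
  have h4 := idealNorm_conjFlow_le (v := v) (x := x) hsep t₀ hsub
  linarith

/-- The difference quotients of the flow are bounded by the commutator. -/
theorem idealNorm_slope_le (hsep : E.IsSeparable) {T D : Bl2} (hT : T ∈ E.ideal)
    (hD : D ∈ E.ideal) (h : IsFormalCommutator v x T D) (t : ℝ) :
    E.idealNorm ((t : ℂ)⁻¹ • (conjFlow (phaseGroup v x) t T - T)) ≤ 36 * E.idealNorm D := by
  let A : Bl2 → Bl2 := fun S => (t : ℂ)⁻¹ • (conjFlow (phaseGroup v x) t S - S)
  have hA : ∀ S ∈ E.ideal, A S ∈ E.ideal := fun S hS =>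
    smul_mem_ideal hsep _ (sub_mem_ideal hsep (conjFlow_mem_ideal hsep t hS) hS)
  have hAn : ∀ S ∈ E.ideal, E.idealNorm (A S) ≤ ‖(t : ℂ)⁻¹‖ * (4 * E.idealNorm S) := by
    intro S hS
    have hm := conjFlow_mem_ideal (v := v) (x := x) hsep t hS
    refine (idealNorm_smul_le _ (sub_mem_ideal hsep hm hS)).trans ?_
    refine mul_le_mul_of_nonneg_left ?_ (norm_nonneg _)
    have h1 := idealNorm_sub_le hsep hm hS
    have h2 := idealNorm_conjFlow_le (v := v) (x := x) hsep t hS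
    linarith
  have hlim : Tendsto (fun F => 36 * E.idealNorm D +
      2 * (‖(t : ℂ)⁻¹‖ * (4 * E.idealNorm (T - compress v F T)))) atTop
      (𝓝 (36 * E.idealNorm D)) := by
    have := ((((tendsto_idealNorm_sub_compress (v := v) hsep hT).const_mul 4).const_mul
      ‖(t : ℂ)⁻¹‖).const_mul 2).const_add (36 * E.idealNorm D)
    simpa using this
  refine ge_of_tendsto' hlim fun F => ?_
  have hTF := compress_mem_ideal (v := v) hsep F T
  have hDF := compress_mem_ideal (v := v) hsep F D
  have hsub := sub_mem_ideal hsep hT hTF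
  have e : A T = A (compress v F T) + A (T - compress v F T) := by
    simp only [A, ← smul_add, conjFlow_sub]
    congr 1
    abel
  change E.idealNorm (A T) ≤ _
  rw [e]
  have h1 := idealNorm_add_le (hA _ hTF) (hA _ hsub)
  have h2 := hAn _ hsub
  have h3 : E.idealNorm (A (compress v F T)) ≤ 18 * E.idealNorm (compress v F D) :=
    idealNorm_le_of_sum_le (hA _ hTF) hDF (by norm_num) (sum_singularNumber_slope_le h F t)
  have h4 := idealNorm_compress_le (v := v) hsep F hD
  linarith

/-- A formal commutator in the ideal is the derivative of the flow in the norm of the ideal. -/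
theorem tendsto_idealNorm_slope_sub (hsep : E.IsSeparable) {T D : Bl2} (hT : T ∈ E.ideal)
    (hD : D ∈ E.ideal) (h : IsFormalCommutator v x T D) :
    Tendsto (fun t : ℝ => E.idealNorm ((t : ℂ)⁻¹ • (conjFlow (phaseGroup v x) t T - T) - D))
      (𝓝[≠] 0) (𝓝 0) := by
  have hA : ∀ (t : ℝ), ∀ S ∈ E.ideal,
      (t : ℂ)⁻¹ • (conjFlow (phaseGroup v x) t S - S) ∈ E.ideal := fun t S hS =>
    smul_mem_ideal hsep _ (sub_mem_ideal hsep (conjFlow_mem_ideal hsep t hS) hS)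
  rw [Metric.tendsto_nhds]
  intro ε hε
  obtain ⟨F, hF⟩ := ((tendsto_idealNorm_sub_compress (v := v) hsep hD).eventually
    (gt_mem_nhds (show 0 < ε / 400 by linarith))).exists
  have hTF := compress_mem_ideal (v := v) hsep F T
  have hDF := compress_mem_ideal (v := v) hsep F D
  have hsubT := sub_mem_ideal hsep hT hTF
  have hsubD := sub_mem_ideal hsep hD hDF
  have hfin : Tendsto (fun t : ℝ => E.idealNorm ((t : ℂ)⁻¹ •
      (conjFlow (phaseGroup v x) t (compress v F T) - compress v F T) - compress v F D))
      (𝓝[≠] 0) (𝓝 0) := by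
    refine tendsto_idealNorm_of_rank_le hsep (r := F.card + F.card + F.card) (fun t => ?_) ?_
    · refine rank_sub_le_nat ?_ (rank_compress_le F D)
      have e : (t : ℂ)⁻¹ • (conjFlow (phaseGroup v x) t (compress v F T) - compress v F T)
          = ((t : ℂ)⁻¹ • (1 : Bl2)) *
            (conjFlow (phaseGroup v x) t (compress v F T) - compress v F T) := by
        rw [smul_mul_assoc, one_mul]
      rw [e]
      exact rank_mul_le_right _ (rank_sub_le_nat (rank_conjFlow_compress_le F T t)
        (rank_compress_le F T))
    · rw [← tendsto_iff_norm_sub_tendsto_zero]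
      have h1 := (hasDerivAt_conjFlow_compress v x h F 0).tendsto_slope_zero
      simp only [zero_add, conjFlow_zero] at h1
      refine h1.congr fun t => ?_
      rw [← Complex.ofReal_inv]
      rfl
  filter_upwards [hfin.eventually (gt_mem_nhds (show 0 < ε / 8 by linarith))] with t ht
  rw [Real.dist_eq, sub_zero, abs_of_nonneg (idealNorm_nonneg
    (sub_mem_ideal hsep (hA t T hT) hD))]
  have e : (t : ℂ)⁻¹ • (conjFlow (phaseGroup v x) t T - T) - D =
      ((t : ℂ)⁻¹ • (conjFlow (phaseGroup v x) t (T - compress v F T) - (T - compress v F T)) -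
        (D - compress v F D)) +
      ((t : ℂ)⁻¹ • (conjFlow (phaseGroup v x) t (compress v F T) - compress v F T) -
        compress v F D) := by
    simp only [conjFlow_sub, smul_sub]
    abel
  rw [e]
  have h1 := idealNorm_add_le (sub_mem_ideal hsep (hA t _ hsubT) hsubD)
    (sub_mem_ideal hsep (hA t _ hTF) hDF)
  have h2 := idealNorm_sub_le hsep (hA t _ hsubT) hsubD
  have h3 := idealNorm_slope_le hsep hsubT hsubD (h.sub (h.compress v x F)) t
  linarith

theorem tendsto_of_idealNorm_sub (hsep : E.IsSeparable) {α : Type*} {l : Filter α} {S : α → Bl2}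
    {T : Bl2} (hS : ∀ a, S a ∈ E.ideal) (hT : T ∈ E.ideal)
    (h : Tendsto (fun a => E.idealNorm (S a - T)) l (𝓝 0)) : Tendsto S l (𝓝 T) := by
  rw [tendsto_iff_norm_sub_tendsto_zero]
  have h1 := h.div_const (E.nrm (Pi.single 0 1))
  rw [zero_div] at h1
  refine squeeze_zero (fun _ => norm_nonneg _) (fun a => ?_) h1
  rw [le_div_iff₀ E.nrm_single_pos]
  exact norm_mul_le_idealNorm (sub_mem_ideal hsep (hS a) hT)

variable (E v x) in
/-- The graph of the derivation `T ↦ i [X, T]` on the ideal, `X` being the diagonal operator with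
eigenvalues `xᵢ`. -/
noncomputable def derivationGraph (hsep : E.IsSeparable) : Submodule ℂ (Bl2 × Bl2) where
  carrier := {p | p.1 ∈ E.ideal ∧ p.2 ∈ E.ideal ∧ IsFormalCommutator v x p.1 p.2}
  add_mem' := fun hp hq => ⟨add_mem_ideal hsep hp.1 hq.1, add_mem_ideal hsep hp.2.1 hq.2.1,
    hp.2.2.add hq.2.2⟩
  zero_mem' := ⟨mem_ideal_of_rank_le hsep (rank_zero_le 0),
    mem_ideal_of_rank_le hsep (rank_zero_le 0), fun i j => by simp⟩
  smul_mem' := fun c _ hp => ⟨smul_mem_ideal hsep c hp.1, smul_mem_ideal hsep c hp.2.1,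
    hp.2.2.smul c⟩

variable (E v x) in
/-- The derivation `T ↦ i [X, T]` on the ideal. -/
noncomputable def derivation (hsep : E.IsSeparable) : Bl2 →ₗ.[ℂ] Bl2 :=
  (derivationGraph E v x hsep).toLinearPMap

theorem mem_derivation_graph (hsep : E.IsSeparable) {T D : Bl2} :
    (T, D) ∈ (derivation E v x hsep).graph ↔
      T ∈ E.ideal ∧ D ∈ E.ideal ∧ IsFormalCommutator v x T D := by
  rw [derivation, Submodule.toLinearPMap_graph_eq]
  · rfl
  · rintro ⟨T, D⟩ ⟨-, -, h⟩ (rfl : T = 0)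
    refine v.ext_entries fun i j => ?_
    have := h i j
    simpa using this

theorem isGeneratorOnIdeal_derivation (hsep : E.IsSeparable) :
    E.IsGeneratorOnIdeal (phaseGroup v x) (derivation E v x hsep) := by
  intro T D
  rw [mem_derivation_graph]
  refine and_congr_right fun hT => and_congr_right fun hD =>
    ⟨fun h => tendsto_idealNorm_slope_sub hsep hT hD h, fun h i j => ?_⟩
  have h1 := tendsto_of_idealNorm_sub hsep (fun t : ℝ => smul_mem_ideal hsep _
    (sub_mem_ideal hsep (conjFlow_mem_ideal (v := v) (x := x) hsep t hT) hT)) hD h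
  have h2 : Tendsto (fun t : ℝ => ⟪v i, ((t : ℂ)⁻¹ •
      (conjFlow (phaseGroup v x) t T - T)) (v j)⟫) (𝓝[≠] 0) (𝓝 ⟪v i, D (v j)⟫) :=
    tendsto_const_nhds.inner
      (((ContinuousLinearMap.apply ℂ Hl2 (v j)).continuous.tendsto _).comp h1)
  refine tendsto_nhds_unique h2 (((tendsto_exp_slope (x i - x j)).mul_const
    ⟪v i, T (v j)⟫).congr fun t => ?_)
  rw [smul_apply, inner_smul_right, sub_apply, inner_sub_right, inner_conjFlow]
  ring

theorem isClosedSymmetricDerivation_derivation (hsep : E.IsSeparable) :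
    E.IsClosedSymmetricDerivation (derivation E v x hsep) := by
  have hg : ∀ T : (derivation E v x hsep).domain, (T : Bl2) ∈ E.ideal ∧
      derivation E v x hsep T ∈ E.ideal ∧ IsFormalCommutator v x T (derivation E v x hsep T) :=
    fun T => (mem_derivation_graph hsep).1 (LinearPMap.mem_graph _ T)
  refine ⟨fun T hT => (hg ⟨T, hT⟩).1, fun T => (hg T).2.1, ?_, ?_, ?_, ?_⟩
  · intro T hT ε hε
    obtain ⟨F, hF⟩ := ((tendsto_idealNorm_sub_compress (v := v) hsep hT).eventually
      (gt_mem_nhds hε)).exists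
    obtain ⟨D, hD, hDc⟩ := exists_formalCommutator_compress v x hsep F T
    exact ⟨compress v F T, LinearPMap.mem_domain_of_mem_graph
      ((mem_derivation_graph hsep).2 ⟨compress_mem_ideal hsep F T, hD, hDc⟩), hF⟩
  · intro u T hT D hD hu hδ
    exact (mem_derivation_graph hsep).2 ⟨hT, hD, IsFormalCommutator.of_tendsto
      (fun n => (hg (u n)).2.2) (tendsto_of_idealNorm_sub hsep (fun n => (hg (u n)).1) hT hu)
      (tendsto_of_idealNorm_sub hsep (fun n => (hg (u n)).2.1) hD hδ)⟩
  · intro T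
    exact (mem_derivation_graph hsep).2 ⟨star_mem_ideal hsep (hg T).1,
      star_mem_ideal hsep (hg T).2.1, (hg T).2.2.star⟩
  · intro T S
    exact (mem_derivation_graph hsep).2 ⟨mul_mem_ideal_left hsep _ (hg S).1,
      add_mem_ideal hsep (mul_mem_ideal_left hsep _ (hg S).1)
        (mul_mem_ideal_left hsep _ (hg S).2.1), (hg T).2.2.mul (hg S).2.2⟩

end generator

/-! ### Hilbert's inequality -/

section hilbert

open intervalIntegral

theorem integral_exp_int (k : ℤ) : ∫ θ in (0 : ℝ)..2 * Real.pi,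
    Complex.exp (Complex.I * k * θ) = if k = 0 then ((2 * Real.pi : ℝ) : ℂ) else 0 := by
  split_ifs with h
  · subst h
    simp
  · have hk : Complex.I * (k : ℂ) ≠ 0 :=
      mul_ne_zero Complex.I_ne_zero (by exact_mod_cast h)
    rw [integral_exp_mul_complex hk]
    have : Complex.I * (k : ℂ) * ((2 * Real.pi : ℝ) : ℂ) = k * (2 * Real.pi * Complex.I) := by
      push_cast
      ring
    rw [this, Complex.exp_int_mul_two_pi_mul_I]
    simp

/-- The Fourier coefficients of `π - θ`; for `k = 0` the right-hand side is `0` by the convention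
`z / 0 = 0`, as it should be. -/
theorem integral_sub_mul_exp_int (k : ℤ) : ∫ θ in (0 : ℝ)..2 * Real.pi,
    ((Real.pi - θ : ℝ) : ℂ) * Complex.exp (Complex.I * k * θ) = 2 * Real.pi * Complex.I / k := by
  rcases eq_or_ne k 0 with rfl | h
  · simp only [Int.cast_zero, mul_zero, zero_mul, Complex.exp_zero, mul_one, div_zero]
    rw [intervalIntegral.integral_ofReal, intervalIntegral.integral_sub (by simp) (by simp),
      integral_id, intervalIntegral.integral_const]
    simp
    ring
  · have hk : (k : ℂ) ≠ 0 := by exact_mod_cast h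
    have hI := Complex.I_ne_zero
    have hderiv : ∀ θ ∈ Set.uIcc (0 : ℝ) (2 * Real.pi), HasDerivAt (fun θ : ℝ =>
        (((Real.pi - θ : ℝ) : ℂ) / (Complex.I * k) + 1 / (Complex.I * k) ^ 2) *
          Complex.exp (Complex.I * k * θ))
        (((Real.pi - θ : ℝ) : ℂ) * Complex.exp (Complex.I * k * θ)) θ := by
      intro θ _
      have h1 : HasDerivAt (fun θ : ℝ => ((Real.pi - θ : ℝ) : ℂ)) ((-1 : ℝ) : ℂ) θ :=
        ((hasDerivAt_id θ).const_sub Real.pi).ofReal_comp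
      have h2 : HasDerivAt (fun θ : ℝ => Complex.I * k * (θ : ℂ)) (Complex.I * k) θ := by
        simpa using ((hasDerivAt_id θ).ofReal_comp).const_mul (Complex.I * (k : ℂ))
      convert! ((h1.div_const (Complex.I * k)).add_const (1 / (Complex.I * k) ^ 2)).mul h2.cexp
        using 1
      field_simp
      push_cast
      ring
    rw [integral_eq_sub_of_hasDerivAt hderiv
      (Continuous.intervalIntegrable (by fun_prop) _ _)]
    have : Complex.I * (k : ℂ) * ((2 * Real.pi : ℝ) : ℂ) = k * (2 * Real.pi * Complex.I) := by
      push_cast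
      ring
    rw [this, Complex.exp_int_mul_two_pi_mul_I]
    simp only [Complex.ofReal_zero, mul_zero, Complex.exp_zero, mul_one, sub_zero]
    push_cast
    field_simp
    rw [Complex.I_pow_three]
    ring

variable {N : ℕ}

/-- The trigonometric polynomial with coefficients `u`. -/
noncomputable def trigPoly (u : Fin N → ℂ) (θ : ℝ) : ℂ :=
  ∑ i, u i * Complex.exp (Complex.I * ((i : ℕ) : ℤ) * θ)

theorem continuous_trigPoly (u : Fin N → ℂ) : Continuous (trigPoly u) := by
  unfold trigPoly
  fun_prop

theorem conj_trigPoly_mul (u w : Fin N → ℂ) (θ : ℝ) :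
    starRingEnd ℂ (trigPoly u θ) * trigPoly w θ = ∑ i, ∑ j, starRingEnd ℂ (u i) * w j *
      Complex.exp (Complex.I * ((((j : ℕ) : ℤ) - ((i : ℕ) : ℤ) : ℤ) : ℂ) * θ) := by
  unfold trigPoly
  rw [map_sum, Finset.sum_mul_sum]
  refine Finset.sum_congr rfl fun i _ => Finset.sum_congr rfl fun j _ => ?_
  rw [map_mul, ← Complex.exp_conj]
  simp only [map_mul, Complex.conj_I, Complex.conj_ofReal, map_intCast]
  have : Complex.exp (Complex.I * ((((j : ℕ) : ℤ) - ((i : ℕ) : ℤ) : ℤ) : ℂ) * θ)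
      = Complex.exp (-Complex.I * (((i : ℕ) : ℤ) : ℂ) * θ) *
        Complex.exp (Complex.I * (((j : ℕ) : ℤ) : ℂ) * θ) := by
    rw [← Complex.exp_add]
    congr 1
    push_cast
    ring
  rw [this]
  ring

theorem integral_norm_sq_trigPoly (u : Fin N → ℂ) :
    ∫ θ in (0 : ℝ)..2 * Real.pi, ‖trigPoly u θ‖ ^ 2 = 2 * Real.pi * ∑ i, ‖u i‖ ^ 2 := by
  have h : ((∫ θ in (0 : ℝ)..2 * Real.pi, ‖trigPoly u θ‖ ^ 2 : ℝ) : ℂ)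
      = ∫ θ in (0 : ℝ)..2 * Real.pi, starRingEnd ℂ (trigPoly u θ) * trigPoly u θ := by
    rw [← intervalIntegral.integral_ofReal]
    congr 1
    funext θ
    rw [RCLike.conj_mul]
    norm_cast
  apply Complex.ofReal_injective
  rw [h]
  simp only [conj_trigPoly_mul]
  rw [intervalIntegral.integral_finsetSum
    fun i _ => Continuous.intervalIntegrable (by fun_prop) _ _]
  rw [Complex.ofReal_mul, Complex.ofReal_sum, Finset.mul_sum]
  refine Finset.sum_congr rfl fun i _ => ?_
  rw [intervalIntegral.integral_finsetSum
    fun j _ => Continuous.intervalIntegrable (by fun_prop) _ _]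
  rw [Finset.sum_eq_single i]
  · rw [intervalIntegral.integral_const_mul, integral_exp_int, if_pos (sub_self _),
      Complex.conj_mul']
    push_cast
    ring
  · intro j _ hj
    rw [intervalIntegral.integral_const_mul, integral_exp_int, if_neg, mul_zero]
    intro h0
    apply hj
    ext
    omega
  · simp

/-- Hilbert's inequality for the kernel `1 / (i - j)`: this kernel is the Toeplitz matrix whose
symbol is a multiple of the bounded function `π - θ`. The diagonal terms vanish by the convention
`0⁻¹ = 0`. -/
theorem hilbert_inequality (u w : Fin N → ℂ) :
    ‖∑ i : Fin N, ∑ j : Fin N,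
      (((((i : ℕ) : ℝ) - ((j : ℕ) : ℝ))⁻¹ : ℝ) : ℂ) * (starRingEnd ℂ (u i) * w j)‖ ≤
      Real.pi / 2 * (∑ i, ‖u i‖ ^ 2 + ∑ j, ‖w j‖ ^ 2) := by
  have hpi := Real.pi_pos
  have hint : ∫ θ in (0 : ℝ)..2 * Real.pi, ((Real.pi - θ : ℝ) : ℂ) *
      (starRingEnd ℂ (trigPoly u θ) * trigPoly w θ) = -(2 * Real.pi * Complex.I) *
      ∑ i : Fin N, ∑ j : Fin N,
      (((((i : ℕ) : ℝ) - ((j : ℕ) : ℝ))⁻¹ : ℝ) : ℂ) * (starRingEnd ℂ (u i) * w j) := by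
    simp only [conj_trigPoly_mul, Finset.mul_sum]
    rw [intervalIntegral.integral_finsetSum
      fun i _ => Continuous.intervalIntegrable (by fun_prop) _ _]
    refine Finset.sum_congr rfl fun i _ => ?_
    rw [intervalIntegral.integral_finsetSum
      fun j _ => Continuous.intervalIntegrable (by fun_prop) _ _]
    refine Finset.sum_congr rfl fun j _ => ?_
    have h1 := integral_sub_mul_exp_int (((j : ℕ) : ℤ) - ((i : ℕ) : ℤ))
    calc _ = ∫ θ in (0 : ℝ)..2 * Real.pi, starRingEnd ℂ (u i) * w j *
          (((Real.pi - θ : ℝ) : ℂ) *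
            Complex.exp (Complex.I * ((((j : ℕ) : ℤ) - ((i : ℕ) : ℤ) : ℤ) : ℂ) * θ)) := by
          congr 1
          funext θ
          ring
      _ = _ := by
          rw [intervalIntegral.integral_const_mul, h1]
          push_cast
          rw [← neg_sub ((i : ℕ) : ℂ) ((j : ℕ) : ℂ), div_neg, div_eq_mul_inv]
          ring
  have hbound : ‖∫ θ in (0 : ℝ)..2 * Real.pi, ((Real.pi - θ : ℝ) : ℂ) *
      (starRingEnd ℂ (trigPoly u θ) * trigPoly w θ)‖ ≤
      ∫ θ in (0 : ℝ)..2 * Real.pi, Real.pi / 2 * (‖trigPoly u θ‖ ^ 2 + ‖trigPoly w θ‖ ^ 2) := by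
    have hcu := continuous_trigPoly u
    have hcw := continuous_trigPoly w
    refine intervalIntegral.norm_integral_le_of_norm_le (by positivity)
      (Eventually.of_forall fun θ hθ => ?_) (Continuous.intervalIntegrable (by fun_prop) _ _)
    rw [norm_mul, norm_mul, RCLike.norm_conj, Complex.norm_real, Real.norm_eq_abs]
    have h1 : |Real.pi - θ| ≤ Real.pi := by
      rw [abs_le]
      constructor <;> linarith [hθ.1, hθ.2]
    have h2 := two_mul_le_add_sq ‖trigPoly u θ‖ ‖trigPoly w θ‖
    calc _ ≤ Real.pi * (‖trigPoly u θ‖ * ‖trigPoly w θ‖) := by gcongr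
      _ ≤ _ := by nlinarith
  rw [hint] at hbound
  have hcu := continuous_trigPoly u
  have hcw := continuous_trigPoly w
  rw [intervalIntegral.integral_const_mul, intervalIntegral.integral_add
    (Continuous.intervalIntegrable (by fun_prop) _ _)
    (Continuous.intervalIntegrable (by fun_prop) _ _),
    integral_norm_sq_trigPoly, integral_norm_sq_trigPoly, norm_mul] at hbound
  have h3 : ‖-(2 * (Real.pi : ℂ) * Complex.I)‖ = 2 * Real.pi := by
    rw [norm_neg, norm_mul, norm_mul, Complex.norm_I, Complex.norm_real, Real.norm_of_nonneg hpi.le]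
    simp
  rw [h3] at hbound
  have h4 : (0 : ℝ) < 2 * Real.pi := by positivity
  refine le_of_mul_le_mul_left (hbound.trans_eq ?_) h4
  ring

end hilbert

/-- The average row sum of `1 / |i - j|` over `N` indices is unbounded in `N`. -/
theorem exists_le_sum_abs_inv_sub (C : ℝ) : ∃ N : ℕ, 2 ≤ N ∧
    C * N ≤ ∑ i : Fin N, ∑ j : Fin N, |(((i : ℕ) : ℝ) - ((j : ℕ) : ℝ))⁻¹| := by
  obtain ⟨M, hM1, hM⟩ := ((eventually_ge_atTop 1).and
    (Real.tendsto_sum_range_one_div_nat_succ_atTop.eventually_ge_atTop (2 * C))).exists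
  refine ⟨M + M, by omega, ?_⟩
  rw [Fin.sum_univ_add]
  have h1 : ∀ i : Fin M, 2 * C ≤ ∑ j : Fin (M + M),
      |((((Fin.natAdd M i : Fin (M + M)) : ℕ) : ℝ) - ((j : ℕ) : ℝ))⁻¹| := by
    intro i
    refine hM.trans ?_
    -- the entries at distance `d + 1` to the left
    have h2 : ∑ d ∈ Finset.range M, 1 / ((d : ℝ) + 1) = ∑ d ∈ Finset.range M,
        |(((M + i : ℕ) : ℝ) - ((M + i - (d + 1) : ℕ) : ℝ))⁻¹| := by
      refine Finset.sum_congr rfl fun d hd => ?_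
      have hd := Finset.mem_range.1 hd
      have : ((M + i : ℕ) : ℝ) - ((M + i - (d + 1) : ℕ) : ℝ) = (d : ℝ) + 1 := by
        rw [Nat.cast_sub (by omega)]
        push_cast
        ring
      rw [this, abs_of_pos (by positivity), one_div]
    rw [h2, Fin.sum_univ_eq_sum_range fun j : ℕ =>
      |((((Fin.natAdd M i : Fin (M + M)) : ℕ) : ℝ) - (j : ℝ))⁻¹|]
    simp only [Fin.val_natAdd]
    rw [← Finset.sum_image (s := Finset.range M) (g := fun d => M + (i : ℕ) - (d + 1))
      (f := fun j : ℕ => |(((M + (i : ℕ) : ℕ) : ℝ) - (j : ℝ))⁻¹|)]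
    · refine Finset.sum_le_sum_of_subset_of_nonneg ?_ fun _ _ _ => abs_nonneg _
      intro j hj
      obtain ⟨d, hd, rfl⟩ := Finset.mem_image.1 hj
      have hd := Finset.mem_range.1 hd
      have := i.2
      exact Finset.mem_range.2 (by omega)
    · intro a ha b hb hab
      have ha := Finset.mem_range.1 ha
      have hb := Finset.mem_range.1 hb
      have := i.2
      simp only at hab
      omega
  have h3 : ∑ _i : Fin M, 2 * C ≤ _ := Finset.sum_le_sum fun i (_ : i ∈ Finset.univ) => h1 i
  rw [Finset.sum_const, Finset.card_univ, Fintype.card_fin, nsmul_eq_mul] at h3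
  have h4 : 0 ≤ ∑ i : Fin M, ∑ j : Fin (M + M),
      |((((Fin.castAdd M i : Fin (M + M)) : ℕ) : ℝ) - ((j : ℕ) : ℝ))⁻¹| :=
    Finset.sum_nonneg fun _ _ => Finset.sum_nonneg fun _ _ => abs_nonneg _
  push_cast
  linarith

/-! ### Tensor products of a matrix with a diagonal operator -/

section tensor

variable {N r : ℕ} {p q : Fin N × Fin r → Hl2}

/-- The tensor product of the matrix `g` with the diagonal matrix `y`, acting from the span of `q`
to the span of `p`. -/
noncomputable def tensorOp (p q : Fin N × Fin r → Hl2) (g : Fin N → Fin N → ℝ) (y : Fin r → ℝ) :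
    Bl2 := ∑ k, ∑ i, ∑ j, ((g i j * y k : ℝ) : ℂ) • rankOne ℂ (p (i, k)) (q (j, k))

theorem tensorOp_apply (p q : Fin N × Fin r → Hl2) (g : Fin N → Fin N → ℝ) (y : Fin r → ℝ)
    (x : Hl2) : tensorOp p q g y x =
      ∑ k, ∑ i, ∑ j, (((g i j * y k : ℝ) : ℂ) * ⟪q (j, k), x⟫) • p (i, k) := by
  simp [tensorOp, smul_smul]

theorem inner_tensorOp_apply (p q : Fin N × Fin r → Hl2) (g : Fin N → Fin N → ℝ) (y : Fin r → ℝ)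
    (z x : Hl2) : ⟪z, tensorOp p q g y x⟫ =
      ∑ k, ∑ i, ∑ j, ((g i j * y k : ℝ) : ℂ) * (⟪z, p (i, k)⟫ * ⟪q (j, k), x⟫) := by
  rw [tensorOp_apply]
  simp only [inner_sum, inner_smul_right]
  refine Finset.sum_congr rfl fun k _ => Finset.sum_congr rfl fun i _ =>
    Finset.sum_congr rfl fun j _ => ?_
  ring

theorem inner_right_tensor (hq : Orthonormal ℂ q) (j j' : Fin N) (k k' : Fin r) :
    ⟪q (j, k), q (j', k')⟫ = if k = k' then if j = j' then 1 else 0 else 0 := by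
  classical
  rw [orthonormal_iff_ite.1 hq]
  simp only [Prod.mk.injEq]
  split_ifs <;> simp_all

theorem tensorOp_apply_basis (p : Fin N × Fin r → Hl2) (hq : Orthonormal ℂ q)
    (g : Fin N → Fin N → ℝ) (y : Fin r → ℝ) (j : Fin N) (k : Fin r) :
    tensorOp p q g y (q (j, k)) = ∑ i, ((g i j * y k : ℝ) : ℂ) • p (i, k) := by
  rw [tensorOp_apply]
  simp [inner_right_tensor hq]

theorem tensorOp_mem_ideal {E : SymmetricSequenceSpace} (hsep : E.IsSeparable)
    (p q : Fin N × Fin r → Hl2) (g : Fin N → Fin N → ℝ) (y : Fin r → ℝ) :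
    tensorOp p q g y ∈ E.ideal := by
  classical
  refine SymmetricSequenceSpace.mem_ideal_of_rank_le hsep
    (rank_le_of_forall_mem_span Finset.univ p fun x => ?_)
  rw [tensorOp_apply]
  exact Submodule.sum_mem _ fun k _ => Submodule.sum_mem _ fun i _ => Submodule.sum_mem _ fun j _ =>
    Submodule.smul_mem _ _ (Submodule.subset_span ⟨(i, k), by simp, rfl⟩)

theorem inner_diagOp_apply {κ : Type*} [Fintype κ] {p : κ → Hl2} (hp : Orthonormal ℂ p)
    (q : κ → Hl2) (c : κ → ℂ) (i : κ) (x : Hl2) : ⟪p i, diagOp p q c x⟫ = c i * ⟪q i, x⟫ := by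
  rw [diagOp_apply, hp.inner_right_fintype]

theorem tensorOp_eq_mul_diagOp (p : Fin N × Fin r → Hl2) (hq : Orthonormal ℂ q)
    (g : Fin N → Fin N → ℝ) (y : Fin r → ℝ) :
    tensorOp p q g y = tensorOp p q g (fun _ => 1) * diagOp q q fun a => (y a.2 : ℂ) := by
  ext1 x
  rw [mul_apply_eq_comp, tensorOp_apply, tensorOp_apply]
  refine Finset.sum_congr rfl fun k _ => Finset.sum_congr rfl fun i _ =>
    Finset.sum_congr rfl fun j _ => ?_
  rw [inner_diagOp_apply hq]
  congr 1
  push_cast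
  ring

/-- The matrix `1 / (i - j)`, with zeros on the diagonal by the convention `0⁻¹ = 0`. -/
noncomputable def hilbertMatrix (N : ℕ) (i j : Fin N) : ℝ := (((i : ℕ) : ℝ) - ((j : ℕ) : ℝ))⁻¹

theorem norm_tensorOp_hilbertMatrix_le (hp : Orthonormal ℂ p) (hq : Orthonormal ℂ q) :
    ‖tensorOp p q (hilbertMatrix N) fun _ => 1‖ ≤ Real.pi := by
  have hpi := Real.pi_pos
  set B := tensorOp p q (hilbertMatrix N) fun _ => 1 with hB
  have key : ∀ z x : Hl2, ‖⟪z, B x⟫‖ ≤ Real.pi / 2 * (‖z‖ ^ 2 + ‖x‖ ^ 2) := by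
    intro z x
    rw [hB, inner_tensorOp_apply]
    refine (norm_sum_le _ _).trans ?_
    have h1 : ∀ k : Fin r, ‖∑ i : Fin N, ∑ j : Fin N,
        ((hilbertMatrix N i j * 1 : ℝ) : ℂ) * (⟪z, p (i, k)⟫ * ⟪q (j, k), x⟫)‖ ≤
        Real.pi / 2 * (∑ i, ‖⟪p (i, k), z⟫‖ ^ 2 + ∑ j, ‖⟪q (j, k), x⟫‖ ^ 2) := by
      intro k
      have := hilbert_inequality (fun i : Fin N => ⟪p (i, k), z⟫) fun j => ⟪q (j, k), x⟫
      simpa only [inner_conj_symm, mul_one, hilbertMatrix] using this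
    refine (Finset.sum_le_sum fun k _ => h1 k).trans ?_
    rw [← Finset.mul_sum, Finset.sum_add_distrib]
    have h2 := hp.isBessel z
    have h3 := hq.isBessel x
    rw [Fintype.sum_prod_type_right] at h2 h3
    gcongr
  refine ContinuousLinearMap.opNorm_le_bound _ hpi.le fun x => ?_
  rcases eq_or_ne (B x) 0 with h0 | h0
  · rw [h0, norm_zero]
    positivity
  have hb : 0 < ‖B x‖ := norm_pos_iff.2 h0
  -- the quadratic bound is applied to the multiple of `B x` that has the length of `x`
  have h1 := key (((‖x‖ / ‖B x‖ : ℝ) : ℂ) • B x) x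
  rw [inner_smul_left, norm_mul, RCLike.norm_conj, norm_smul, Complex.norm_real,
    inner_self_eq_norm_sq_to_K, Real.norm_of_nonneg (by positivity),
    div_mul_cancel₀ _ hb.ne'] at h1
  have h2 : ‖((‖B x‖ : ℝ) : ℂ) ^ 2‖ = ‖B x‖ ^ 2 := by
    rw [norm_pow, Complex.norm_real, norm_norm]
  have h3 : ‖x‖ / ‖B x‖ * ‖B x‖ ^ 2 = ‖x‖ * ‖B x‖ := by
    field_simp
  have h4 : ‖x‖ * ‖B x‖ ≤ ‖x‖ * (Real.pi * ‖x‖) := by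
    rw [← h3, ← h2]
    refine h1.trans_eq ?_
    ring
  rcases eq_or_ne x 0 with rfl | hx
  · simp
  · exact le_of_mul_le_mul_left h4 (norm_pos_iff.2 hx)

/-- The normalized sums over the first index. -/
noncomputable def avg (p : Fin N × Fin r → Hl2) (k : Fin r) : Hl2 :=
  (((√(N : ℝ))⁻¹ : ℝ) : ℂ) • ∑ i, p (i, k)

theorem inner_avg (hp : Orthonormal ℂ p) (i : Fin N) (k k' : Fin r) :
    ⟪p (i, k), avg p k'⟫ = if k = k' then (((√(N : ℝ))⁻¹ : ℝ) : ℂ) else 0 := by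
  rw [avg, inner_smul_right, inner_sum]
  simp only [inner_right_tensor hp]
  split_ifs <;> simp

theorem inv_sqrt_mul_inv_sqrt (N : ℕ) :
    (((√(N : ℝ))⁻¹ : ℝ) : ℂ) * (((√(N : ℝ))⁻¹ : ℝ) : ℂ) = (N : ℂ)⁻¹ := by
  rw [← Complex.ofReal_mul, ← mul_inv, Real.mul_self_sqrt (Nat.cast_nonneg N)]
  simp

theorem orthonormal_avg (hN : 0 < N) (hp : Orthonormal ℂ p) : Orthonormal ℂ (avg p) := by
  classical
  have hN' : (N : ℂ) ≠ 0 := by exact_mod_cast hN.ne'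
  rw [orthonormal_iff_ite]
  intro k k'
  rw [avg, inner_smul_left, sum_inner]
  simp only [inner_avg hp, Complex.conj_ofReal]
  split_ifs
  · rw [Finset.sum_const, Finset.card_univ, Fintype.card_fin, nsmul_eq_mul]
    calc _ = (N : ℂ) * ((((√(N : ℝ))⁻¹ : ℝ) : ℂ) * (((√(N : ℝ))⁻¹ : ℝ) : ℂ)) := by ring
      _ = 1 := by rw [inv_sqrt_mul_inv_sqrt, mul_inv_cancel₀ hN']
  · simp

theorem tensorOp_one (hN : 0 < N) (p q : Fin N × Fin r → Hl2) (y : Fin r → ℝ) :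
    tensorOp p q (fun _ _ => 1) y = diagOp (avg p) (avg q) fun k => ((N * y k : ℝ) : ℂ) := by
  have hN' : (N : ℂ) ≠ 0 := by exact_mod_cast hN.ne'
  ext1 x
  rw [tensorOp_apply, diagOp_apply]
  refine Finset.sum_congr rfl fun k _ => ?_
  rw [avg, avg, inner_smul_left, sum_inner, smul_smul, Finset.smul_sum, Complex.conj_ofReal]
  refine Finset.sum_congr rfl fun i _ => ?_
  rw [← Finset.sum_smul]
  congr 1
  rw [← Finset.mul_sum]
  calc _ = (N * (N : ℂ)⁻¹) * (y k * ∑ j, ⟪q (j, k), x⟫) := by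
        rw [mul_inv_cancel₀ hN']
        simp
    _ = _ := by
        rw [← inv_sqrt_mul_inv_sqrt]
        push_cast
        ring

theorem avg_mul_tensorOp_mul_avg (hp : Orthonormal ℂ p) (hq : Orthonormal ℂ q)
    (g : Fin N → Fin N → ℝ) (y : Fin r → ℝ) :
    diagOp (avg p) (avg p) (fun _ => 1) * tensorOp p q g y * diagOp (avg q) (avg q) (fun _ => 1) =
      diagOp (avg p) (avg q) fun k => (((∑ i, ∑ j, g i j) / N * y k : ℝ) : ℂ) := by
  ext1 x
  rw [mul_apply_eq_comp, mul_apply_eq_comp, diagOp_apply (avg p), diagOp_apply (avg p) (avg q)]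
  refine Finset.sum_congr rfl fun k _ => ?_
  congr 1
  have h1 : ∀ (j : Fin N) (k : Fin r), ⟪q (j, k), diagOp (avg q) (avg q) (fun _ => 1) x⟫ =
      (((√(N : ℝ))⁻¹ : ℝ) : ℂ) * ⟪avg q k, x⟫ := by
    intro j k
    rw [diagOp_apply, inner_sum]
    simp [inner_smul_right, inner_avg hq, mul_comm]
  have h2 : ∀ (i : Fin N) (k' : Fin r), ⟪avg p k, p (i, k')⟫ =
      if k' = k then (((√(N : ℝ))⁻¹ : ℝ) : ℂ) else 0 := by
    intro i k'
    rw [← inner_conj_symm, inner_avg hp]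
    split_ifs <;> simp
  rw [inner_tensorOp_apply]
  simp only [h1, h2]
  rw [Finset.sum_eq_single k]
  · simp only [if_true, one_mul]
    push_cast
    simp only [Finset.sum_div, Finset.sum_mul]
    refine Finset.sum_congr rfl fun i _ => Finset.sum_congr rfl fun j _ => ?_
    have := inv_sqrt_mul_inv_sqrt N
    push_cast at this
    rw [div_eq_mul_inv, ← this]
    ring
  · intro k' _ hk
    simp [hk]
  · simp

end tensor

/-! ### Norms of tensor products -/

namespace SymmetricSequenceSpace

variable {E : SymmetricSequenceSpace} {N r : ℕ} {p q : Fin N × Fin r → Hl2} {y : ℕ → ℝ}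

theorem idealNorm_diagOp_fin {P Q : Fin r → Hl2} (hP : Orthonormal ℂ P) (hQ : Orthonormal ℂ Q)
    (hy : y ∈ E.carrier) (hr : ∀ k, r ≤ k → y k = 0) (c : ℝ) :
    E.idealNorm (diagOp P Q fun k => ((c * y k : ℝ) : ℂ)) = |c| * E.nrm y := by
  rw [← E.nrm_smul c y hy]
  refine idealNorm_diagOp E hP hQ _ Fin.val_injective (fun i => ?_) (fun k hk => ?_)
    (E.carrier.smul_mem c hy)
  · rw [Complex.norm_real]
    rfl
  · have : r ≤ k := by
      by_contra! h
      exact hk ⟨⟨k, h⟩, rfl⟩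
    simp [hr k this]

theorem idealNorm_tensorOp_hilbertMatrix_le (hsep : E.IsSeparable) (hN : 0 < N)
    (hp : Orthonormal ℂ p) (hq : Orthonormal ℂ q) (hy : y ∈ E.carrier)
    (hr : ∀ k, r ≤ k → y k = 0) :
    E.idealNorm (tensorOp p q (hilbertMatrix N) fun k => y k) ≤
      Real.pi * E.nrm (dilate N y) := by
  have hd := E.dilate_mem hN hy
  rw [tensorOp_eq_mul_diagOp p hq]
  refine (idealNorm_mul_le_left _ (diagOp_mem_ideal hsep _ _ _)).trans ?_
  have hnorm : E.idealNorm (diagOp q q fun a => ((y a.2 : ℝ) : ℂ)) = E.nrm (dilate N y) := by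
    -- `σ_N y` lists the diagonal entries, that of `q (i, k)` at the position `N k + i`
    refine idealNorm_diagOp E hq hq _ (φ := fun a => N * (a.2 : ℕ) + a.1) ?_ ?_ ?_ hd
    · rintro ⟨i, k⟩ ⟨i', k'⟩ h
      have h1 : (N * (k : ℕ) + i) / N = k := by
        rw [Nat.mul_add_div hN, Nat.div_eq_of_lt i.2, add_zero]
      have h2 : (N * (k' : ℕ) + i') / N = k' := by
        rw [Nat.mul_add_div hN, Nat.div_eq_of_lt i'.2, add_zero]
      simp only at h
      have hk : (k : ℕ) = k' := by rw [← h1, ← h2, h]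
      have hi : (i : ℕ) = i' := by
        rw [hk] at h
        omega
      exact Prod.ext (Fin.ext hi) (Fin.ext hk)
    · rintro ⟨i, k⟩
      simp only [dilate, Complex.norm_real, Real.norm_eq_abs]
      rw [Nat.mul_add_div hN, Nat.div_eq_of_lt i.2, add_zero]
    · intro l hl
      refine hr _ ?_
      by_contra! h
      exact hl ⟨(⟨l % N, Nat.mod_lt _ hN⟩, ⟨l / N, h⟩), Nat.div_add_mod l N⟩
  rw [hnorm]
  exact mul_le_mul_of_nonneg_right (norm_tensorOp_hilbertMatrix_le hp hq) (E.nrm_nonneg hd)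

theorem sum_mul_nrm_le_idealNorm_tensorOp (hsep : E.IsSeparable) (hN : 0 < N)
    (hp : Orthonormal ℂ p) (hq : Orthonormal ℂ q) (hy : y ∈ E.carrier)
    (hr : ∀ k, r ≤ k → y k = 0) (g : Fin N → Fin N → ℝ) :
    (∑ i, ∑ j, g i j) / N * E.nrm y ≤ E.idealNorm (tensorOp p q g fun k => y k) := by
  have hP := orthonormal_avg hN hp
  have hQ := orthonormal_avg hN hq
  have h1 := idealNorm_diagOp_fin (E := E) hP hQ hy hr ((∑ i, ∑ j, g i j) / N)
  rw [← avg_mul_tensorOp_mul_avg hp hq] at h1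
  have h2 := idealNorm_mul_mul_le hsep
    (norm_diagOp_le hP hP (c := fun _ => 1) zero_le_one (by simp))
    (norm_diagOp_le hQ hQ (c := fun _ => 1) zero_le_one (by simp))
    (tensorOp_mem_ideal hsep p q g fun k => y k)
  rw [h1] at h2
  exact (mul_le_mul_of_nonneg_right (le_abs_self _) (E.nrm_nonneg hy)).trans h2

theorem sum_fiber_div (hr : ∀ k, r ≤ k → y k = 0) (N n : ℕ) :
    ∑ k : Fin r, (((Finset.range n).filter fun l => l / N = k).card : ℝ) * y k =
      ∑ l ∈ Finset.range n, dilate N y l := by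
  simp only [Finset.card_filter, Nat.cast_sum, Finset.sum_mul]
  rw [Finset.sum_comm]
  refine Finset.sum_congr rfl fun l _ => ?_
  by_cases h : l / N < r
  · rw [Finset.sum_eq_single ⟨l / N, h⟩]
    · simp [dilate]
    · intro k _ hk
      rw [if_neg fun h' => hk (Fin.ext h'.symm)]
      simp
    · simp
  · rw [dilate, hr _ (not_lt.1 h)]
    refine Finset.sum_eq_zero fun k _ => ?_
    rw [if_neg fun h' : l / N = k => h (h' ▸ k.2)]
    simp

theorem card_filter_div_le (hN : 0 < N) (n k : ℕ) :
    ((Finset.range n).filter fun l => l / N = k).card ≤ N := by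
  calc _ ≤ (Finset.Ico (N * k) (N * k + N)).card := by
        refine Finset.card_le_card fun l hl => ?_
        obtain ⟨-, rfl⟩ := Finset.mem_filter.1 hl
        have := Nat.div_add_mod l N
        have := Nat.mod_lt l hN
        exact Finset.mem_Ico.2 (by omega)
    _ = N := by simp

theorem sum_card_filter_div_le (N n r : ℕ) :
    ∑ k : Fin r, ((Finset.range n).filter fun l => l / N = k).card ≤ n := by
  rw [← Finset.card_biUnion]
  · refine (Finset.card_le_card (Finset.biUnion_subset.2 fun k _ =>
      Finset.filter_subset _ _)).trans_eq (Finset.card_range n)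
  · intro k _ k' _ hk
    refine Finset.disjoint_left.2 fun l h1 h2 => hk (Fin.ext ?_)
    rw [← (Finset.mem_filter.1 h1).2, (Finset.mem_filter.1 h2).2]

/-- The operator is tested against the Hilbert matrix, a contraction up to the factor `π`, with
weights on the diagonal factor which pick out its first `n` singular values. -/
theorem sum_mul_nrm_dilate_le_idealNorm_tensorOp (hsep : E.IsSeparable) (hN : 0 < N)
    (hp : Orthonormal ℂ p) (hq : Orthonormal ℂ q) (hy : y ∈ E.carrier)
    (hanti : Antitone y) (hy0 : ∀ k, 0 ≤ y k) (hr : ∀ k, r ≤ k → y k = 0)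
    (m : Fin N → Fin N → ℝ) (hm : 0 ≤ ∑ i, ∑ j, hilbertMatrix N i j * m i j) :
    (∑ i, ∑ j, hilbertMatrix N i j * m i j) / (9 * Real.pi * N) * E.nrm (dilate N y) ≤
      E.idealNorm (tensorOp p q m fun k => y k) := by
  have hpi := Real.pi_pos
  have hN' : (0 : ℝ) < N := by exact_mod_cast hN
  set R := ∑ i, ∑ j, hilbertMatrix N i j * m i j with hR
  set T := tensorOp p q m fun k => y k with hT
  have hTE : T ∈ E.ideal := tensorOp_mem_ideal hsep p q m _
  set B := tensorOp p q (hilbertMatrix N) fun _ => 1 with hB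
  have hBn : ‖((Real.pi⁻¹ : ℝ) : ℂ) • B‖ ≤ 1 := by
    rw [norm_smul, Complex.norm_real, Real.norm_of_nonneg (by positivity)]
    calc _ ≤ Real.pi⁻¹ * Real.pi := by
          gcongr
          exact norm_tensorOp_hilbertMatrix_le hp hq
      _ = 1 := inv_mul_cancel₀ hpi.ne'
  have hd := E.dilate_mem hN hy
  have hdanti : Antitone (dilate N y) := fun a b hab => hanti (Nat.div_le_div_right hab)
  rw [← abs_of_nonneg (a := R / (9 * Real.pi * N)) (by positivity), ← E.nrm_smul _ _ hd]
  refine E.nrm_le_of_submajorized _ hTE.2 _ (E.carrier.smul_mem _ hd)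
    (submajorized_of_antitone
      (fun a b hab => mul_le_mul_of_nonneg_left (hdanti hab) (by positivity))
      (fun n => mul_nonneg (by positivity) (hy0 _)) (singularNumber_antitone T)
      (singularNumber_nonneg T) fun n => ?_)
  -- the share of the `k`-th block of `σ_N y` that lies among its first `n` entries
  set w : Fin r → ℝ := fun k =>
    (((Finset.range n).filter fun l => l / N = k).card : ℝ) / N with hw
  have hw0 : ∀ k, 0 ≤ w k := fun k => by positivity
  have hw1 : ∀ k, w k ≤ 1 := fun k => by
    rw [hw, div_le_one hN']
    exact_mod_cast card_filter_div_le hN n k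
  have hf : IsBessel fun a : Fin N × Fin r =>
      (w a.2 : ℂ) • (((Real.pi⁻¹ : ℝ) : ℂ) • B) (q a) :=
    (hq.isBessel.map hBn).smul fun a => by
      rw [Complex.norm_real, Real.norm_of_nonneg (hw0 _)]
      exact hw1 _
  have hmass : ∑ a : Fin N × Fin r,
      ‖(w a.2 : ℂ) • (((Real.pi⁻¹ : ℝ) : ℂ) • B) (q a)‖ * ‖q a‖ ≤ n := by
    calc _ ≤ ∑ a : Fin N × Fin r, w a.2 := by
          refine Finset.sum_le_sum fun a _ => ?_
          rw [hq.1 a, mul_one, norm_smul, Complex.norm_real, Real.norm_of_nonneg (hw0 _)]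
          refine mul_le_of_le_one_right (hw0 _) (((_ : Bl2).le_opNorm _).trans ?_)
          rw [hq.1 a, mul_one]
          exact hBn
      _ = ∑ k : Fin r, (((Finset.range n).filter fun l => l / N = k).card : ℝ) := by
          rw [Fintype.sum_prod_type_right]
          refine Finset.sum_congr rfl fun k _ => ?_
          change ∑ _j : Fin N, w k = _
          rw [Finset.sum_const, Finset.card_univ, Fintype.card_fin, nsmul_eq_mul]
          exact mul_div_cancel₀ _ hN'.ne'
      _ ≤ n := by exact_mod_cast sum_card_filter_div_le N n r
  have hpair := norm_pairing_le_sum_singularNumber hq.isBessel hf hmass T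
  have hval : pairing q (fun a : Fin N × Fin r =>
      (w a.2 : ℂ) • (((Real.pi⁻¹ : ℝ) : ℂ) • B) (q a)) T =
      ((Real.pi⁻¹ * R * ∑ k, w k * y k : ℝ) : ℂ) := by
    rw [pairing, Fintype.sum_prod_type_right, Finset.mul_sum, Complex.ofReal_sum]
    refine Finset.sum_congr rfl fun k _ => ?_
    have h1 : ∀ j, ⟪(w k : ℂ) • (((Real.pi⁻¹ : ℝ) : ℂ) • B) (q (j, k)), T (q (j, k))⟫ =
        ((w k * Real.pi⁻¹ * ∑ i, hilbertMatrix N i j * (m i j * y k) : ℝ) : ℂ) := by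
      intro j
      have hpk : Orthonormal ℂ fun i => p (i, k) :=
        hp.comp (fun i => (i, k)) fun i j h => by simpa using h
      rw [smul_apply, inner_smul_left, inner_smul_left, hB, hT, tensorOp_apply_basis p hq,
        tensorOp_apply_basis p hq, hpk.inner_sum]
      simp only [mul_one, Complex.conj_ofReal]
      push_cast
      ring
    simp only [h1]
    rw [← Complex.ofReal_sum]
    congr 1
    rw [← Finset.mul_sum, Finset.sum_comm, hR]
    simp only [Finset.mul_sum, Finset.sum_mul]
    refine Finset.sum_congr rfl fun i _ => Finset.sum_congr rfl fun j _ => ?_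
    ring
  have hwy : ∑ k, w k * y k = (N : ℝ)⁻¹ * ∑ l ∈ Finset.range n, dilate N y l := by
    rw [← sum_fiber_div hr N n, Finset.mul_sum]
    refine Finset.sum_congr rfl fun k _ => ?_
    rw [hw]
    ring
  rw [hval, hwy, Complex.norm_real] at hpair
  have h2 := (le_abs_self _).trans hpair
  simp only [Pi.smul_apply, smul_eq_mul]
  rw [← Finset.mul_sum]
  calc _ = 9⁻¹ * (Real.pi⁻¹ * R * ((N : ℝ)⁻¹ * ∑ l ∈ Finset.range n, dilate N y l)) := by
        field_simp
    _ ≤ 9⁻¹ * (9 * ∑ k ∈ Finset.range n, singularNumber T k) := by gcongr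
    _ = _ := by ring

/-- When a Boyd index is trivial, multiplying entrywise by the multiplier `m` can increase the norm
by a factor comparable to the average row sum of `m i j / (i - j)`: the test operator is a dilated
diagonal operator times the Hilbert matrix for `α = 0`, and times the all-ones matrix for
`β = 1`. -/
theorem exists_tensorOp_of_trivial (hsep : E.IsSeparable) (hE : E.HasTrivialBoydIndex)
    (hN : 2 ≤ N) : ∃ (g : Fin N → Fin N → ℝ) (r : ℕ) (y : Fin r → ℝ) (ν : ℝ), 0 < r ∧ 0 < ν ∧
      ∀ p q : Fin N × Fin r → Hl2, Orthonormal ℂ p → Orthonormal ℂ q →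
        E.idealNorm (tensorOp p q g y) ≤ ν ∧
        ∀ m : Fin N → Fin N → ℝ, 0 ≤ ∑ i, ∑ j, hilbertMatrix N i j * m i j →
          (∑ i, ∑ j, hilbertMatrix N i j * m i j) / N * ν / 144 ≤
            E.idealNorm (tensorOp p q (fun i j => m i j * g i j) y) := by
  have hN0 : 0 < N := by omega
  have hN' : (0 : ℝ) < N := by exact_mod_cast hN0
  have hpi := Real.pi_pos
  have hpi4 := Real.pi_le_four
  rcases hE with hE | hE
  · obtain ⟨x, hx, hx0, hxN⟩ := exists_nrm_dilate_le_of_lower hE hN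
    obtain ⟨y, hy, hanti, hy0, ⟨r, hr⟩, h1, h2, h3, h4⟩ :=
      exists_sorted_truncation hsep hN0 hx hx0
    have hypos : 0 < E.nrm y := by linarith
    have hr0 : 0 < r := by
      by_contra! h
      rw [show y = 0 from funext fun k => hr k (by omega), E.nrm_zero] at hypos
      exact hypos.false
    refine ⟨hilbertMatrix N, r, fun k => y k, 4 * Real.pi * E.nrm y, hr0, by positivity,
      fun p q hp hq => ⟨?_, fun m hm => ?_⟩⟩
    · refine (idealNorm_tensorOp_hilbertMatrix_le hsep hN0 hp hq hy hr).trans ?_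
      nlinarith
    · have h5 := sum_mul_nrm_le_idealNorm_tensorOp hsep hN0 hp hq hy hr
        fun i j => m i j * hilbertMatrix N i j
      refine le_trans ?_ h5
      simp only [mul_comm (m _ _)]
      have h6 : 0 ≤ (∑ i, ∑ j, hilbertMatrix N i j * m i j) / N * E.nrm y := by positivity
      nlinarith
  · obtain ⟨x, hx, hx0, hxN⟩ := exists_le_nrm_dilate_of_upper hE hN
    obtain ⟨y, hy, hanti, hy0, ⟨r, hr⟩, h1, h2, h3, h4⟩ :=
      exists_sorted_truncation hsep hN0 hx hx0
    have hypos : 0 < E.nrm y := by linarith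
    have hr0 : 0 < r := by
      by_contra! h
      rw [show y = 0 from funext fun k => hr k (by omega), E.nrm_zero] at hypos
      exact hypos.false
    refine ⟨fun _ _ => 1, r, fun k => y k, N * E.nrm y, hr0, by positivity,
      fun p q hp hq => ⟨?_, fun m hm => ?_⟩⟩
    · rw [tensorOp_one hN0, idealNorm_diagOp_fin (orthonormal_avg hN0 hp) (orthonormal_avg hN0 hq)
        hy hr, abs_of_pos hN']
    · simp only [mul_one]
      refine le_trans ?_ (sum_mul_nrm_dilate_le_idealNorm_tensorOp hsep hN0 hp hq hy hanti hy0 hr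
        m hm)
      set R := ∑ i, ∑ j, hilbertMatrix N i j * m i j
      have h5 : N * E.nrm y ≤ 4 * E.nrm (dilate N y) := by nlinarith
      have h6 : 0 ≤ E.nrm (dilate N y) := E.nrm_nonneg (E.dilate_mem hN0 hy)
      calc R / N * (N * E.nrm y) / 144 ≤ R / N * (4 * E.nrm (dilate N y)) / 144 := by gcongr
        _ = R / (36 * N) * E.nrm (dilate N y) := by
            field_simp
            ring
        _ ≤ _ := by
            gcongr
            linarith

end SymmetricSequenceSpace

/-! ### A continuously differentiable function resembling `|t|` at infinitely many scales -/

section sqrtSeries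

variable {s : ℕ → ℝ}

/-- The sum of the functions `2⁻ⁿ (√(t² + sₙ²) - sₙ)`. The `n`-th summand is smooth, but looks like
a multiple of `|t|` for `|t| ≥ sₙ`. -/
noncomputable def sqrtSeries (s : ℕ → ℝ) (t : ℝ) : ℝ :=
  ∑' n, 2⁻¹ ^ n * (√(t ^ 2 + s n ^ 2) - s n)

theorem sqrtSeries_zero (hs : ∀ n, 0 < s n) : sqrtSeries s 0 = 0 := by
  have : ∀ n, √(s n ^ 2) = s n := fun n => Real.sqrt_sq (hs n).le
  simp [sqrtSeries, this]

theorem sqrtSeries_neg (s : ℕ → ℝ) (t : ℝ) : sqrtSeries s (-t) = sqrtSeries s t := by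
  simp [sqrtSeries]

theorem summable_sqrtSeries (hs : ∀ n, 0 < s n) (t : ℝ) :
    Summable fun n => (2⁻¹ : ℝ) ^ n * (√(t ^ 2 + s n ^ 2) - s n) := by
  refine Summable.of_nonneg_of_le (fun n => ?_) (fun n => ?_)
    ((summable_geometric_of_lt_one (r := (2⁻¹ : ℝ)) (by norm_num) (by norm_num)).mul_right |t|)
  · refine mul_nonneg (by positivity) (sub_nonneg.2 (Real.le_sqrt_of_sq_le ?_))
    nlinarith [sq_nonneg t]
  · have h : √(t ^ 2 + s n ^ 2) ≤ |t| + s n := by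
      rw [Real.sqrt_le_left (add_nonneg (abs_nonneg t) (hs n).le), add_sq, sq_abs]
      have := mul_nonneg (abs_nonneg t) (hs n).le
      linarith
    gcongr
    linarith

theorem contDiff_sqrtSeries (hs : ∀ n, 0 < s n) : ContDiff ℝ 1 (sqrtSeries s) := by
  have hpos : ∀ n (t : ℝ), 0 < t ^ 2 + s n ^ 2 := fun n t =>
    add_pos_of_nonneg_of_pos (sq_nonneg t) (pow_pos (hs n) 2)
  have hsum := summable_geometric_of_lt_one (r := (2⁻¹ : ℝ)) (by norm_num) (by norm_num)
  have hbound : ∀ n (t : ℝ), ‖(2⁻¹ : ℝ) ^ n * (t / √(t ^ 2 + s n ^ 2))‖ ≤ 2⁻¹ ^ n := by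
    intro n t
    rw [norm_mul, Real.norm_of_nonneg (by positivity), Real.norm_eq_abs, abs_div,
      abs_of_nonneg (Real.sqrt_nonneg _)]
    refine mul_le_of_le_one_right (by positivity) (div_le_one_of_le₀ ?_ (Real.sqrt_nonneg _))
    refine Real.le_sqrt_of_sq_le ?_
    rw [sq_abs]
    nlinarith [sq_nonneg (s n)]
  have hderiv : ∀ n (t : ℝ), HasDerivAt (fun t : ℝ => (2⁻¹ : ℝ) ^ n * (√(t ^ 2 + s n ^ 2) - s n))
      (2⁻¹ ^ n * (t / √(t ^ 2 + s n ^ 2))) t := by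
    intro n t
    have h1 : HasDerivAt (fun t : ℝ => t ^ 2 + s n ^ 2) (2 * t) t := by
      simpa using (hasDerivAt_pow 2 t).add_const (s n ^ 2)
    convert! ((h1.sqrt (hpos n t).ne').sub_const (s n)).const_mul ((2⁻¹ : ℝ) ^ n) using 1
    rw [mul_div_mul_left _ _ two_ne_zero]
  have hall : ∀ t, HasDerivAt (sqrtSeries s)
      (∑' n, (2⁻¹ : ℝ) ^ n * (t / √(t ^ 2 + s n ^ 2))) t := fun t =>
    hasDerivAt_tsum hsum hderiv hbound (summable_sqrtSeries hs 0) t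
  rw [contDiff_one_iff_deriv]
  refine ⟨fun t => (hall t).differentiableAt, ?_⟩
  rw [funext fun t => (hall t).deriv]
  refine continuous_tsum (fun n => ?_) hsum hbound
  refine continuous_const.mul (continuous_id.div (by fun_prop) fun t => ?_)
  exact (Real.sqrt_pos.2 (hpos n t)).ne'

theorem sqrtSeries_sub_ge (hs : ∀ n, 0 < s n) (n : ℕ) {a b : ℝ} (hb : s n ≤ b) (ha : 3 * b ≤ a) :
    2⁻¹ ^ n / 3 * (a + b) ≤ sqrtSeries s a - sqrtSeries s b := by
  have hb0 : 0 < b := (hs n).trans_le hb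
  have hab : b ^ 2 ≤ a ^ 2 := by nlinarith
  unfold sqrtSeries
  rw [← (summable_sqrtSeries hs a).tsum_sub (summable_sqrtSeries hs b)]
  refine le_trans ?_ (((summable_sqrtSeries hs a).sub (summable_sqrtSeries hs b)).le_tsum n
    fun m _ => ?_)
  · have h1 : √(b ^ 2 + s n ^ 2) ≤ 3 / 2 * b := by
      rw [Real.sqrt_le_left (by positivity)]
      nlinarith [hs n]
    have h2 : √(b ^ 2 + s n ^ 2) + (a + b) / 3 ≤ √(a ^ 2 + s n ^ 2) := by
      refine Real.le_sqrt_of_sq_le ?_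
      have h3 := Real.sq_sqrt (add_nonneg (sq_nonneg b) (sq_nonneg (s n)))
      have h4 := mul_le_mul_of_nonneg_right h1 (by linarith : 0 ≤ (a + b) / 3)
      nlinarith
    have h5 : (0 : ℝ) < 2⁻¹ ^ n := by positivity
    nlinarith
  · rw [← mul_sub]
    refine mul_nonneg (by positivity) ?_
    have : √(b ^ 2 + s m ^ 2) ≤ √(a ^ 2 + s m ^ 2) := Real.sqrt_le_sqrt (by linarith)
    linarith

end sqrtSeries

/-! ### Finite-dimensional blocks -/

section commutator

variable {N r : ℕ} {p q : Fin N × Fin r → Hl2}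

theorem star_tensorOp (p q : Fin N × Fin r → Hl2) (g : Fin N → Fin N → ℝ) (y : Fin r → ℝ) :
    star (tensorOp p q g y) = tensorOp q p (fun i j => g j i) y := by
  rw [ContinuousLinearMap.star_eq_adjoint]
  refine ((ContinuousLinearMap.eq_adjoint_iff _ _).2 fun x z => ?_).symm
  rw [← inner_conj_symm, inner_tensorOp_apply, inner_tensorOp_apply]
  simp only [map_sum]
  refine Finset.sum_congr rfl fun k _ => ?_
  rw [Finset.sum_comm]
  refine Finset.sum_congr rfl fun i _ => Finset.sum_congr rfl fun j _ => ?_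
  rw [map_mul, map_mul, Complex.conj_ofReal, inner_conj_symm, inner_conj_symm]
  ring

theorem tensorOp_smul (p q : Fin N × Fin r → Hl2) (g : Fin N → Fin N → ℝ) (y : Fin r → ℝ)
    (c : ℝ) : tensorOp p q (fun i j => c * g i j) y = (c : ℂ) • tensorOp p q g y := by
  ext1 x
  simp only [smul_apply, tensorOp_apply, Finset.smul_sum, smul_smul]
  refine Finset.sum_congr rfl fun k _ => Finset.sum_congr rfl fun i _ =>
    Finset.sum_congr rfl fun j _ => ?_
  congr 1
  push_cast
  ring

/-- The commutator with an operator diagonalized by `p` and `q` multiplies the entries by the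
differences of the eigenvalues. -/
theorem tensorOp_mul_sub_mul {V : Bl2} (hV : IsSelfAdjoint V) {α β : Fin N → ℝ}
    (hp : ∀ i k, V (p (i, k)) = (α i : ℂ) • p (i, k))
    (hq : ∀ j k, V (q (j, k)) = (β j : ℂ) • q (j, k)) (g : Fin N → Fin N → ℝ) (y : Fin r → ℝ) :
    tensorOp p q g y * V - V * tensorOp p q g y =
      tensorOp p q (fun i j => (β j - α i) * g i j) y := by
  ext1 x
  have h : ∀ j k, ⟪q (j, k), V x⟫ = β j * ⟪q (j, k), x⟫ := fun j k => by
    rw [← ContinuousLinearMap.adjoint_inner_left, ← ContinuousLinearMap.star_eq_adjoint,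
      hV.star_eq, hq, inner_smul_left, Complex.conj_ofReal]
  rw [sub_apply, mul_apply_eq_comp, mul_apply_eq_comp]
  simp only [tensorOp_apply, map_sum, map_smul, hp, h, smul_smul, ← Finset.sum_sub_distrib,
    ← sub_smul]
  refine Finset.sum_congr rfl fun k _ => Finset.sum_congr rfl fun i _ =>
    Finset.sum_congr rfl fun j _ => ?_
  congr 1
  push_cast
  ring

theorem diagOp_one_apply_of_mem {κ : Type*} [Fintype κ] {p : κ → Hl2} (hp : Orthonormal ℂ p)
    {x : Hl2} (hx : x ∈ Submodule.span ℂ (Set.range p)) : diagOp p p (fun _ => 1) x = x := by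
  induction hx using Submodule.span_induction with
  | mem x h =>
    obtain ⟨i, rfl⟩ := h
    rw [diagOp_apply_self hp, one_smul]
  | zero => exact map_zero _
  | add x y _ _ hx hy => rw [map_add, hx, hy]
  | smul c x _ hx => rw [map_smul, hx]

theorem tensorOp_apply_mem_span (p q : Fin N × Fin r → Hl2) (g : Fin N → Fin N → ℝ)
    (y : Fin r → ℝ) (x : Hl2) : tensorOp p q g y x ∈ Submodule.span ℂ (Set.range p) := by
  rw [tensorOp_apply]
  exact Submodule.sum_mem _ fun k _ => Submodule.sum_mem _ fun i _ => Submodule.sum_mem _ fun j _ =>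
    Submodule.smul_mem _ _ (Submodule.subset_span ⟨(i, k), rfl⟩)

theorem tensorOp_mul_diagOp_one (p : Fin N × Fin r → Hl2) (hq : Orthonormal ℂ q)
    (g : Fin N → Fin N → ℝ) (y : Fin r → ℝ) :
    tensorOp p q g y * diagOp q q (fun _ => 1) = tensorOp p q g y := by
  ext1 x
  rw [mul_apply_eq_comp, tensorOp_apply, tensorOp_apply]
  simp only [inner_diagOp_apply hq, one_mul]

/-- The corner of `T - T*` cut out by the two orthogonal families is `T`. -/
theorem diagOp_mul_sub_star_mul_diagOp (hp : Orthonormal ℂ p) (hq : Orthonormal ℂ q)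
    (hpq : ∀ a b, ⟪p a, q b⟫ = 0) (g : Fin N → Fin N → ℝ) (y : Fin r → ℝ) :
    diagOp p p (fun _ => 1) * (tensorOp p q g y - star (tensorOp p q g y)) *
      diagOp q q (fun _ => 1) = tensorOp p q g y := by
  have h1 : diagOp p p (fun _ => 1) * tensorOp p q g y = tensorOp p q g y := by
    ext1 x
    exact diagOp_one_apply_of_mem hp (tensorOp_apply_mem_span p q g y x)
  have h2 : diagOp p p (fun _ => 1) * star (tensorOp p q g y) = 0 := by
    ext1 x
    rw [star_tensorOp, mul_apply_eq_comp, diagOp_apply]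
    simp [inner_tensorOp_apply, hpq]
  rw [mul_sub, h1, h2, sub_zero, tensorOp_mul_diagOp_one p hq]

end commutator

namespace SymmetricSequenceSpace

variable {E : SymmetricSequenceSpace}

/-- The index set of a block: two copies of `Fin N × Fin r`. -/
abbrev BlockIndex (N r : ℕ) : Type := (Fin N × Fin r) ⊕ (Fin N × Fin r)

/-- For every `n` there are eigenvalues `lam` and self-adjoint operators `X` on the corresponding
finite-dimensional space such that the commutator of `X` with the diagonal operator `lam` is small,
but the commutator of `X` with `f (lam)` is large for each even function `f` whose increments
`f a - f b`, for `a ≥ 3 b` and `b ≥ s`, are at least `2⁻ⁿ (a + b) / 3`. -/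
theorem exists_block (hsep : E.IsSeparable) (hE : E.HasTrivialBoydIndex) (n : ℕ) :
    ∃ (N r : ℕ) (lam : BlockIndex N r → ℝ) (s : ℝ) (X : (BlockIndex N r → Hl2) → Bl2),
      0 < N ∧ 0 < r ∧ 0 < s ∧ ∀ e : BlockIndex N r → Hl2, Orthonormal ℂ e →
        IsSelfAdjoint (X e) ∧ (∀ x, X e x ∈ Submodule.span ℂ (Set.range e)) ∧
        E.idealNorm (diagOp e e fun a => (lam a : ℂ)) ≤ 8⁻¹ ^ n ∧
        (∀ W : Bl2, IsSelfAdjoint W → (∀ a, W (e a) = (lam a : ℂ) • e a) →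
          E.idealNorm (X e * W - W * X e) ≤ 8⁻¹ ^ n) ∧
        ∀ f : ℝ → ℝ, (∀ t, f (-t) = f t) →
          (∀ a b, s ≤ b → 3 * b ≤ a → 2⁻¹ ^ n / 3 * (a + b) ≤ f a - f b) →
          ∀ V : Bl2, IsSelfAdjoint V → (∀ a, V (e a) = (f (lam a) : ℂ) • e a) →
            n ≤ E.idealNorm (X e * V - V * X e) := by
  -- `C` is chosen so that the final lower bound `2⁻ⁿ / 3 * C * (8⁻ⁿ / 4) / 144` equals `n`
  obtain ⟨N, hN, hC⟩ := exists_le_sum_abs_inv_sub ((n : ℝ) * 144 * 4 * 3 * (2 ^ n * 8 ^ n))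
  have hN0 : 0 < N := by omega
  have hN' : (0 : ℝ) < N := by exact_mod_cast hN0
  obtain ⟨g, r, y, ν, hr, hν, hg⟩ := exists_tensorOp_of_trivial hsep hE hN
  have hs0 := E.nrm_single_pos
  set M : ℝ := ((Fintype.card (BlockIndex N r) : ℕ) + 1) * E.nrm (Pi.single 0 1) * 3 ^ N with hM
  have hMpos : 0 < M := by positivity
  -- the scale `τ` makes the diagonal operator small, the factor `c` the commutator with it
  obtain ⟨τ, hτ, hτM⟩ : ∃ τ > 0, M * τ = 8⁻¹ ^ n :=
    ⟨8⁻¹ ^ n / M, by positivity, mul_div_cancel₀ _ hMpos.ne'⟩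
  obtain ⟨c, hc, hcν⟩ : ∃ c > 0, 4 * (c * ν) = 8⁻¹ ^ n :=
    ⟨8⁻¹ ^ n / (4 * ν), by positivity, by field_simp⟩
  set a : Fin N → ℝ := fun i => τ * 3 ^ (i : ℕ) with ha
  have ha0 : ∀ i, 0 < a i := fun i => by positivity
  have haτ : ∀ i, τ ≤ a i := fun i => le_mul_of_one_le_right hτ.le (one_le_pow₀ (by norm_num))
  have ha3 : ∀ i j, j < i → 3 * a j ≤ a i := fun i j hij => by
    have : (3 : ℝ) ^ ((j : ℕ) + 1) ≤ 3 ^ (i : ℕ) := pow_le_pow_right₀ (by norm_num) hij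
    rw [pow_succ] at this
    simp only [ha]
    nlinarith
  set lam : BlockIndex N r → ℝ := Sum.elim (fun b => a b.1) (fun b => -a b.1) with hlam
  set z : Fin N → Fin N → ℝ := fun i j => (a i + a j)⁻¹ * (c * g i j) with hz
  set A : (BlockIndex N r → Hl2) → Bl2 := fun e => tensorOp (e ∘ Sum.inl) (e ∘ Sum.inr) z y with hA
  refine ⟨N, r, lam, τ, fun e => A e + star (A e), hN0, hr, hτ, fun e he => ?_⟩
  have hp : Orthonormal ℂ (e ∘ Sum.inl) := he.comp _ Sum.inl_injective
  have hq : Orthonormal ℂ (e ∘ Sum.inr) := he.comp _ Sum.inr_injective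
  have hpq : ∀ b b', ⟪(e ∘ Sum.inl) b, (e ∘ Sum.inr) b'⟫ = 0 := fun b b' =>
    he.2 (by simp)
  obtain ⟨hg1, hg2⟩ := hg _ _ hp hq
  -- the commutator with an operator acting as `f (lam)`
  have hcomm : ∀ (V : Bl2) (f : ℝ → ℝ), IsSelfAdjoint V →
      (∀ b, V (e b) = (f (lam b) : ℂ) • e b) →
      (A e + star (A e)) * V - V * (A e + star (A e)) =
        tensorOp (e ∘ Sum.inl) (e ∘ Sum.inr) (fun i j => (f (-a j) - f (a i)) * z i j) y -
        star (tensorOp (e ∘ Sum.inl) (e ∘ Sum.inr)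
          (fun i j => (f (-a j) - f (a i)) * z i j) y) := by
    intro V f hV h
    rw [← tensorOp_mul_sub_mul hV (fun i k => h (Sum.inl (i, k))) fun j k => h (Sum.inr (j, k)),
      star_sub, star_mul, star_mul, hV.star_eq]
    simp only [hA]
    noncomm_ring
  refine ⟨?_, fun x => ?_, ?_, fun W hW h => ?_, fun f hf hfs V hV h => ?_⟩
  · rw [IsSelfAdjoint, star_add, star_star, add_comm]
  · rw [add_apply, star_tensorOp]
    refine Submodule.add_mem _
      (Submodule.span_mono (Set.range_comp_subset_range _ _) (tensorOp_apply_mem_span _ _ _ _ x))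
      (Submodule.span_mono (Set.range_comp_subset_range _ _) (tensorOp_apply_mem_span _ _ _ _ x))
  · have hrank := rank_le_of_forall_mem_span (F := diagOp e e fun b => (lam b : ℂ)) Finset.univ e
      fun x => by
        rw [diagOp_apply]
        exact Submodule.sum_mem _ fun i _ =>
          Submodule.smul_mem _ _ (Submodule.subset_span ⟨i, by simp, rfl⟩)
    refine (idealNorm_le_of_rank_le hrank).trans ?_
    have h3 : ‖diagOp e e fun b => (lam b : ℂ)‖ ≤ τ * 3 ^ N := by
      refine norm_diagOp_le he he (by positivity) fun b => ?_
      have h4 : ∀ i : Fin N, |a i| ≤ τ * 3 ^ N := fun i => by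
        rw [abs_of_pos (ha0 i)]
        exact mul_le_mul_of_nonneg_left (pow_le_pow_right₀ (by norm_num) i.2.le) hτ.le
      rw [Complex.norm_real, Real.norm_eq_abs]
      rcases b with b | b
      · exact h4 b.1
      · simpa [hlam] using h4 b.1
    rw [← hτM, hM, Finset.card_univ]
    calc _ ≤ ((Fintype.card (BlockIndex N r) : ℕ) + 1) * E.nrm (Pi.single 0 1) * (τ * 3 ^ N) := by
          gcongr
      _ = _ := by ring
  · rw [hcomm W id hW h]
    have h1 : tensorOp (e ∘ Sum.inl) (e ∘ Sum.inr) (fun i j => (id (-a j) - id (a i)) * z i j) y =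
        ((-c : ℝ) : ℂ) • tensorOp (e ∘ Sum.inl) (e ∘ Sum.inr) g y := by
      rw [← tensorOp_smul]
      congr 1
      funext i j
      have := ha0 i
      have := ha0 j
      simp only [hz, id]
      field_simp
      ring
    have h2 := tensorOp_mem_ideal hsep (e ∘ Sum.inl) (e ∘ Sum.inr) g y
    have h3 := smul_mem_ideal hsep ((-c : ℝ) : ℂ) h2
    rw [h1]
    refine (idealNorm_sub_le hsep h3 (star_mem_ideal hsep h3)).trans ?_
    have h4 := idealNorm_smul_le ((-c : ℝ) : ℂ) h2
    rw [Complex.norm_real, norm_neg, Real.norm_of_nonneg hc.le] at h4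
    rw [idealNorm_star, ← hcν]
    nlinarith
  · set m : Fin N → Fin N → ℝ := fun i j => (f (a i) - f (a j)) / (a i + a j) with hm
    set T := tensorOp (e ∘ Sum.inl) (e ∘ Sum.inr) (fun i j => m i j * g i j) y with hT
    have hTE : T ∈ E.ideal := tensorOp_mem_ideal hsep _ _ _ _
    have h1 : tensorOp (e ∘ Sum.inl) (e ∘ Sum.inr) (fun i j => (f (-a j) - f (a i)) * z i j) y =
        ((-c : ℝ) : ℂ) • T := by
      rw [hT, ← tensorOp_smul]
      congr 1
      funext i j
      have := ha0 i
      have := ha0 j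
      simp only [hz, hm, hf]
      field_simp
      ring
    have h2 := hcomm V f hV h
    have h3 : ∀ i j, 2⁻¹ ^ n / 3 * |hilbertMatrix N i j| ≤ hilbertMatrix N i j * m i j := by
      have h4 : ∀ i j, j < i → 2⁻¹ ^ n / 3 ≤ m i j := fun i j hij => by
        rw [hm, le_div_iff₀ (add_pos (ha0 i) (ha0 j))]
        exact hfs _ _ (haτ j) (ha3 i j hij)
      intro i j
      rcases lt_trichotomy i j with hij | rfl | hij
      · have h5 : hilbertMatrix N i j < 0 := by
          rw [hilbertMatrix, inv_lt_zero, sub_neg]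
          exact_mod_cast hij
        have h6 : m i j = -m j i := by
          simp only [hm]
          rw [add_comm (a i), ← neg_div, neg_sub]
        rw [h6, abs_of_neg h5]
        nlinarith [h4 j i hij]
      · simp [hilbertMatrix]
      · have h5 : 0 < hilbertMatrix N i j := by
          rw [hilbertMatrix, inv_pos, sub_pos]
          exact_mod_cast hij
        rw [abs_of_pos h5]
        nlinarith [h4 i j hij]
    have h4 : 2⁻¹ ^ n / 3 * ((n : ℝ) * 144 * 4 * 3 * (2 ^ n * 8 ^ n) * N) ≤
        ∑ i, ∑ j, hilbertMatrix N i j * m i j := by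
      calc _ ≤ 2⁻¹ ^ n / 3 * ∑ i, ∑ j, |hilbertMatrix N i j| := by
            gcongr
            exact hC
        _ ≤ _ := by
            simp only [Finset.mul_sum]
            exact Finset.sum_le_sum fun i _ => Finset.sum_le_sum fun j _ => h3 i j
    have h5 := hg2 m (le_trans (by positivity) h4)
    have h6 : (n : ℝ) * 8 ^ n * 4 * ν ≤ E.idealNorm T := by
      refine le_trans ?_ h5
      calc _ = 2⁻¹ ^ n / 3 * ((n : ℝ) * 144 * 4 * 3 * (2 ^ n * 8 ^ n) * N) / N * ν / 144 := by
            rw [inv_pow]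
            field_simp
        _ ≤ _ := by gcongr
    have h7 : E.idealNorm (((-c : ℝ) : ℂ) • T) ≤
        E.idealNorm ((A e + star (A e)) * V - V * (A e + star (A e))) := by
      rw [h2, ← h1]
      conv_lhs => rw [← diagOp_mul_sub_star_mul_diagOp hp hq hpq]
      refine idealNorm_mul_mul_le hsep (norm_diagOp_le hp hp zero_le_one (by simp))
        (norm_diagOp_le hq hq zero_le_one (by simp)) ?_
      have h8 := tensorOp_mem_ideal hsep (e ∘ Sum.inl) (e ∘ Sum.inr)
        (fun i j => (f (-a j) - f (a i)) * z i j) y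
      exact sub_mem_ideal hsep h8 (star_mem_ideal hsep h8)
    refine le_trans ?_ h7
    have h9 := idealNorm_smul_le ((-c⁻¹ : ℝ) : ℂ) (smul_mem_ideal hsep ((-c : ℝ) : ℂ) hTE)
    rw [smul_smul, ← Complex.ofReal_mul, neg_mul_neg, inv_mul_cancel₀ hc.ne', Complex.ofReal_one,
      one_smul, Complex.norm_real, norm_neg, Real.norm_of_nonneg (by positivity)] at h9
    have h10 : c * E.idealNorm T ≤ E.idealNorm (((-c : ℝ) : ℂ) • T) := by
      calc _ ≤ c * (c⁻¹ * E.idealNorm (((-c : ℝ) : ℂ) • T)) := by gcongr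
        _ = _ := by rw [← mul_assoc, mul_inv_cancel₀ hc.ne', one_mul]
    refine le_trans ?_ h10
    calc (n : ℝ) = n * 8 ^ n * (8⁻¹ ^ n) := by
          rw [inv_pow, mul_assoc, mul_inv_cancel₀ (by positivity), mul_one]
      _ = c * ((n : ℝ) * 8 ^ n * 4 * ν) := by
          rw [← hcν]
          ring
      _ ≤ _ := by gcongr

end SymmetricSequenceSpace

/-! ### Functional calculus on eigenvectors -/

section funCalc

variable {W : Bl2} {ξ : Hl2} {f : ℝ → ℝ}

theorem mem_spectrum_of_apply_eq_smul {c : ℂ} (hξ0 : ξ ≠ 0) (hξ : W ξ = c • ξ) :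
    c ∈ spectrum ℂ W := by
  rw [spectrum.mem_iff]
  rintro ⟨u, hu⟩
  apply hξ0
  have h1 : (u : Bl2) ξ = 0 := by
    rw [hu, sub_apply, hξ, Algebra.algebraMap_eq_smul_one, smul_apply, one_apply_eq_self, sub_self]
  calc ξ = ((↑u⁻¹ : Bl2) * (u : Bl2)) ξ := by rw [Units.inv_mul, one_apply_eq_self]
    _ = 0 := by rw [mul_apply_eq_comp, h1, map_zero]

theorem continuousOn_funCalc (hf : Continuous f) (s : Set ℂ) :
    ContinuousOn (fun z : ℂ => (f z.re : ℂ)) s :=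
  (Complex.continuous_ofReal.comp (hf.comp Complex.continuous_re)).continuousOn

theorem funCalc_apply_eigenvector (hW : IsSelfAdjoint W) (hf : Continuous f) {c : ℝ}
    (hξ : W ξ = (c : ℂ) • ξ) : funCalc f W ξ = (f c : ℂ) • ξ := by
  rcases eq_or_ne ξ 0 with rfl | hξ0
  · simp
  have hc := mem_spectrum_of_apply_eq_smul hξ0 hξ
  have key : ∀ g : C(spectrum ℂ W, ℂ), cfcHom hW.isStarNormal g ξ = g ⟨c, hc⟩ • ξ := by
    intro g
    induction g using ContinuousMap.induction_on_of_compact with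
    | const z =>
      have : ContinuousMap.const (spectrum ℂ W) z = algebraMap ℂ C(spectrum ℂ W, ℂ) z := rfl
      rw [this, AlgHomClass.commutes, Algebra.algebraMap_eq_smul_one, smul_apply,
        one_apply_eq_self]
      simp
    | id =>
      rw [cfcHom_id]
      exact hξ
    | star_id =>
      rw [map_star, cfcHom_id, hW.star_eq, hξ]
      simp
    | add g₁ g₂ h₁ h₂ => rw [map_add, add_apply, h₁, h₂, ContinuousMap.add_apply, add_smul]
    | mul g₁ g₂ h₁ h₂ =>
      rw [map_mul, mul_apply_eq_comp, h₂, map_smul, h₁, smul_smul, ContinuousMap.mul_apply,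
        mul_comm]
    | frequently g h =>
      have hclosed : IsClosed {g : C(spectrum ℂ W, ℂ) |
          cfcHom hW.isStarNormal g ξ = g ⟨c, hc⟩ • ξ} := by
        refine isClosed_eq ?_ (by fun_prop)
        exact (ContinuousLinearMap.apply ℂ Hl2 ξ).continuous.comp (cfcHom_continuous _)
      exact hclosed.closure_subset (mem_closure_iff_frequently.2 h)
  rw [funCalc, cfc_apply _ W hW.isStarNormal (continuousOn_funCalc hf _), key]
  rfl

theorem isSelfAdjoint_funCalc (f : ℝ → ℝ) (W : Bl2) : IsSelfAdjoint (funCalc f W) := by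
  rw [IsSelfAdjoint, funCalc, ← cfc_star]
  congr 1
  funext z
  exact Complex.conj_ofReal _

/-- If `f` is continuously differentiable and `f 0 = 0`, then `f(W)` is a multiple of `W`. -/
theorem funCalc_eq_mul (hW : IsSelfAdjoint W) (hf : ContDiff ℝ 1 f) (h0 : f 0 = 0) :
    funCalc f W = W * funCalc (dslope f 0) W := by
  have hcont : Continuous (dslope f 0) := by
    rw [← continuousOn_univ, continuousOn_dslope Filter.univ_mem]
    exact ⟨hf.continuous.continuousOn, (hf.differentiable one_ne_zero).differentiableAt⟩
  have hfun : ∀ t, f t = t * dslope f 0 t := fun t => by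
    have := sub_smul_dslope f 0 t
    rw [h0, sub_zero, sub_zero, smul_eq_mul] at this
    exact this.symm
  have hWn := hW.isStarNormal
  calc funCalc f W = cfc (fun z : ℂ => z * ((dslope f 0 z.re : ℝ) : ℂ)) W := by
        refine cfc_congr fun z hz => ?_
        rw [hfun z.re, Complex.ofReal_mul, ← hW.mem_spectrum_eq_re hz]
    _ = _ := by
        rw [cfc_mul (fun z : ℂ => z) (fun z : ℂ => ((dslope f 0 z.re : ℝ) : ℂ)) W continuousOn_id
          (continuousOn_funCalc hcont _), funCalc]
        congr 1
        exact cfc_id' ℂ W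

end funCalc

/-! ### Orthogonal sums of blocks -/

section blocks

variable {β : ℕ → Type} {e : (Σ n, β n) → Hl2}

theorem inner_eq_zero_of_mem_span (he : Orthonormal ℂ e) {m n : ℕ} (hmn : m ≠ n) {x y : Hl2}
    (hx : x ∈ Submodule.span ℂ (Set.range fun a => e ⟨m, a⟩))
    (hy : y ∈ Submodule.span ℂ (Set.range fun a => e ⟨n, a⟩)) : ⟪x, y⟫ = 0 := by
  have : Submodule.span ℂ (Set.range fun a => e ⟨m, a⟩) ⟂
      Submodule.span ℂ (Set.range fun a => e ⟨n, a⟩) := by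
    rw [Submodule.isOrtho_span]
    rintro _ ⟨a, rfl⟩ _ ⟨b, rfl⟩
    exact he.2 fun h => hmn (congrArg Sigma.fst h)
  exact (Submodule.isOrtho_iff_inner_eq.1 this) x hx y hy

theorem apply_mem_span_of_eigen {ι : Type*} {e : ι → Hl2} {T : Bl2} {c : ι → ℂ}
    (h : ∀ a, T (e a) = c a • e a) {x : Hl2} (hx : x ∈ Submodule.span ℂ (Set.range e)) :
    T x ∈ Submodule.span ℂ (Set.range e) := by
  induction hx using Submodule.span_induction with
  | mem x hx =>
    obtain ⟨a, rfl⟩ := hx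
    rw [h]
    exact Submodule.smul_mem _ _ (Submodule.subset_span ⟨a, rfl⟩)
  | zero => simp
  | add x y _ _ hx hy =>
    rw [map_add]
    exact Submodule.add_mem _ hx hy
  | smul c x _ hx =>
    rw [map_smul]
    exact Submodule.smul_mem _ _ hx

/-- The spectral theorem for a self-adjoint operator with range in a finite-dimensional space. -/
theorem exists_eigenbasis {ι : Type*} [Fintype ι] {e : ι → Hl2} (he : Orthonormal ℂ e) {X : Bl2}
    (hX : IsSelfAdjoint X) (hXe : ∀ ξ, X ξ ∈ Submodule.span ℂ (Set.range e)) :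
    ∃ (u : ι → Hl2) (x : ι → ℝ), Orthonormal ℂ u ∧ (∀ i, X (u i) = (x i : ℂ) • u i) ∧
      Submodule.span ℂ (Set.range u) = Submodule.span ℂ (Set.range e) := by
  set S := Submodule.span ℂ (Set.range e) with hS
  have : FiniteDimensional ℂ S := FiniteDimensional.span_of_finite ℂ (Set.finite_range e)
  have hfin : Module.finrank ℂ S = Fintype.card ι :=
    finrank_span_eq_card he.linearIndependent
  have hsymm : ((X : Hl2 →ₗ[ℂ] Hl2).restrict (p := S) (q := S) fun ξ _ => hXe ξ).IsSymmetric := by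
    intro ξ η
    simp only [Submodule.coe_inner, LinearMap.restrict_apply, ContinuousLinearMap.coe_coe]
    rw [← ContinuousLinearMap.adjoint_inner_right, ← ContinuousLinearMap.star_eq_adjoint,
      hX.star_eq]
  set b := (hsymm.eigenvectorBasis hfin).reindex (Fintype.equivFin ι).symm with hb
  refine ⟨fun i => (b i : Hl2), fun i => hsymm.eigenvalues hfin (Fintype.equivFin ι i),
    b.orthonormal.comp_linearIsometry S.subtypeₗᵢ, fun i => ?_, ?_⟩
  · have := hsymm.apply_eigenvectorBasis hfin (Fintype.equivFin ι i)
    have h2 := congrArg (Subtype.val) this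
    simp only [hb, OrthonormalBasis.reindex_apply, Equiv.symm_symm]
    exact h2
  · have h1 : Set.range (fun i => (b i : Hl2)) = S.subtype '' Set.range b := by
      rw [← Set.range_comp]
      rfl
    have h2 : Submodule.span ℂ (Set.range b) = ⊤ := by
      have := b.toBasis.span_eq
      rwa [b.coe_toBasis] at this
    rw [h1, Submodule.span_image, h2, Submodule.map_top, Submodule.range_subtype]

theorem exists_hilbertBasis_of_countable {ι : Type*} [Countable ι] [Infinite ι] :
    Nonempty (HilbertBasis ι ℂ Hl2) := by
  obtain ⟨φ⟩ := nonempty_equiv_of_countable (α := ι) (β := ℕ)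
  let b : HilbertBasis ℕ ℂ Hl2 := HilbertBasis.ofRepr (LinearIsometryEquiv.refl ℂ Hl2)
  refine ⟨HilbertBasis.mk (b.orthonormal.comp φ φ.injective) ?_⟩
  rw [φ.surjective.range_comp, b.dense_span]

theorem tsum_apply_of_eq_zero {T : ℕ → Bl2} (hT : Summable fun n => ‖T n‖) {ξ : Hl2} (n : ℕ)
    (h : ∀ m, m ≠ n → T m ξ = 0) : (∑' m, T m) ξ = T n ξ := by
  have h1 := (ContinuousLinearMap.apply ℂ Hl2 ξ).hasSum hT.of_norm.hasSum
  exact h1.unique (hasSum_single n h)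

theorem inner_commutator {ι : Type*} {v : ι → Hl2} {X : Bl2} (hX : IsSelfAdjoint X) {c : ι → ℝ}
    (h : ∀ i, X (v i) = (c i : ℂ) • v i) (T : Bl2) (i j : ι) :
    ⟪v i, (X * T - T * X) (v j)⟫ = ((c i - c j : ℝ) : ℂ) * ⟪v i, T (v j)⟫ := by
  rw [sub_apply, mul_apply_eq_comp, mul_apply_eq_comp, inner_sub_right, h j, map_smul,
    inner_smul_right, ← ContinuousLinearMap.adjoint_inner_left,
    ← ContinuousLinearMap.star_eq_adjoint, hX.star_eq, h i, inner_smul_left, Complex.conj_ofReal]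
  push_cast
  ring

end blocks

/-! ### The counterexample -/

section global

variable {β : ℕ → Type} {e : HilbertBasis (Σ n, β n) ℂ Hl2}

theorem orthonormal_block (e : HilbertBasis (Σ n, β n) ℂ Hl2) (n : ℕ) :
    Orthonormal ℂ fun a => e ⟨n, a⟩ :=
  e.orthonormal.comp _ sigma_mk_injective

variable {v : HilbertBasis (Σ n, β n) ℂ Hl2}

theorem inner_eq_zero_of_block_eigen
    (hv : ∀ i, v i ∈ Submodule.span ℂ (Set.range fun a => e ⟨i.1, a⟩)) {T : Bl2}
    {μ : ∀ n, β n → ℂ} (hT : ∀ n a, T (e ⟨n, a⟩) = μ n a • e ⟨n, a⟩) {i j : Σ n, β n}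
    (hij : i.1 ≠ j.1) : ⟪v i, T (v j)⟫ = 0 :=
  inner_eq_zero_of_mem_span e.orthonormal hij (hv i) (apply_mem_span_of_eigen (hT j.1) (hv j))

variable {x : (Σ n, β n) → ℝ} {X : ℕ → Bl2}

/-- The commutator of `T` with `X` is the sum of its commutators with the blocks of `X`. -/
theorem isFormalCommutator_tsum {T : Bl2} (hX : ∀ n, IsSelfAdjoint (X n))
    (hXv : ∀ n i, X n (v i) = ((if i.1 = n then x i else 0 : ℝ) : ℂ) • v i)
    (hT : ∀ i j, i.1 ≠ j.1 → ⟪v i, T (v j)⟫ = 0)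
    (hsum : Summable fun n => ‖Complex.I • (X n * T - T * X n)‖) :
    IsFormalCommutator v x T (∑' n, Complex.I • (X n * T - T * X n)) := by
  intro i j
  have h1 := (innerSL ℂ (v i)).hasSum
    ((ContinuousLinearMap.apply ℂ Hl2 (v j)).hasSum hsum.of_norm.hasSum)
  simp only [innerSL_apply_apply, ContinuousLinearMap.apply_apply] at h1
  have h2 : ∀ n, ⟪v i, (Complex.I • (X n * T - T * X n)) (v j)⟫ = Complex.I *
      ((((if i.1 = n then x i else 0) - (if j.1 = n then x j else 0) : ℝ) : ℂ) *
        ⟪v i, T (v j)⟫) := fun n => by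
    rw [smul_apply, inner_smul_right, inner_commutator (hX n) (hXv n)]
  simp only [h2] at h1
  by_cases hij : i.1 = j.1
  · rw [h1.unique (hasSum_single i.1 fun n hn => ?_), if_pos rfl, if_pos hij.symm, mul_assoc]
    rw [if_neg hn.symm, if_neg (hij ▸ hn.symm)]
    simp
  · simp only [hT i j hij, mul_zero] at h1 ⊢
    exact h1.unique hasSum_zero

variable [∀ n, Fintype (β n)]

theorem isSelfAdjoint_tsum_diagOp (e : HilbertBasis (Σ n, β n) ℂ Hl2) (lam : ∀ n, β n → ℝ) :
    IsSelfAdjoint (∑' n,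
      diagOp (fun a => e ⟨n, a⟩) (fun a => e ⟨n, a⟩) fun a => (lam n a : ℂ)) := by
  rw [IsSelfAdjoint, tsum_star]
  refine tsum_congr fun n => ?_
  rw [diagOp, star_sum]
  refine Finset.sum_congr rfl fun a _ => ?_
  rw [star_smul, ContinuousLinearMap.star_eq_adjoint, InnerProductSpace.adjoint_rankOne]
  congr 1
  exact Complex.conj_ofReal _

theorem tsum_diagOp_apply_basis (e : HilbertBasis (Σ n, β n) ℂ Hl2) (lam : ∀ n, β n → ℝ)
    (h : Summable fun n =>
      ‖diagOp (fun a => e ⟨n, a⟩) (fun a => e ⟨n, a⟩) fun a => (lam n a : ℂ)‖) (n : ℕ) (a : β n) :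
    (∑' n, diagOp (fun a => e ⟨n, a⟩) (fun a => e ⟨n, a⟩) fun a => (lam n a : ℂ)) (e ⟨n, a⟩) =
      (lam n a : ℂ) • e ⟨n, a⟩ := by
  rw [tsum_apply_of_eq_zero h n fun m hm => ?_]
  · exact diagOp_apply_self (orthonormal_block e n) _ a
  · rw [diagOp_apply]
    refine Finset.sum_eq_zero fun b _ => ?_
    rw [e.orthonormal.2 fun h => hm (congrArg Sigma.fst h), mul_zero, zero_smul]

/-- Diagonalization of an orthogonal sum of self-adjoint operators on finite blocks. -/
theorem exists_hilbertBasis_eigenvectors (e : HilbertBasis (Σ n, β n) ℂ Hl2) {X : ℕ → Bl2}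
    (hX : ∀ n, IsSelfAdjoint (X n))
    (hXe : ∀ n ξ, X n ξ ∈ Submodule.span ℂ (Set.range fun a => e ⟨n, a⟩)) :
    ∃ (v : HilbertBasis (Σ n, β n) ℂ Hl2) (x : (Σ n, β n) → ℝ),
      (∀ i, v i ∈ Submodule.span ℂ (Set.range fun a => e ⟨i.1, a⟩)) ∧
      ∀ n i, X n (v i) = ((if i.1 = n then x i else 0 : ℝ) : ℂ) • v i := by
  choose u x hu hXu hspan using fun n => exists_eigenbasis (orthonormal_block e n) (hX n) (hXe n)
  have hmem : ∀ i : Σ n, β n, u i.1 i.2 ∈ Submodule.span ℂ (Set.range fun a => e ⟨i.1, a⟩) :=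
    fun i => hspan i.1 ▸ Submodule.subset_span ⟨i.2, rfl⟩
  have hort : Orthonormal ℂ fun i : Σ n, β n => u i.1 i.2 := by
    refine ⟨fun i => (hu i.1).1 i.2, ?_⟩
    rintro ⟨m, a⟩ ⟨n, b⟩ hne
    rcases eq_or_ne m n with rfl | hmn
    · exact (hu m).2 fun h : a = b => hne (by rw [h])
    · exact inner_eq_zero_of_mem_span e.orthonormal hmn (hmem ⟨m, a⟩) (hmem ⟨n, b⟩)
  have hdense : ⊤ ≤ (Submodule.span ℂ (Set.range fun i : Σ n, β n =>
      u i.1 i.2)).topologicalClosure := by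
    rw [← e.dense_span]
    refine Submodule.topologicalClosure_mono (Submodule.span_le.2 ?_)
    rintro _ ⟨⟨n, a⟩, rfl⟩
    have h1 : e ⟨n, a⟩ ∈ Submodule.span ℂ (Set.range (u n)) :=
      hspan n ▸ Submodule.subset_span ⟨a, rfl⟩
    refine Submodule.span_mono ?_ h1
    rintro _ ⟨b, rfl⟩
    exact ⟨⟨n, b⟩, rfl⟩
  refine ⟨HilbertBasis.mk hort hdense, fun i => x i.1 i.2, fun i => ?_, fun n i => ?_⟩
  · rw [HilbertBasis.coe_mk]
    exact hmem i
  · rw [HilbertBasis.coe_mk]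
    rcases eq_or_ne i.1 n with rfl | hin
    · rw [if_pos rfl]
      exact hXu i.1 i.2
    · rw [if_neg hin, Complex.ofReal_zero, zero_smul]
      refine e.ext_inner fun j => ?_
      rw [inner_zero_right, ← ContinuousLinearMap.adjoint_inner_left,
        ← ContinuousLinearMap.star_eq_adjoint, (hX n).star_eq]
      exact inner_eq_zero_of_mem_span e.orthonormal (Ne.symm hin) (hXe n _) (hmem i)

/-- A commutator of `T` with `X` dominates the commutator of `T` with any of the blocks of `X`. -/
theorem idealNorm_commutator_le {E : SymmetricSequenceSpace} (hsep : E.IsSeparable) {T D : Bl2}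
    (hX : ∀ n, IsSelfAdjoint (X n))
    (hXv : ∀ n i, X n (v i) = ((if i.1 = n then x i else 0 : ℝ) : ℂ) • v i)
    (hT : ∀ i j, i.1 ≠ j.1 → ⟪v i, T (v j)⟫ = 0) (hD : D ∈ E.ideal)
    (h : IsFormalCommutator v x T D) (n : ℕ) :
    E.idealNorm (X n * T - T * X n) ≤ E.idealNorm D := by
  classical
  set F : Finset (Σ n, β n) := Finset.univ.map ⟨Sigma.mk n, sigma_mk_injective⟩ with hF
  have hmem : ∀ i : Σ n, β n, i ∈ F ↔ i.1 = n := by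
    rintro ⟨m, a⟩
    simp only [hF, Finset.mem_map, Finset.mem_univ, true_and, Function.Embedding.coeFn_mk]
    constructor
    · rintro ⟨b, hb⟩
      exact (congrArg Sigma.fst hb).symm
    · rintro rfl
      exact ⟨a, rfl⟩
  have heq : X n * T - T * X n = (-Complex.I) • compress v F D := by
    refine v.ext_entries fun i j => ?_
    rw [inner_commutator (hX n) (hXv n), smul_apply, inner_smul_right, inner_compress]
    simp only [hmem]
    have hI : ∀ z : ℂ, -Complex.I * (Complex.I * z) = z := fun z => by
      rw [← mul_assoc, neg_mul, Complex.I_mul_I, neg_neg, one_mul]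
    by_cases hij : i.1 = j.1
    · by_cases hi : i.1 = n
      · rw [if_pos hi, if_pos (hij ▸ hi), if_pos ⟨hi, hij ▸ hi⟩, h i j, mul_assoc, hI]
      · rw [if_neg hi, if_neg (hij ▸ hi), if_neg fun h' => hi h'.1]
        simp
    · have h' : ¬(i.1 = n ∧ j.1 = n) := fun h' => hij (h'.1.trans h'.2.symm)
      rw [hT i j hij, if_neg h']
      simp
  have hP := norm_basisProj_le (v := v) F
  have hPD : compress v F D ∈ E.ideal :=
    SymmetricSequenceSpace.mul_mem_ideal_right hsep _
      (SymmetricSequenceSpace.mul_mem_ideal_left hsep _ hD)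
  rw [heq]
  calc _ ≤ ‖-Complex.I‖ * E.idealNorm (compress v F D) :=
        SymmetricSequenceSpace.idealNorm_smul_le _ hPD
    _ = E.idealNorm (compress v F D) := by simp
    _ ≤ _ := SymmetricSequenceSpace.idealNorm_mul_mul_le hsep hP hP hD

end global

theorem corollary5p1 (E : SymmetricSequenceSpace) (hsep : E.IsSeparable)
    (hBoyd : E.HasTrivialBoydIndex) :
    ∃ f : ℝ → ℝ, ContDiff ℝ 1 f ∧ f 0 = 0 ∧
    ∃ W : Bl2, IsSelfAdjoint W ∧ W ∈ E.ideal ∧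
    ∃ (X : Hl2 →ₗ.[ℂ] Hl2) (U : ℝ → Bl2) (δ : Bl2 →ₗ.[ℂ] Bl2),
      IsSelfAdjoint X ∧ IsUnitaryGroupOf X U ∧
      E.IsC0Flow U ∧ E.IsGeneratorOnIdeal U δ ∧ E.IsClosedSymmetricDerivation δ ∧
      W ∈ δ.domain ∧ funCalc f W ∈ E.ideal ∧ funCalc f W ∉ δ.domain := by
  choose N r lam s X hN hr hs hblock using fun n =>
    SymmetricSequenceSpace.exists_block hsep hBoyd n
  have hne : ∀ n, Nonempty (SymmetricSequenceSpace.BlockIndex (N n) (r n)) := fun n =>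
    ⟨Sum.inl (⟨0, hN n⟩, ⟨0, hr n⟩)⟩
  obtain ⟨e⟩ := exists_hilbertBasis_of_countable
    (ι := Σ n, SymmetricSequenceSpace.BlockIndex (N n) (r n))
  have he := orthonormal_block e
  choose hXsa hXspan hWnorm hcomm hlarge using fun n => hblock n _ (he n)
  set W : Bl2 := ∑' n, diagOp (fun a => e ⟨n, a⟩) (fun a => e ⟨n, a⟩) fun a => (lam n a : ℂ)
    with hW
  obtain ⟨hWsum, hWE⟩ := SymmetricSequenceSpace.summable_and_tsum_mem_ideal hsep
    (fun n => diagOp_mem_ideal hsep _ _ _) hWnorm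
  have hWsa : IsSelfAdjoint W := isSelfAdjoint_tsum_diagOp e lam
  have hWe := tsum_diagOp_apply_basis e lam hWsum
  have hf := contDiff_sqrtSeries hs
  have hf0 := sqrtSeries_zero hs
  have hfWe : ∀ n a, funCalc (sqrtSeries s) W (e ⟨n, a⟩) =
      (sqrtSeries s (lam n a) : ℂ) • e ⟨n, a⟩ := fun n a =>
    funCalc_apply_eigenvector hWsa hf.continuous (hWe n a)
  have hfWE : funCalc (sqrtSeries s) W ∈ E.ideal := by
    rw [funCalc_eq_mul hWsa hf hf0]
    exact SymmetricSequenceSpace.mul_mem_ideal_right hsep _ hWE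
  obtain ⟨v, x, hv, hXv⟩ := exists_hilbertBasis_eigenvectors e hXsa hXspan
  refine ⟨sqrtSeries s, hf, hf0, W, hWsa, hWE, diagPMap v x, phaseGroup v x,
    derivation E v x hsep, isSelfAdjoint_diagPMap v x,
    isUnitaryGroupOf_diagPMap v x, isC0Flow_phaseGroup hsep,
    isGeneratorOnIdeal_derivation hsep,
    isClosedSymmetricDerivation_derivation hsep, ?_, hfWE, fun hdom => ?_⟩
  · have hmem : ∀ n, X n (fun a => e ⟨n, a⟩) * W - W * X n (fun a => e ⟨n, a⟩) ∈ E.ideal :=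
      fun n => SymmetricSequenceSpace.sub_mem_ideal hsep
        (SymmetricSequenceSpace.mul_mem_ideal_left hsep _ hWE)
        (SymmetricSequenceSpace.mul_mem_ideal_right hsep _ hWE)
    obtain ⟨hDsum, hDE⟩ := SymmetricSequenceSpace.summable_and_tsum_mem_ideal hsep
      (fun n => SymmetricSequenceSpace.smul_mem_ideal hsep Complex.I (hmem n)) fun n => by
        refine (SymmetricSequenceSpace.idealNorm_smul_le _ (hmem n)).trans ?_
        rw [Complex.norm_I, one_mul]
        exact hcomm n W hWsa (hWe n)
    exact LinearPMap.mem_domain_of_mem_graph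
      ((mem_derivation_graph hsep).2 ⟨hWE, hDE, isFormalCommutator_tsum
        hXsa hXv (fun i j => inner_eq_zero_of_block_eigen hv hWe) hDsum⟩)
  · obtain ⟨D, hD⟩ := LinearPMap.mem_domain_iff.1 hdom
    obtain ⟨-, hDE, hDc⟩ := (mem_derivation_graph hsep).1 hD
    obtain ⟨n, hn⟩ := exists_nat_gt (E.idealNorm D)
    refine hn.not_ge (le_trans ?_ (idealNorm_commutator_le hsep hXsa hXv
      (fun i j => inner_eq_zero_of_block_eigen hv hfWe) hDE hDc n))
    exact hlarge n (sqrtSeries s) (sqrtSeries_neg s) (fun a b => sqrtSeries_sub_ge hs n) _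
      (isSelfAdjoint_funCalc _ _) (hfWe n)
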